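/- Setting. Let $\mathscr C=\mathbb R\times\mathbb S^2\subset\mathbb R\times\mathbb R^3=\mathbb R^4$ with coordinates $(V,s)$ and measure $dV\wedge d\mathbb S^2$, and let $\mathscr C_p=(0,\infty)\times\mathbb S^2\subset\mathscr C$. Test functions. $T(\mathscr C)$ is the complex vector space of all $\psi\in L^2(\mathscr C)$ whose weak derivative $\partial_V\psi$ also lies in $L^2(\mathscr C)$. Let $h\in C^\infty(\mathscr C_p,\mathbb R)$ be such that $h\to0$ uniformly on $\mathbb S^2$ as $V\to0^+$ and such that each derivative $\partial_V^nh$, $n\ge1$, tends to a constant uniformly on $\mathbb S^2$ as $V\to 0^+$ (for example $h=V$); then $\mathscr S(\mathscr C_p)=\{hf|_{\mathscr C_p}: f\in C_0^\infty(\mathbb R^4,\mathbb C)\}$, regarded as functions on $\mathscr C$ by extension by zero. Every element of $\mathscr S(\mathscr C_p)$ lies in $T(\mathscr C)$. Put $\sigma(\psi,\psi')=\int(\psi\,\partial_V\psi'-\partial_V\psi\,\psi')\,dV\wedge d\mathbb S^2$. Algebras. $\mathscr A_b(\mathscr C)$ and $\mathscr A_b(\mathscr C_p)$ are the spaces $\bigoplus_{n\ge0}\otimes_s^nT$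 (algebraic symmetric tensor powers, finite sequences) for $T=T(\mathscr C)$ and $T=\mathscr S(\mathscr C_p)$, with complex conjugation as $*$-operation and with the product, in terms of polynomial functionals, $$(F\star G)(\Phi)=\sum_{n\ge0}\frac{i^n}{2^nn!}\big\langle F^{(n)}(\Phi),\sigma^{\otimes n}G^{(n)}(\Phi)\big\rangle .$$ Two-point function and state. For $\psi,\psi'\in T(\mathscr C)$ let $$\omega(\psi,\psi')=-\frac1\pi\lim_{\epsilon\to0^+}\int_{\mathbb R^2\times\mathbb S^2}\frac{\psi(V,s)\,\psi'(V',s)}{(V-V'-i\epsilon)^2}\,dV\,dV'\,d\mathbb S^2(s).$$ The quasi-free functional with two-point function $\omega$ is the linear functional $\Omega$ whose value on every product $\psi_1\star\dots\star\psi_n$ of test functions is $\sum\prod\omega(\psi_i,\psi_j)$, the sum being over all partitions of $\{1,\dots,n\}$ into pairs and each product over the pairs $i<j$ of the partition ($1$ if $n=0$, and $0$ if $n$ is odd). Proposition. 0. The integrals defining $\omega(\psi,\psi')$ converge absolutely for every $\epsilon>0$ and the limit exists. 1. On $\mathscr A_b(\mathscr C)$, and on $\mathscr A_b(\mathscr C_p)$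 for every admissible $h$, there is exactly one quasi-free functional with two-point function $\omega$. It is an algebraic state: $\Omega(1)=1$ and $\Omega(F^*\star F)\ge0$ for all $F$. The state on $\mathscr A_b(\mathscr C_p)$ is the restriction of the state on $\mathscr A_b(\mathscr C)$. 2. $\Omega$ on $\mathscr A_b(\mathscr C)$ is a vacuum (ground state) with respect to $\partial_V$: the translations $(V,s)\mapsto(V+t,s)$ act by $*$-automorphisms $\alpha_t$ of $\mathscr A_b(\mathscr C)$, induced by $(\alpha_t\psi)(V+t,s)=\psi(V,s)$; $\Omega\circ\alpha_t=\Omega$; and for all $F,G$ the function $t\mapsto\Omega(F\star\alpha_tG)$ is continuous and bounded and satisfies $\int\hat f(t)\,\Omega(F\star\alpha_tG)\,dt=0$, where $\hat f(t)=\int e^{-itp}f(p)\,dp$, for all $f\in C_0^\infty((-\infty,0))$ (only positive frequencies). 3. $\Omega$ is invariant under changes of the local frame and under $SO_0(3,1)$ as a subgroup of the Bondi–Metzner–Sachs (BMS) group. In both cases below, the transformation acts by $*$-automorphisms of $\mathscr A_b(\mathscr C)$, $\Omega$ is invariant under them, and for $h=V$ the space $\mathscr S(\mathscr C_p)$ is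 mapped onto itself. (a) Changes of frame: for $\Lambda\in SO_0(3,1)$ write $\Lambda(1,s)=\kappa_\Lambda(s)\,(1,s')$. Then $(V,s)\mapsto(\kappa_\Lambda(s)V,s')$, which is the linear action of $\Lambda$ on the points $V(1,s)$ of the null cone, and $\psi\mapsto\psi'$ with $\psi'(\kappa_\Lambda(s)V,s')=\kappa_\Lambda(s)\,\psi(V,s)$ (so that $\psi/V$ transforms as a scalar). (b) The BMS action of $SO_0(3,1)\cong SL(2,\mathbb C)/\{\pm1\}$ (without supertranslations): in the stereographic coordinate $z$ of $\mathbb S^2$, for $\begin{pmatrix}a&b\\c&d\end{pmatrix}\in SL(2,\mathbb C)$, $$z\mapsto z'=\frac{az+b}{cz+d},\qquad V\mapsto V'=K(z)V,\qquad K(z)=\frac{1+|z|^2}{|az+b|^2+|cz+d|^2},$$ and $\psi\mapsto\psi'$ with $\psi'(V',z')=K(z)^{-1}\psi(V,z)$. -/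

import Mathlib

open MeasureTheory Filter Topology Set
open scoped TensorProduct ContDiff ENNReal Matrix

noncomputable section

namespace LightCone

/-! ### The boundary manifold `𝒞 = ℝ × S²` -/

/-- Three-dimensional Euclidean space. -/
abbrev E3 : Type := EuclideanSpace ℝ (Fin 3)

/-- The unit sphere `S²`. -/
abbrev S2 : Type := Metric.sphere (0 : E3) 1

/-- The manifold `𝒞 = ℝ × S²`; the first coordinate is `V`. The cone `𝒞_p` is its part `V > 0`. -/
abbrev Cone : Type := ℝ × S2

/-- The standard (surface) measure of the unit sphere. -/
abbrev sphereMeasure : Measure S2 := (volume : Measure E3).toSphere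

/-- The measure `dV ∧ dS²` on `𝒞`. -/
abbrev coneMeasure : Measure Cone := (volume : Measure ℝ).prod sphereMeasure

/-- `L²(𝒞, dV ∧ dS²)`, complex valued. -/
abbrev L2Cone : Type := Lp ℂ 2 coneMeasure

/-- The inclusion of `𝒞 = ℝ × S²` into `ℝ × ℝ³ = ℝ⁴`. -/
def incl (x : Cone) : ℝ × E3 := (x.1, (x.2 : E3))

/-! ### Square integrable functions with square integrable weak `V`-derivative -/

/-- `dψ` is the weak `V`-derivative of `ψ`: `∫ ψ ∂_V χ = - ∫ dψ χ` for all test functions `χ`.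
The smooth compactly supported functions on the closed submanifold `ℝ × S²` of `ℝ⁴` are exactly
the restrictions of smooth compactly supported functions on `ℝ⁴`. -/
def IsWeakVDeriv (ψ dψ : L2Cone) : Prop :=
  ∀ χ : ℝ × E3 → ℝ, ContDiff ℝ ∞ χ → HasCompactSupport χ →
    ∫ x, ψ x * ((fderiv ℝ χ (incl x) (1, 0) : ℝ) : ℂ) ∂coneMeasure
      = - ∫ x, dψ x * ((χ (incl x) : ℝ) : ℂ) ∂coneMeasure

lemma isClosedEmbedding_incl : IsClosedEmbedding incl :=
  IsClosedEmbedding.prodMap IsClosedEmbedding.id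
    (Metric.isClosed_sphere (x := (0 : E3)) (ε := 1)).isClosedEmbedding_subtypeVal

lemma integrable_mul_test (ψ : L2Cone) {g : ℝ × E3 → ℝ} (hg : Continuous g)
    (hs : HasCompactSupport g) :
    Integrable (fun x => ψ x * ((g (incl x) : ℝ) : ℂ)) coneMeasure := by
  have hc : Continuous fun x : Cone => ((g (incl x) : ℝ) : ℂ) :=
    Complex.continuous_ofReal.comp (hg.comp isClosedEmbedding_incl.continuous)
  have hs' : HasCompactSupport fun x : Cone => ((g (incl x) : ℝ) : ℂ) :=
    (hs.comp_isClosedEmbedding isClosedEmbedding_incl).comp_left (g := fun r : ℝ => (r : ℂ))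
      Complex.ofReal_zero
  exact (Lp.memLp ψ).integrable_mul (hc.memLp_of_hasCompactSupport (p := 2) hs')

lemma continuous_fderiv_test {χ : ℝ × E3 → ℝ} (h : ContDiff ℝ ∞ χ) :
    Continuous fun y => fderiv ℝ χ y (1, 0) :=
  (h.continuous_fderiv (by simp)).clm_apply continuous_const

lemma hasCompactSupport_fderiv_test {χ : ℝ × E3 → ℝ} (h : HasCompactSupport χ) :
    HasCompactSupport fun y => fderiv ℝ χ y (1, 0) :=
  h.fderiv_apply ℝ (1, 0)

/-- The test functions on `𝒞`: all `ψ ∈ L²(𝒞)` with weak derivative `∂_V ψ ∈ L²(𝒞)`. An element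
is stored as the pair `(ψ, ∂_V ψ)`; the second entry is determined by the first one. -/
def TestSpace : Submodule ℂ (L2Cone × L2Cone) where
  carrier := {p | IsWeakVDeriv p.1 p.2}
  zero_mem' := by
    intro χ _ _
    have h0 : ((0 : L2Cone) : Cone → ℂ) =ᵐ[coneMeasure] 0 := Lp.coeFn_zero _ _ _
    have h1 : ∀ g : Cone → ℂ, ∫ x, (0 : L2Cone) x * g x ∂coneMeasure = 0 := by
      intro g
      refine integral_eq_zero_of_ae ?_
      filter_upwards [h0] with x hx
      rw [hx, Pi.zero_apply, zero_mul]
    change ∫ x, (0 : L2Cone) x * _ ∂coneMeasure = - ∫ x, (0 : L2Cone) x * _ ∂coneMeasure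
    rw [h1, h1, neg_zero]
  add_mem' := by
    intro a b ha hb χ hχ hs
    have key : ∀ (u v : L2Cone) (g : ℝ × E3 → ℝ), Continuous g → HasCompactSupport g →
        ∫ x, (u + v : L2Cone) x * ((g (incl x) : ℝ) : ℂ) ∂coneMeasure
          = ∫ x, u x * ((g (incl x) : ℝ) : ℂ) ∂coneMeasure
            + ∫ x, v x * ((g (incl x) : ℝ) : ℂ) ∂coneMeasure := by
      intro u v g hg hgs
      rw [← integral_add (integrable_mul_test u hg hgs) (integrable_mul_test v hg hgs)]
      refine integral_congr_ae ?_
      filter_upwards [Lp.coeFn_add u v] with x hx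
      rw [hx, Pi.add_apply, add_mul]
    have h1 := key a.1 b.1 _ (continuous_fderiv_test hχ) (hasCompactSupport_fderiv_test hs)
    have h2 := key a.2 b.2 χ hχ.continuous hs
    change ∫ x, (a.1 + b.1 : L2Cone) x * _ ∂coneMeasure
      = - ∫ x, (a.2 + b.2 : L2Cone) x * _ ∂coneMeasure
    rw [h1, h2, ha χ hχ hs, hb χ hχ hs]
    ring
  smul_mem' := by
    intro c a ha χ hχ hs
    have key : ∀ (u : L2Cone) (g : Cone → ℂ),
        ∫ x, (c • u : L2Cone) x * g x ∂coneMeasure = c * ∫ x, u x * g x ∂coneMeasure := by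
      intro u g
      rw [← integral_const_mul]
      refine integral_congr_ae ?_
      filter_upwards [Lp.coeFn_smul c u] with x hx
      rw [hx, Pi.smul_apply, smul_eq_mul, mul_assoc]
    change ∫ x, (c • a.1 : L2Cone) x * _ ∂coneMeasure
      = - ∫ x, (c • a.2 : L2Cone) x * _ ∂coneMeasure
    rw [key, key, ha χ hχ hs]
    ring

/-- The function underlying a test function. -/
def toL2 (ψ : TestSpace) : L2Cone := ψ.1.1

lemma integrable_mul_L2 (u v : L2Cone) : Integrable (fun x => u x * v x) coneMeasure :=
  (Lp.memLp u).integrable_mul (Lp.memLp v)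

/-- The bilinear pairing `(u, v) ↦ ∫ u v dV ∧ dS²`. -/
def pairing : L2Cone →ₗ[ℂ] L2Cone →ₗ[ℂ] ℂ :=
  LinearMap.mk₂ ℂ (fun u v => ∫ x, u x * v x ∂coneMeasure)
    (by
      intro u u' v
      rw [← integral_add (integrable_mul_L2 u v) (integrable_mul_L2 u' v)]
      refine integral_congr_ae ?_
      filter_upwards [Lp.coeFn_add u u'] with x hx
      rw [hx, Pi.add_apply, add_mul])
    (by
      intro c u v
      rw [smul_eq_mul, ← integral_const_mul]
      refine integral_congr_ae ?_
      filter_upwards [Lp.coeFn_smul c u] with x hx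
      rw [hx, Pi.smul_apply, smul_eq_mul, mul_assoc])
    (by
      intro u v v'
      rw [← integral_add (integrable_mul_L2 u v) (integrable_mul_L2 u v')]
      refine integral_congr_ae ?_
      filter_upwards [Lp.coeFn_add v v'] with x hx
      rw [hx, Pi.add_apply, mul_add])
    (by
      intro c u v
      rw [smul_eq_mul, ← integral_const_mul]
      refine integral_congr_ae ?_
      filter_upwards [Lp.coeFn_smul c v] with x hx
      rw [hx, Pi.smul_apply, smul_eq_mul]
      ring)

/-- `ψ ↦ ψ` as a linear map to `L²`. -/
def toL2ₗ : TestSpace →ₗ[ℂ] L2Cone := LinearMap.fst ℂ L2Cone L2Cone ∘ₗ TestSpace.subtype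

/-- `ψ ↦ ∂_V ψ` as a linear map to `L²`. -/
def dVₗ : TestSpace →ₗ[ℂ] L2Cone := LinearMap.snd ℂ L2Cone L2Cone ∘ₗ TestSpace.subtype

/-- The symplectic form `σ(ψ, ψ') = ∫ (ψ ∂_V ψ' - ∂_V ψ ψ') dV ∧ dS²`. -/
def sympl : TestSpace →ₗ[ℂ] TestSpace →ₗ[ℂ] ℂ :=
  pairing.compl₁₂ toL2ₗ dVₗ - pairing.compl₁₂ dVₗ toL2ₗ

lemma star_test_integral (u : L2Cone) (g : Cone → ℝ) :
    ∫ x, (star u : L2Cone) x * ((g x : ℝ) : ℂ) ∂coneMeasure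
      = (starRingEnd ℂ) (∫ x, u x * ((g x : ℝ) : ℂ) ∂coneMeasure) := by
  rw [← integral_conj]
  refine integral_congr_ae ?_
  filter_upwards [Lp.coeFn_star u] with x hx
  rw [hx, map_mul, Complex.conj_ofReal]
  rfl

lemma star_mem {ψ : L2Cone × L2Cone} (h : ψ ∈ TestSpace) : (star ψ.1, star ψ.2) ∈ TestSpace := by
  intro χ hχ hs
  change ∫ x, (star ψ.1 : L2Cone) x * _ ∂coneMeasure
    = - ∫ x, (star ψ.2 : L2Cone) x * _ ∂coneMeasure
  rw [star_test_integral ψ.1 (fun x => fderiv ℝ χ (incl x) (1, 0)),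
    star_test_integral ψ.2 (fun x => χ (incl x)), h χ hχ hs, map_neg]

lemma star_smul_L2 (c : ℂ) (u : L2Cone) : star (c • u) = (starRingEnd ℂ) c • star u := by
  refine Lp.ext ?_
  filter_upwards [Lp.coeFn_star (c • u), Lp.coeFn_star u, Lp.coeFn_smul c u,
    Lp.coeFn_smul ((starRingEnd ℂ) c) (star u)] with x h1 h2 h3 h4
  rw [h1, Pi.star_apply, h3, h4, Pi.smul_apply, Pi.smul_apply, h2, Pi.star_apply, star_smul]
  rfl

lemma star_add_L2 (u v : L2Cone) : star (u + v) = star u + star v := by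
  refine Lp.ext ?_
  filter_upwards [Lp.coeFn_star (u + v), Lp.coeFn_star u, Lp.coeFn_star v, Lp.coeFn_add u v,
    Lp.coeFn_add (star u) (star v)] with x h1 h2 h3 h4 h5
  rw [h1, Pi.star_apply, h4, h5, Pi.add_apply, Pi.add_apply, h2, h3, star_add, Pi.star_apply,
    Pi.star_apply]

/-- Pointwise complex conjugation of test functions. -/
def conjTest : TestSpace →ₛₗ[starRingEnd ℂ] TestSpace where
  toFun ψ := ⟨(star ψ.1.1, star ψ.1.2), star_mem ψ.2⟩
  map_add' ψ χ := by
    refine Subtype.ext (Prod.ext ?_ ?_)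
    · exact star_add_L2 ψ.1.1 χ.1.1
    · exact star_add_L2 ψ.1.2 χ.1.2
  map_smul' c ψ := by
    refine Subtype.ext (Prod.ext ?_ ?_)
    · exact star_smul_L2 c ψ.1.1
    · exact star_smul_L2 c ψ.1.2

/-! ### The spaces `𝒮(𝒞_p)` -/

/-- The weight functions `h ∈ C^∞(𝒞_p)` (smooth functions on the closed submanifold
`(0, ∞) × S²` of `(0, ∞) × ℝ³`, given by a smooth extension): `h` tends to `0` uniformly on `S²`
as `V → 0`, and each `V`-derivative of `h` tends uniformly on `S²` to a constant. -/
structure IsConeWeight (h : ℝ × E3 → ℝ) : Prop where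
  smooth : ContDiffOn ℝ ∞ h (Ioi 0 ×ˢ univ)
  vanish : TendstoUniformly (fun (V : ℝ) (s : S2) => h (V, (s : E3))) (fun _ => 0) (𝓝[>] 0)
  deriv_tendsto : ∀ n : ℕ, 1 ≤ n → ∃ c : ℝ,
    TendstoUniformly (fun (V : ℝ) (s : S2) => iteratedDeriv n (fun v => h (v, (s : E3))) V)
      (fun _ => c) (𝓝[>] 0)

/-- The function `h f` on `𝒞_p`, extended by zero to `𝒞`. -/
def coneFun (h : ℝ × E3 → ℝ) (f : ℝ × E3 → ℂ) (x : Cone) : ℂ :=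
  if 0 < x.1 then (h (incl x) : ℂ) * f (incl x) else 0

/-- `𝒮(𝒞_p) = {h f : f ∈ C₀^∞(ℝ⁴)}`, the functions being extended by zero from `𝒞_p` to `𝒞`. -/
def coneTest (h : ℝ × E3 → ℝ) : Submodule ℂ TestSpace where
  carrier := {ψ | ∃ f : ℝ × E3 → ℂ, ContDiff ℝ ∞ f ∧ HasCompactSupport f ∧
    (toL2 ψ : Cone → ℂ) =ᵐ[coneMeasure] coneFun h f}
  zero_mem' := by
    refine ⟨0, contDiff_const, HasCompactSupport.zero, ?_⟩
    have h0 : ((0 : L2Cone) : Cone → ℂ) =ᵐ[coneMeasure] 0 := Lp.coeFn_zero _ _ _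
    change ((0 : L2Cone) : Cone → ℂ) =ᵐ[coneMeasure] _
    filter_upwards [h0] with x hx
    rw [hx]
    simp [coneFun]
  add_mem' := by
    rintro a b ⟨f, hf, hfs, hfa⟩ ⟨g, hg, hgs, hga⟩
    refine ⟨f + g, hf.add hg, hfs.add hgs, ?_⟩
    change ((toL2 a + toL2 b : L2Cone) : Cone → ℂ) =ᵐ[coneMeasure] _
    filter_upwards [hfa, hga, Lp.coeFn_add (toL2 a) (toL2 b)] with x h1 h2 h3
    rw [h3, Pi.add_apply, h1, h2]
    unfold coneFun
    split_ifs
    · simp [mul_add]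
    · simp
  smul_mem' := by
    rintro c a ⟨f, hf, hfs, hfa⟩
    refine ⟨c • f, contDiff_const.smul hf, hfs.smul_left (f := fun _ => c), ?_⟩
    change ((c • toL2 a : L2Cone) : Cone → ℂ) =ᵐ[coneMeasure] _
    filter_upwards [hfa, Lp.coeFn_smul c (toL2 a)] with x h1 h3
    rw [h3, Pi.smul_apply, h1]
    unfold coneFun
    split_ifs
    · simp only [smul_eq_mul, Pi.smul_apply]
      ring
    · simp

lemma conj_mem_coneTest {h : ℝ × E3 → ℝ} {ψ : TestSpace} (hψ : ψ ∈ coneTest h) :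
    conjTest ψ ∈ coneTest h := by
  obtain ⟨f, hf, hfs, hfa⟩ := hψ
  refine ⟨fun y => (starRingEnd ℂ) (f y), Complex.conjCLE.contDiff.comp hf,
    hfs.comp_left (g := starRingEnd ℂ) (map_zero _), ?_⟩
  change ((star (toL2 ψ) : L2Cone) : Cone → ℂ) =ᵐ[coneMeasure] _
  filter_upwards [hfa, Lp.coeFn_star (toL2 ψ)] with x h1 h2
  rw [h2, Pi.star_apply, h1]
  unfold coneFun
  split_ifs
  · simp
  · simp

/-- Complex conjugation on `𝒮(𝒞_p)`. -/
def conjCone (h : ℝ × E3 → ℝ) : coneTest h →ₛₗ[starRingEnd ℂ] coneTest h where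
  toFun ψ := ⟨conjTest ψ.1, conj_mem_coneTest ψ.2⟩
  map_add' ψ χ := Subtype.ext (map_add conjTest ψ.1 χ.1)
  map_smul' c ψ := Subtype.ext (map_smulₛₗ conjTest c ψ.1)

/-- The symplectic form restricted to `𝒮(𝒞_p)`. -/
def symplCone (h : ℝ × E3 → ℝ) : coneTest h →ₗ[ℂ] coneTest h →ₗ[ℂ] ℂ :=
  sympl.compl₁₂ (coneTest h).subtype (coneTest h).subtype

/-! ### The algebras

For a complex vector space `T` of test functions the underlying vector space `⨁ₙ ⊗ₛⁿ T` (finite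
sequences) is the symmetric algebra of `T`; its commutative product is the symmetrised tensor
product, i.e. the pointwise product of polynomial functionals. -/

section Algebra

variable {T T' : Type} [AddCommGroup T] [Module ℂ T] [AddCommGroup T'] [Module ℂ T']

/-- The vector space `⨁ₙ ⊗ₛⁿ T`. -/
abbrev FieldAlg (T : Type) [AddCommGroup T] [Module ℂ T] : Type := SymmetricAlgebra ℂ T

/-- The smeared field, i.e. the linear functional `Φ ↦ ⟨ψ, Φ⟩`. -/
abbrev field (ψ : T) : FieldAlg T := SymmetricAlgebra.ι ℂ T ψ

/-- The functional derivative `F ↦ F^{(1)}`: the derivation with `ψ ↦ 1 ⊗ ψ`. -/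
def funDeriv : FieldAlg T →ₗ[ℂ] FieldAlg T ⊗[ℂ] T :=
  (TrivSqZeroExt.sndHom (FieldAlg T) (FieldAlg T ⊗[ℂ] T)).restrictScalars ℂ ∘ₗ
    (SymmetricAlgebra.lift (R := ℂ) (M := T)
      (A := TrivSqZeroExt (FieldAlg T) (FieldAlg T ⊗[ℂ] T))
      ((TrivSqZeroExt.inlAlgHom ℂ (FieldAlg T) (FieldAlg T ⊗[ℂ] T)).toLinearMap
          ∘ₗ SymmetricAlgebra.ι ℂ T
        + (TrivSqZeroExt.inrHom (FieldAlg T) (FieldAlg T ⊗[ℂ] T)).restrictScalars ℂ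
          ∘ₗ TensorProduct.mk ℂ (FieldAlg T) T 1)).toLinearMap

/-- The operator `F ⊗ G ↦ ⟨F^{(1)}, σ G^{(1)}⟩`: one functional derivative on each factor,
contracted with the bilinear form `σ`. Its `n`-th power is
`F ⊗ G ↦ ⟨F^{(n)}, σ^{⊗ n} G^{(n)}⟩`. -/
def contraction (σ : T →ₗ[ℂ] T →ₗ[ℂ] ℂ) :
    FieldAlg T ⊗[ℂ] FieldAlg T →ₗ[ℂ] FieldAlg T ⊗[ℂ] FieldAlg T :=
  (TensorProduct.rid ℂ (FieldAlg T ⊗[ℂ] FieldAlg T)).toLinearMap ∘ₗ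
    LinearMap.lTensor (FieldAlg T ⊗[ℂ] FieldAlg T) (TensorProduct.lift σ) ∘ₗ
      (TensorProduct.tensorTensorTensorComm ℂ (FieldAlg T) T (FieldAlg T) T).toLinearMap ∘ₗ
        TensorProduct.map funDeriv funDeriv

/-- The product
`F ⋆ G = ∑ₙ iⁿ / (2ⁿ n!) ⟨F^{(n)}, σ^{⊗ n} G^{(n)}⟩` (only finitely many terms are nonzero). -/
def starProd (σ : T →ₗ[ℂ] T →ₗ[ℂ] ℂ) (F G : FieldAlg T) : FieldAlg T :=
  ∑ᶠ n : ℕ, (Complex.I ^ n / (2 ^ n * (n.factorial : ℂ))) •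
    LinearMap.mul' ℂ (FieldAlg T) (((contraction σ) ^ n) (F ⊗ₜ[ℂ] G))

/-- The ring `⨁ₙ ⊗ₛⁿ T` with scalars acting through complex conjugation. -/
def ConjAlg (T : Type) [AddCommGroup T] [Module ℂ T] : Type := FieldAlg T

instance : CommRing (ConjAlg T) := inferInstanceAs (CommRing (FieldAlg T))

instance : Algebra ℂ (ConjAlg T) :=
  RingHom.toAlgebra ((algebraMap ℂ (FieldAlg T)).comp (starRingEnd ℂ))

/-- The field smeared with the conjugate test function, as a linear map to `ConjAlg T`. -/
def conjField (c : T →ₛₗ[starRingEnd ℂ] T) : T →ₗ[ℂ] ConjAlg T where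
  toFun ψ := (field (c ψ) : FieldAlg T)
  map_add' ψ χ := by
    rw [map_add]
    exact map_add (SymmetricAlgebra.ι ℂ T) _ _
  map_smul' a ψ := by
    rw [map_smulₛₗ]
    exact (map_smul (SymmetricAlgebra.ι ℂ T) _ _).trans (Algebra.smul_def _ _)

/-- The `*`-operation: complex conjugation `{Fₙ} ↦ {conj Fₙ}`, where `c` is the conjugation
of test functions. -/
def starOp (c : T →ₛₗ[starRingEnd ℂ] T) (F : FieldAlg T) : FieldAlg T :=
  (SymmetricAlgebra.lift (conjField c) F : ConjAlg T)

/-- The map of algebras induced by a linear map of test functions. -/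
def secondQuant (U : T →ₗ[ℂ] T') : FieldAlg T →ₐ[ℂ] FieldAlg T' :=
  SymmetricAlgebra.lift (SymmetricAlgebra.ι ℂ T' ∘ₗ U)

/-- The product `ψ₁ ⋆ ⋯ ⋆ ψₙ` of smeared fields. -/
def fieldProd (σ : T →ₗ[ℂ] T →ₗ[ℂ] ℂ) : (n : ℕ) → (Fin n → T) → FieldAlg T
  | 0, _ => 1
  | n + 1, ψ => starProd σ (field (ψ 0)) (fieldProd σ n (Fin.tail ψ))

/-- Quasi-free `n`-point functions: the sum over all partitions of `{1, …, n}` into ordered pairs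
`i < j` of the products of `w (ψ i) (ψ j)` (so `1` for `n = 0` and `0` for odd `n`), organised by
the partner of the first entry. -/
def wick (w : T → T → ℂ) : (n : ℕ) → (Fin n → T) → ℂ
  | 0, _ => 1
  | 1, _ => 0
  | n + 2, ψ => ∑ j : Fin (n + 1), w (ψ 0) (ψ j.succ) * wick w n (Fin.removeNth j (Fin.tail ψ))

/-- `Ω` is the quasi-free functional with two-point function `w`. -/
def IsQuasiFree (σ : T →ₗ[ℂ] T →ₗ[ℂ] ℂ) (w : T → T → ℂ) (Ω : FieldAlg T →ₗ[ℂ] ℂ) : Prop :=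
  ∀ (n : ℕ) (ψ : Fin n → T), Ω (fieldProd σ n ψ) = wick w n ψ

/-- `Ω` is an algebraic state: normalised, and `Ω(F* ⋆ F)` is a nonnegative real number. -/
def IsAlgState (σ : T →ₗ[ℂ] T →ₗ[ℂ] ℂ) (c : T →ₛₗ[starRingEnd ℂ] T)
    (Ω : FieldAlg T →ₗ[ℂ] ℂ) : Prop :=
  Ω 1 = 1 ∧ ∀ F : FieldAlg T,
    0 ≤ (Ω (starProd σ (starOp c F) F)).re ∧ (Ω (starProd σ (starOp c F) F)).im = 0

end Algebra

/-! ### The two-point function -/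

/-- The integrand `ψ(V, s) ψ'(V', s) / (V - V' - i ε)²`, as a function of `(V, V', s)`. -/
def twoPointIntegrand (ε : ℝ) (ψ ψ' : TestSpace) (y : ℝ × ℝ × S2) : ℂ :=
  toL2 ψ (y.1, y.2.2) * toL2 ψ' (y.2.1, y.2.2) /
    ((y.1 : ℂ) - (y.2.1 : ℂ) - Complex.I * (ε : ℂ)) ^ 2

/-- The measure `dV dV' dS²`. -/
abbrev twoPointMeasure : Measure (ℝ × ℝ × S2) :=
  (volume : Measure ℝ).prod ((volume : Measure ℝ).prod sphereMeasure)

/-- The regularised two-point function at `ε`. -/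
def regTwoPoint (ε : ℝ) (ψ ψ' : TestSpace) : ℂ :=
  -(1 / (Real.pi : ℂ)) * ∫ y, twoPointIntegrand ε ψ ψ' y ∂twoPointMeasure

/-- The two-point function `ω(ψ, ψ')`, the limit `ε → 0⁺` of the regularised one. -/
def twoPoint (ψ ψ' : TestSpace) : ℂ :=
  limUnder (𝓝[>] (0 : ℝ)) fun ε => regTwoPoint ε ψ ψ'

/-! ### Transformations of `𝒞` -/

/-- `U` is the action on test functions of the transformation `g` of `𝒞` with weight `w`:
`(U ψ)(g x) = w(x) ψ(x)`. -/
def Implements (g : Cone → Cone) (w : Cone → ℝ) (U : TestSpace →ₗ[ℂ] TestSpace) : Prop :=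
  ∀ ψ : TestSpace, ∀ᵐ x ∂coneMeasure, toL2 (U ψ) (g x) = (w x : ℂ) * toL2 ψ x

/-- The transformation `g` with weight `w` acts on the test functions in exactly one way, this
action induces a `*`-automorphism of `𝒜_b(𝒞)`, and `Ω` is invariant under it. -/
def IsInvariantUnder (Ω : FieldAlg TestSpace →ₗ[ℂ] ℂ) (g : Cone → Cone) (w : Cone → ℝ) : Prop :=
  (∃! U : TestSpace →ₗ[ℂ] TestSpace, Implements g w U) ∧
  ∀ U : TestSpace →ₗ[ℂ] TestSpace, Implements g w U →
    Function.Bijective (secondQuant U) ∧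
    (∀ F G, secondQuant U (starProd sympl F G)
      = starProd sympl (secondQuant U F) (secondQuant U G)) ∧
    (∀ F, secondQuant U (starOp conjTest F) = starOp conjTest (secondQuant U F)) ∧
    ∀ F, Ω (secondQuant U F) = Ω F

/-- The action of `g` with weight `w` maps `𝒮(𝒞_p)`, for the choice `h = V`, onto itself. -/
def PreservesConeTest (g : Cone → Cone) (w : Cone → ℝ) : Prop :=
  ∀ U : TestSpace →ₗ[ℂ] TestSpace, Implements g w U →
    (coneTest fun y => y.1).map U = coneTest fun y => y.1

/-- The flow of `∂_V`. -/
def translate (t : ℝ) (x : Cone) : Cone := (x.1 + t, x.2)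

/-- `Ω` is a vacuum (ground state) for the flow of `∂_V`: it is invariant, and for the induced
automorphisms `α_t` and all `F`, `G` the function `t ↦ Ω(F ⋆ α_t G)` is continuous and bounded and
contains no negative frequencies, that is
`∫ f̂(t) Ω(F ⋆ α_t G) dt = 0` with `f̂(t) = ∫ exp(-i t p) f(p) dp`, for `f ∈ C₀^∞((-∞, 0))`. -/
def IsVacuum (Ω : FieldAlg TestSpace →ₗ[ℂ] ℂ) : Prop :=
  (∀ t : ℝ, IsInvariantUnder Ω (translate t) fun _ => 1) ∧
  ∀ U : ℝ → TestSpace →ₗ[ℂ] TestSpace, (∀ t, Implements (translate t) (fun _ => 1) (U t)) →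
    ∀ F G : FieldAlg TestSpace,
      Continuous (fun t => Ω (starProd sympl F (secondQuant (U t) G))) ∧
      (∃ B : ℝ, ∀ t, ‖Ω (starProd sympl F (secondQuant (U t) G))‖ ≤ B) ∧
      ∀ f : ℝ → ℂ, ContDiff ℝ ∞ f → HasCompactSupport f → tsupport f ⊆ Iio 0 →
        ∫ t : ℝ, (∫ p : ℝ, Complex.exp (-Complex.I * t * p) * f p) *
          Ω (starProd sympl F (secondQuant (U t) G)) = 0

/-! ### Change of frame: the linear action of `SO₀(3,1)` on the null cone -/

/-- The Minkowski metric. -/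
def minkowski : Matrix (Fin 4) (Fin 4) ℝ := Matrix.diagonal ![-1, 1, 1, 1]

/-- The group `SO₀(3,1)`: proper orthochronous Lorentz matrices. -/
def SO031 : Set (Matrix (Fin 4) (Fin 4) ℝ) :=
  {Λ | Λᵀ * minkowski * Λ = minkowski ∧ Λ.det = 1 ∧ 0 < Λ 0 0}

/-- The null vector `(1, s)`. -/
def nullVec (s : S2) : Fin 4 → ℝ := ![1, (s : E3) 0, (s : E3) 1, (s : E3) 2]

/-- The time component of `Λ (1, s)`. -/
def boost (Λ : Matrix (Fin 4) (Fin 4) ℝ) (s : S2) : ℝ := (Λ *ᵥ nullVec s) 0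

lemma lorentz_null {Λ : Matrix (Fin 4) (Fin 4) ℝ} (hΛ : Λ ∈ SO031) (s : S2) :
    (Λ *ᵥ nullVec s) 1 ^ 2 + (Λ *ᵥ nullVec s) 2 ^ 2 + (Λ *ᵥ nullVec s) 3 ^ 2 = boost Λ s ^ 2 := by
  have hq : ∀ v : Fin 4 → ℝ, v ⬝ᵥ (minkowski *ᵥ v) = -(v 0) ^ 2 + v 1 ^ 2 + v 2 ^ 2 + v 3 ^ 2 := by
    intro v
    simp [minkowski, Matrix.mulVec_diagonal, dotProduct, Fin.sum_univ_four]
    ring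
  have h1 : (Λ *ᵥ nullVec s) ⬝ᵥ (minkowski *ᵥ (Λ *ᵥ nullVec s))
      = nullVec s ⬝ᵥ (minkowski *ᵥ nullVec s) := by
    conv_rhs => rw [← hΛ.1]
    rw [← Matrix.mulVec_mulVec, ← Matrix.mulVec_mulVec, Matrix.dotProduct_mulVec _ Λᵀ,
      Matrix.vecMul_transpose]
  have h2 : (s : E3) 0 ^ 2 + (s : E3) 1 ^ 2 + (s : E3) 2 ^ 2 = 1 := by
    have h := mem_sphere_zero_iff_norm.1 s.2
    have h' := EuclideanSpace.norm_sq_eq (s : E3)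
    rw [h] at h'
    simpa [Fin.sum_univ_three] using h'.symm
  rw [hq, hq] at h1
  have h3 : -(nullVec s 0) ^ 2 + nullVec s 1 ^ 2 + nullVec s 2 ^ 2 + nullVec s 3 ^ 2 = 0 := by
    simp [nullVec]
    linarith
  rw [h3] at h1
  unfold boost
  linarith

lemma boost_ne_zero {Λ : Matrix (Fin 4) (Fin 4) ℝ} (hΛ : Λ ∈ SO031) (s : S2) :
    boost Λ s ≠ 0 := by
  intro h0
  have h := lorentz_null hΛ s
  rw [h0] at h
  have e1 : (Λ *ᵥ nullVec s) 1 = 0 := by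
    nlinarith [sq_nonneg ((Λ *ᵥ nullVec s) 2),
      sq_nonneg ((Λ *ᵥ nullVec s) 3), sq_nonneg ((Λ *ᵥ nullVec s) 1)]
  have e2 : (Λ *ᵥ nullVec s) 2 = 0 := by
    nlinarith [sq_nonneg ((Λ *ᵥ nullVec s) 2),
      sq_nonneg ((Λ *ᵥ nullVec s) 3), sq_nonneg ((Λ *ᵥ nullVec s) 1)]
  have e3 : (Λ *ᵥ nullVec s) 3 = 0 := by
    nlinarith [sq_nonneg ((Λ *ᵥ nullVec s) 2),
      sq_nonneg ((Λ *ᵥ nullVec s) 3), sq_nonneg ((Λ *ᵥ nullVec s) 1)]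
  have hz : Λ *ᵥ nullVec s = 0 := by
    ext i
    fin_cases i
    · exact h0
    · exact e1
    · exact e2
    · exact e3
  have hdet : Λ.det ≠ 0 := by rw [hΛ.2.1]; exact one_ne_zero
  have hv := Matrix.eq_zero_of_mulVec_eq_zero hdet hz
  have := congrFun hv 0
  simp [nullVec] at this

/-- The action of `Λ` on the celestial sphere: `Λ (1, s)` is the multiple `boost Λ s` of
`(1, celestial Λ s)`. -/
def celestial (Λ : SO031) (s : S2) : S2 :=
  ⟨(boost Λ.1 s)⁻¹ • !₂[(Λ.1 *ᵥ nullVec s) 1, (Λ.1 *ᵥ nullVec s) 2, (Λ.1 *ᵥ nullVec s) 3], by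
    have h1 := lorentz_null Λ.2 s
    have h2 := boost_ne_zero Λ.2 s
    rw [mem_sphere_zero_iff_norm]
    have : ‖(boost Λ.1 s)⁻¹ • (!₂[(Λ.1 *ᵥ nullVec s) 1, (Λ.1 *ᵥ nullVec s) 2,
        (Λ.1 *ᵥ nullVec s) 3] : E3)‖ ^ 2 = 1 := by
      rw [norm_smul, mul_pow, EuclideanSpace.norm_sq_eq]
      simp only [Fin.sum_univ_three, Real.norm_eq_abs, sq_abs]
      simp only [Matrix.cons_val]
      rw [h1, inv_pow]
      exact inv_mul_cancel₀ (pow_ne_zero 2 h2)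
    exact (pow_eq_one_iff_of_nonneg (norm_nonneg _) two_ne_zero).1 this⟩

/-- A change of frame by `Λ`: identifying `(V, s) ∈ 𝒞` with the point `V (1, s)` of the null cone
of the tangent space, this is the linear action of `Λ`. -/
def frameChange (Λ : SO031) (x : Cone) : Cone := (boost Λ.1 x.2 * x.1, celestial Λ x.2)

/-- The weight of a change of frame: if `ψ = V φ`, then `φ` transforms as a scalar function on
the cone. -/
def frameWeight (Λ : SO031) (x : Cone) : ℝ := boost Λ.1 x.2

/-! ### The action of `SO₀(3,1) ≅ SL(2,ℂ)/{±1}` as a subgroup of the BMS group -/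

/-- The inverse of the stereographic projection `z = (s₀ + i s₁) / (1 - s₂)` of `S²` onto the
Riemann sphere. -/
def invStereo : OnePoint ℂ → S2
  | none => ⟨!₂[0, 0, 1], by
      rw [mem_sphere_zero_iff_norm, EuclideanSpace.norm_eq]
      simp [Fin.sum_univ_three]⟩
  | some z => ⟨(1 + Complex.normSq z)⁻¹ • !₂[2 * z.re, 2 * z.im, Complex.normSq z - 1], by
      have h2 : 1 + Complex.normSq z ≠ 0 := by
        have := Complex.normSq_nonneg z
        positivity
      rw [mem_sphere_zero_iff_norm]
      have : ‖(1 + Complex.normSq z)⁻¹ • (!₂[2 * z.re, 2 * z.im, Complex.normSq z - 1] : E3)‖ ^ 2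
          = 1 := by
        rw [norm_smul, mul_pow, EuclideanSpace.norm_sq_eq]
        simp only [Fin.sum_univ_three, Real.norm_eq_abs, sq_abs]
        simp only [Matrix.cons_val]
        have h3 : (2 * z.re) ^ 2 + (2 * z.im) ^ 2 + (Complex.normSq z - 1) ^ 2
            = (1 + Complex.normSq z) ^ 2 := by
          rw [Complex.normSq_apply]; ring
        rw [h3, inv_pow]
        exact inv_mul_cancel₀ (pow_ne_zero 2 h2)
      exact (pow_eq_one_iff_of_nonneg (norm_nonneg _) two_ne_zero).1 this⟩

/-- The stereographic projection of `S²` onto the Riemann sphere. -/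
def stereo (s : S2) : OnePoint ℂ :=
  if (s : E3) 2 = 1 then OnePoint.infty
  else (((((s : E3) 0 : ℝ) : ℂ) + Complex.I * (((s : E3) 1 : ℝ) : ℂ))
    / (1 - (((s : E3) 2 : ℝ) : ℂ)) : ℂ)

/-- The action `z ↦ (a z + b) / (c z + d)` of `SL(2,ℂ)` on `S²`. -/
def mobius (A : Matrix.SpecialLinearGroup (Fin 2) ℂ) (s : S2) : S2 :=
  invStereo ((A : GL (Fin 2) ℂ) • stereo s)

/-- The conformal factor `K(z) = (1 + |z|²) / (|a z + b|² + |c z + d|²)` on the Riemann sphere. -/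
def bmsFactor (A : Matrix.SpecialLinearGroup (Fin 2) ℂ) : OnePoint ℂ → ℝ
  | none => 1 / (Complex.normSq (A.1 0 0) + Complex.normSq (A.1 1 0))
  | some z => (1 + Complex.normSq z) /
      (Complex.normSq (A.1 0 0 * z + A.1 0 1) + Complex.normSq (A.1 1 0 * z + A.1 1 1))

/-- The element `A ∈ SL(2,ℂ)` of the BMS group acts on `𝒞` by
`V ↦ K(z) V`, `z ↦ (a z + b) / (c z + d)`. -/
def bmsMap (A : Matrix.SpecialLinearGroup (Fin 2) ℂ) (x : Cone) : Cone :=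
  (bmsFactor A (stereo x.2) * x.1, mobius A x.2)

/-- The weight of the BMS action on test functions: `ψ'(V', z') = K(z)⁻¹ ψ(V, z)`. -/
def bmsWeight (A : Matrix.SpecialLinearGroup (Fin 2) ℂ) (x : Cone) : ℝ :=
  (bmsFactor A (stereo x.2))⁻¹

end LightCone

end

open LightCone

/-! Everything follows from one formula. The Fourier transform in `V` along each generator turns the
kernel `-1/(π (V - V' - iε)²)` into the multiplier `4πk exp(-2πkε)` on `k > 0`. As `ε → 0⁺` the
two-point function becomes `ω(ψ, χ) = 4π ∫_{k>0} k ψ̂(k, s) χ̂(-k, s) dk dS²` (`regPairing`,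
`tendsto_regTwoPoint`, `twoPointForm_eq_integral`). The integral converges because `k ψ̂` is, up to
a constant, the transform of `∂_V ψ ∈ L²` (`vFourier_deriv`). The formula shows that `ω` is
bilinear, hermitian for complex conjugation, positive because `ω(ψ̄, ψ) = 4π ∫_{k>0} k |ψ̂(-k,
s)|²`, and has antisymmetrisation `ω(ψ, χ) - ω(χ, ψ) = iσ(ψ, χ)` (`isTwoPointForm_twoPointForm`).

These properties give the state by pure algebra. Let `μ` be the symmetric part of `ω`. The Wick map
`S`, morally the exponential of `½ μ(∂, ∂)`, carries the product with contraction `iσ/2` to the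
product with contraction `ω = μ + iσ/2` (`IsWickMap.map_starProd`), and `Ω(F) = (S F)(0)` is
quasi-free (`IsWickMap.isQuasiFree`). It is unique because star products of fields span the algebra
(`span_fieldProd`). For positivity, only finitely many test functions occur in `F`. On their span
`ω` is a sum of squares `∑ l̄ᵢ ⊗ lᵢ`, and the `n`-th term of `(F* ⋆ F)(0)` is a sum of squared
moduli of `n`-fold derivatives of `F` at zero (`vacuumPart_contraction_pow_nonneg`).

For the spectrum condition, `Ω(F ⋆ α_t G)` is a polynomial in the functions `t ↦ ω(ψ, α_t χ)`
(`IsWickMap.mem_adjoin`). Each of these is a superposition of `exp(2πikt)` with `k > 0`. Products of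
such superpositions again have only nonnegative frequencies, and test functions supported on
negative frequencies annihilate them (`spectral_of_mem_adjoin`).

For invariance, consider `ψ ↦ w(s) ψ(a(s)V + b(s), θ(s))`. On the Fourier side the shift `b` gives
opposite phases at `k` and `-k`, the scale `a` drops out by homogeneity of `k dk`, and there remains
the condition `θ_*(w² dS²) = dS²` (`ConeMap.twoPointForm_pull`). A Lorentz matrix with `Λ(1, s) =
κ(s)(1, s')` acts on the celestial sphere with Jacobian `κ⁻²` (`lintegral_skyMap`), which is the
Lorentz invariance of `d³x/|x|` on the null cone. Hence `w = κ⁻¹` works with either `a = κ` or `a =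
κ⁻¹`. The first case is the change of frame. The second is the BMS action, because the spinor
representation of `SL(2,ℂ)` gives `K = κ⁻¹` (`spinCover_eq`). -/

noncomputable section

namespace LightCone

/-! ### Derivations of the symmetric algebra. -/

section Derivations

variable {T T' : Type} [AddCommGroup T] [Module ℂ T] [AddCommGroup T'] [Module ℂ T']

/-- Induction on the symmetric algebra by multiplication with generators. -/
theorem fieldAlg_induction {P : FieldAlg T → Prop} (one : P 1)
    (add : ∀ F G, P F → P G → P (F + G)) (smul : ∀ (c : ℂ) F, P F → P (c • F))
    (mul : ∀ ψ F, P F → P (field ψ * F)) (F : FieldAlg T) : P F := by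
  -- Carrying an arbitrary right factor `G` makes the product case of the induction compose; `G = 1`
  -- recovers the claim.
  have key : ∀ F : FieldAlg T, ∀ G, P G → P (F * G) := by
    intro F
    induction F using SymmetricAlgebra.induction with
    | algebraMap r =>
      intro G hG
      rw [← Algebra.smul_def]
      exact smul r G hG
    | ι x => exact fun G hG => mul x G hG
    | mul a b ha hb =>
      intro G hG
      rw [mul_assoc]
      exact ha _ (hb _ hG)
    | add a b ha hb =>
      intro G hG
      rw [add_mul]
      exact add _ _ (ha _ hG) (hb _ hG)
  simpa using key F 1 one

@[simp] lemma funDeriv_one : funDeriv (1 : FieldAlg T) = 0 := by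
  simp [funDeriv]

@[simp] lemma funDeriv_field (ψ : T) : funDeriv (field ψ) = (1 : FieldAlg T) ⊗ₜ[ℂ] ψ := by
  simp [funDeriv]

/-- The algebra homomorphism `F ↦ F + F^{(1)}` into the trivial square-zero extension. -/
def taylorHom : FieldAlg T →ₐ[ℂ] TrivSqZeroExt (FieldAlg T) (FieldAlg T ⊗[ℂ] T) :=
  SymmetricAlgebra.lift (R := ℂ) (M := T)
      (A := TrivSqZeroExt (FieldAlg T) (FieldAlg T ⊗[ℂ] T))
      ((TrivSqZeroExt.inlAlgHom ℂ (FieldAlg T) (FieldAlg T ⊗[ℂ] T)).toLinearMap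
          ∘ₗ SymmetricAlgebra.ι ℂ T
        + (TrivSqZeroExt.inrHom (FieldAlg T) (FieldAlg T ⊗[ℂ] T)).restrictScalars ℂ
          ∘ₗ TensorProduct.mk ℂ (FieldAlg T) T 1)

lemma fst_taylorHom (F : FieldAlg T) : (taylorHom F).fst = F := by
  have : (TrivSqZeroExt.fstHom ℂ (FieldAlg T) (FieldAlg T ⊗[ℂ] T)).comp taylorHom
      = AlgHom.id ℂ (FieldAlg T) := by
    apply SymmetricAlgebra.algHom_ext
    ext ψ
    simp [taylorHom]
  exact DFunLike.congr_fun this F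

/-- The map `F ↦ F + F^{(1)}` is multiplicative, and the second component of a product in a
square-zero extension is the Leibniz rule. -/
lemma funDeriv_mul (F G : FieldAlg T) :
    funDeriv (F * G) = F • funDeriv G + G • funDeriv F := by
  have h : ∀ F : FieldAlg T, funDeriv F = (taylorHom F).snd := fun F => rfl
  rw [h, h, h, map_mul, TrivSqZeroExt.snd_mul, fst_taylorHom, fst_taylorHom]
  simp

/-- The derivation of the symmetric algebra that extends a linear functional. -/
def dirDeriv (l : T →ₗ[ℂ] ℂ) : FieldAlg T →ₗ[ℂ] FieldAlg T :=
  (TensorProduct.rid ℂ (FieldAlg T)).toLinearMap ∘ₗ LinearMap.lTensor (FieldAlg T) l ∘ₗ funDeriv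

@[simp] lemma dirDeriv_one (l : T →ₗ[ℂ] ℂ) : dirDeriv l (1 : FieldAlg T) = 0 := by
  simp [dirDeriv]

@[simp] lemma dirDeriv_field (l : T →ₗ[ℂ] ℂ) (ψ : T) :
    dirDeriv l (field ψ) = algebraMap ℂ (FieldAlg T) (l ψ) := by
  simp [dirDeriv, Algebra.algebraMap_eq_smul_one]

lemma rid_lTensor_smul (l : T →ₗ[ℂ] ℂ) (F : FieldAlg T) (x : FieldAlg T ⊗[ℂ] T) :
    TensorProduct.rid ℂ (FieldAlg T) (LinearMap.lTensor (FieldAlg T) l (F • x))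
      = F * TensorProduct.rid ℂ (FieldAlg T) (LinearMap.lTensor (FieldAlg T) l x) := by
  induction x using TensorProduct.induction_on with
  | zero => simp
  | tmul a φ => simp [TensorProduct.smul_tmul']
  | add x y hx hy => simp only [smul_add, map_add, hx, hy, mul_add]

lemma dirDeriv_mul (l : T →ₗ[ℂ] ℂ) (F G : FieldAlg T) :
    dirDeriv l (F * G) = F * dirDeriv l G + dirDeriv l F * G := by
  simp only [dirDeriv, LinearMap.comp_apply, funDeriv_mul, map_add, LinearEquiv.coe_coe,
    rid_lTensor_smul]
  ring

lemma dirDeriv_field_mul (l : T →ₗ[ℂ] ℂ) (ψ : T) (G : FieldAlg T) :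
    dirDeriv l (field ψ * G) = field ψ * dirDeriv l G + l ψ • G := by
  rw [dirDeriv_mul, dirDeriv_field, Algebra.smul_def]

lemma dirDeriv_add_functional (l m : T →ₗ[ℂ] ℂ) (F : FieldAlg T) :
    dirDeriv (l + m) F = dirDeriv l F + dirDeriv m F := by
  simp [dirDeriv, LinearMap.lTensor_add]

lemma dirDeriv_smul_functional (c : ℂ) (l : T →ₗ[ℂ] ℂ) (F : FieldAlg T) :
    dirDeriv (c • l) F = c • dirDeriv l F := by
  simp [dirDeriv, LinearMap.lTensor_smul]

/-- The derivative of a generator is a scalar, so these derivations have constant coefficients. This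
is why contractions and Wick maps commute with derivatives. -/
lemma dirDeriv_comm (l m : T →ₗ[ℂ] ℂ) (F : FieldAlg T) :
    dirDeriv l (dirDeriv m F) = dirDeriv m (dirDeriv l F) := by
  induction F using fieldAlg_induction with
  | one => simp
  | add F G hF hG => simp only [map_add, hF, hG]
  | smul c F hF => simp only [map_smul, hF]
  | mul ψ F hF =>
    simp only [dirDeriv_field_mul, map_add, map_smul, hF]
    abel

/-- The directional derivative of `F` is a finite combination with coefficients independent of the
functional. -/
lemma exists_dirDeriv_eq_sum (F : FieldAlg T) : ∃ (n : ℕ) (χ : Fin n → T) (G : Fin n → FieldAlg T),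
    ∀ l : T →ₗ[ℂ] ℂ, dirDeriv l F = ∑ j, l (χ j) • G j := by
  have key : ∀ x : FieldAlg T ⊗[ℂ] T, ∃ (n : ℕ) (χ : Fin n → T) (G : Fin n → FieldAlg T),
      ∀ l : T →ₗ[ℂ] ℂ, TensorProduct.rid ℂ (FieldAlg T) (LinearMap.lTensor (FieldAlg T) l x)
        = ∑ j, l (χ j) • G j := by
    intro x
    induction x using TensorProduct.induction_on with
    | zero => exact ⟨0, Fin.elim0, Fin.elim0, fun l => by simp⟩
    | tmul a φ => exact ⟨1, fun _ => φ, fun _ => a, fun l => by simp⟩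
    | add x y hx hy =>
      obtain ⟨n, χ, G, h⟩ := hx
      obtain ⟨n', χ', G', h'⟩ := hy
      refine ⟨n + n', Fin.append χ χ', Fin.append G G', fun l => ?_⟩
      rw [map_add, map_add, h, h', Fin.sum_univ_add]
      simp
  exact key (funDeriv F)

end Derivations

/-! ### The star product and its recursion in the left factor. -/

section StarProduct

variable {T T' : Type} [AddCommGroup T] [Module ℂ T] [AddCommGroup T'] [Module ℂ T']

/-- The bilinear operation of which `contraction` is the composition with `funDeriv`. -/
def contractTensor (σ : T →ₗ[ℂ] T →ₗ[ℂ] ℂ) :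
    (FieldAlg T ⊗[ℂ] T) ⊗[ℂ] (FieldAlg T ⊗[ℂ] T) →ₗ[ℂ] FieldAlg T ⊗[ℂ] FieldAlg T :=
  (TensorProduct.rid ℂ (FieldAlg T ⊗[ℂ] FieldAlg T)).toLinearMap ∘ₗ
    LinearMap.lTensor (FieldAlg T ⊗[ℂ] FieldAlg T) (TensorProduct.lift σ) ∘ₗ
      (TensorProduct.tensorTensorTensorComm ℂ (FieldAlg T) T (FieldAlg T) T).toLinearMap

lemma contraction_tmul (σ : T →ₗ[ℂ] T →ₗ[ℂ] ℂ) (F G : FieldAlg T) :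
    contraction σ (F ⊗ₜ G) = contractTensor σ (funDeriv F ⊗ₜ funDeriv G) := rfl

lemma contractTensor_tmul (σ : T →ₗ[ℂ] T →ₗ[ℂ] ℂ) (F G : FieldAlg T) (φ χ : T) :
    contractTensor σ ((F ⊗ₜ φ) ⊗ₜ (G ⊗ₜ χ)) = σ φ χ • (F ⊗ₜ G) := by
  simp [contractTensor]

/-- Multiplication of the left tensor factor by a field. -/
def leftField (ψ : T) : Module.End ℂ (FieldAlg T ⊗[ℂ] FieldAlg T) :=
  LinearMap.rTensor (FieldAlg T) (LinearMap.mulLeft ℂ (field ψ))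

@[simp] lemma leftField_tmul (ψ : T) (F G : FieldAlg T) :
    leftField ψ (F ⊗ₜ[ℂ] G) = (field ψ * F) ⊗ₜ[ℂ] G := by
  simp [leftField]

/-- Directional derivative of the right tensor factor. -/
def rightDeriv (l : T →ₗ[ℂ] ℂ) : Module.End ℂ (FieldAlg T ⊗[ℂ] FieldAlg T) :=
  LinearMap.lTensor (FieldAlg T) (dirDeriv l)

@[simp] lemma rightDeriv_tmul (l : T →ₗ[ℂ] ℂ) (F G : FieldAlg T) :
    rightDeriv l (F ⊗ₜ[ℂ] G) = F ⊗ₜ[ℂ] dirDeriv l G := by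
  simp [rightDeriv]

lemma contractTensor_smul (σ : T →ₗ[ℂ] T →ₗ[ℂ] ℂ) (ψ : T) (x y : FieldAlg T ⊗[ℂ] T) :
    contractTensor σ ((field ψ • x) ⊗ₜ y) = leftField ψ (contractTensor σ (x ⊗ₜ y)) := by
  induction x using TensorProduct.induction_on with
  | zero => simp
  | add x x' hx hx' => simp only [smul_add, TensorProduct.add_tmul, map_add, hx, hx']
  | tmul a φ =>
    induction y using TensorProduct.induction_on with
    | zero => simp
    | add y y' hy hy' => simp only [TensorProduct.tmul_add, map_add, hy, hy']
    | tmul b χ =>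
      rw [TensorProduct.smul_tmul', contractTensor_tmul, contractTensor_tmul, map_smul,
        leftField_tmul, smul_eq_mul]

lemma contractTensor_right (σ : T →ₗ[ℂ] T →ₗ[ℂ] ℂ) (ψ : T) (F G : FieldAlg T) :
    contractTensor σ ((F ⊗ₜ ψ) ⊗ₜ funDeriv G) = rightDeriv (σ ψ) (F ⊗ₜ G) := by
  have key : ∀ y : FieldAlg T ⊗[ℂ] T, contractTensor σ ((F ⊗ₜ ψ) ⊗ₜ y)
      = F ⊗ₜ TensorProduct.rid ℂ (FieldAlg T) (LinearMap.lTensor (FieldAlg T) (σ ψ) y) := by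
    intro y
    induction y using TensorProduct.induction_on with
    | zero => simp
    | add y y' hy hy' => simp only [TensorProduct.tmul_add, map_add, hy, hy']
    | tmul b χ => simp [contractTensor_tmul]
  rw [key, rightDeriv_tmul]
  rfl

/-- The left derivative hits either `F` or `ψ`; in the second case `σ ψ` is left over as a direction
in which to differentiate `G`. -/
lemma contraction_field_mul (σ : T →ₗ[ℂ] T →ₗ[ℂ] ℂ) (ψ : T) (F G : FieldAlg T) :
    contraction σ ((field ψ * F) ⊗ₜ G)
      = leftField ψ (contraction σ (F ⊗ₜ G)) + rightDeriv (σ ψ) (F ⊗ₜ G) := by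
  rw [contraction_tmul, funDeriv_mul, TensorProduct.add_tmul, map_add, contractTensor_smul,
    funDeriv_field, TensorProduct.smul_tmul', smul_eq_mul, mul_one, contractTensor_right,
    contraction_tmul]

lemma contraction_one (σ : T →ₗ[ℂ] T →ₗ[ℂ] ℂ) (G : FieldAlg T) :
    contraction σ (1 ⊗ₜ G) = 0 := by
  rw [contraction_tmul, funDeriv_one, TensorProduct.zero_tmul, map_zero]

lemma contraction_leftField (σ : T →ₗ[ℂ] T →ₗ[ℂ] ℂ) (ψ : T) :
    contraction σ * leftField ψ = leftField ψ * contraction σ + rightDeriv (σ ψ) := by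
  refine TensorProduct.ext' fun F G => ?_
  simp [contraction_field_mul]

lemma leftField_rightDeriv (ψ : T) (l : T →ₗ[ℂ] ℂ) (x : FieldAlg T ⊗[ℂ] FieldAlg T) :
    rightDeriv l (leftField ψ x) = leftField ψ (rightDeriv l x) := by
  induction x using TensorProduct.induction_on with
  | zero => simp
  | add y y' hy hy' => simp only [map_add, hy, hy']
  | tmul b χ => simp

/-- Both are constant-coefficient differential operators; the induction reduces to `dirDeriv_comm`.
-/
lemma contraction_rightDeriv (σ : T →ₗ[ℂ] T →ₗ[ℂ] ℂ) (l : T →ₗ[ℂ] ℂ) :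
    Commute (contraction σ) (rightDeriv l) := by
  refine TensorProduct.ext' fun F G => ?_
  simp only [Module.End.mul_apply, rightDeriv_tmul]
  induction F using fieldAlg_induction with
  | one => simp [contraction_one]
  | add F F' h h' => simp only [TensorProduct.add_tmul, map_add, h, h']
  | smul c F h => simp only [← TensorProduct.smul_tmul', map_smul, h]
  | mul ψ F h =>
    rw [contraction_field_mul, contraction_field_mul, h, map_add, leftField_rightDeriv]
    simp [dirDeriv_comm]

/-- When `[A, B]` commutes with `A`, one has `[A^{n+1}, B] = (n+1) [A, B] A^n`. The factor `n + 1`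
later cancels against the factorial in the star product. -/
lemma contraction_pow_leftField (σ : T →ₗ[ℂ] T →ₗ[ℂ] ℂ) (ψ : T) (n : ℕ) :
    contraction σ ^ (n + 1) * leftField ψ
      = leftField ψ * contraction σ ^ (n + 1)
        + ((n + 1 : ℕ) : ℂ) • (rightDeriv (σ ψ) * contraction σ ^ n) := by
  induction n with
  | zero => simp [contraction_leftField]
  | succ n ih =>
    have hc := contraction_rightDeriv σ (σ ψ)
    rw [pow_succ' _ (n + 1), mul_assoc, ih, mul_add, ← mul_assoc, contraction_leftField,
      mul_smul_comm, ← mul_assoc (contraction σ) (rightDeriv _), hc.eq, add_mul, mul_assoc,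
      ← pow_succ', mul_assoc, ← pow_succ' _ n, add_assoc, add_comm (rightDeriv _ * _),
      Nat.cast_succ (n + 1), add_smul _ (1 : ℂ), one_smul]

lemma contraction_pow_field_mul (σ : T →ₗ[ℂ] T →ₗ[ℂ] ℂ) (ψ : T) (n : ℕ) (F G : FieldAlg T) :
    (contraction σ ^ (n + 1)) ((field ψ * F) ⊗ₜ G)
      = leftField ψ ((contraction σ ^ (n + 1)) (F ⊗ₜ G))
        + ((n + 1 : ℕ) : ℂ) • (contraction σ ^ n) (F ⊗ₜ dirDeriv (σ ψ) G) := by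
  have h := congrArg (fun L => L (F ⊗ₜ[ℂ] G)) (contraction_pow_leftField σ ψ n)
  have hc := ((contraction_rightDeriv σ (σ ψ)).pow_left n).eq
  rw [← hc] at h
  simpa using h

/-- Each contraction lowers the degree of the left factor. The bound is thus uniform in `G`, so that
a single truncation of the series serves all right factors. -/
lemma exists_contraction_pow_eq_zero (σ : T →ₗ[ℂ] T →ₗ[ℂ] ℂ) (F : FieldAlg T) :
    ∃ N : ℕ, ∀ n, N ≤ n → ∀ G : FieldAlg T, (contraction σ ^ n) (F ⊗ₜ G) = 0 := by
  induction F using fieldAlg_induction with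
  | one =>
    refine ⟨1, fun n hn G => ?_⟩
    obtain ⟨m, rfl⟩ := Nat.exists_eq_add_of_le' hn
    rw [pow_succ, Module.End.mul_apply, contraction_one, map_zero]
  | add F F' h h' =>
    obtain ⟨N, h⟩ := h
    obtain ⟨N', h'⟩ := h'
    refine ⟨max N N', fun n hn G => ?_⟩
    rw [TensorProduct.add_tmul, map_add, h n (le_of_max_le_left hn),
      h' n (le_of_max_le_right hn), add_zero]
  | smul c F h =>
    obtain ⟨N, h⟩ := h
    refine ⟨N, fun n hn G => ?_⟩
    rw [← TensorProduct.smul_tmul', map_smul, h n hn, smul_zero]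
  | mul ψ F h =>
    obtain ⟨N, h⟩ := h
    refine ⟨N + 1, fun n hn G => ?_⟩
    obtain ⟨m, rfl⟩ := Nat.exists_eq_add_of_le' (le_trans (Nat.le_add_left 1 N) hn)
    rw [contraction_pow_field_mul, h _ (by omega), h _ (by omega)]
    simp

lemma starProd_eq_sum (σ : T →ₗ[ℂ] T →ₗ[ℂ] ℂ) (F G : FieldAlg T) {N : ℕ}
    (h : ∀ n, N ≤ n → (contraction σ ^ n) (F ⊗ₜ G) = 0) :
    starProd σ F G = ∑ n ∈ Finset.range N, (Complex.I ^ n / (2 ^ n * (n.factorial : ℂ))) •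
      LinearMap.mul' ℂ (FieldAlg T) ((contraction σ ^ n) (F ⊗ₜ[ℂ] G)) := by
  refine finsum_eq_sum_of_support_subset _ fun n hn => ?_
  rw [Finset.coe_range, mem_Iio]
  by_contra hN
  exact hn (by simp [h n (not_lt.1 hN)])

lemma exists_starProd_eq_sum (σ : T →ₗ[ℂ] T →ₗ[ℂ] ℂ) (F : FieldAlg T) :
    ∃ N₀ : ℕ, ∀ N, N₀ ≤ N → ∀ G, starProd σ F G
      = ∑ n ∈ Finset.range N, (Complex.I ^ n / (2 ^ n * (n.factorial : ℂ))) •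
      LinearMap.mul' ℂ (FieldAlg T) ((contraction σ ^ n) (F ⊗ₜ[ℂ] G)) := by
  obtain ⟨N₀, h⟩ := exists_contraction_pow_eq_zero σ F
  exact ⟨N₀, fun N hN G => starProd_eq_sum σ F G fun n hn => h n (hN.trans hn) G⟩

@[simp] lemma starProd_one_left (σ : T →ₗ[ℂ] T →ₗ[ℂ] ℂ) (G : FieldAlg T) :
    starProd σ 1 G = G := by
  rw [starProd_eq_sum (N := 1)]
  · simp
  · intro n hn
    obtain ⟨m, rfl⟩ := Nat.exists_eq_add_of_le' hn
    rw [pow_succ, Module.End.mul_apply, contraction_one, map_zero]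

lemma starProd_add_left (σ : T →ₗ[ℂ] T →ₗ[ℂ] ℂ) (F F' G : FieldAlg T) :
    starProd σ (F + F') G = starProd σ F G + starProd σ F' G := by
  obtain ⟨N₁, h₁⟩ := exists_starProd_eq_sum σ F
  obtain ⟨N₂, h₂⟩ := exists_starProd_eq_sum σ F'
  obtain ⟨N₃, h₃⟩ := exists_starProd_eq_sum σ (F + F')
  rw [h₁ (max N₁ (max N₂ N₃)) (by simp), h₂ (max N₁ (max N₂ N₃)) (by simp),
    h₃ (max N₁ (max N₂ N₃)) (by simp), ← Finset.sum_add_distrib]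
  simp [TensorProduct.add_tmul]

lemma starProd_smul_left (σ : T →ₗ[ℂ] T →ₗ[ℂ] ℂ) (c : ℂ) (F G : FieldAlg T) :
    starProd σ (c • F) G = c • starProd σ F G := by
  obtain ⟨N₁, h₁⟩ := exists_starProd_eq_sum σ F
  obtain ⟨N₂, h₂⟩ := exists_starProd_eq_sum σ (c • F)
  rw [h₁ (max N₁ N₂) (by simp), h₂ (max N₁ N₂) (by simp), Finset.smul_sum]
  simp [← TensorProduct.smul_tmul', smul_comm c]

lemma starProd_add_right (σ : T →ₗ[ℂ] T →ₗ[ℂ] ℂ) (F G G' : FieldAlg T) :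
    starProd σ F (G + G') = starProd σ F G + starProd σ F G' := by
  obtain ⟨N, h⟩ := exists_starProd_eq_sum σ F
  simp only [h N le_rfl, ← Finset.sum_add_distrib, TensorProduct.tmul_add, map_add, smul_add]

lemma starProd_smul_right (σ : T →ₗ[ℂ] T →ₗ[ℂ] ℂ) (c : ℂ) (F G : FieldAlg T) :
    starProd σ F (c • G) = c • starProd σ F G := by
  obtain ⟨N, h⟩ := exists_starProd_eq_sum σ F
  simp only [h N le_rfl, TensorProduct.tmul_smul, map_smul, Finset.smul_sum, smul_comm c]

/-- The star product as a bilinear map. -/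
def starProdₗ (σ : T →ₗ[ℂ] T →ₗ[ℂ] ℂ) : FieldAlg T →ₗ[ℂ] FieldAlg T →ₗ[ℂ] FieldAlg T :=
  LinearMap.mk₂ ℂ (starProd σ) (starProd_add_left σ) (starProd_smul_left σ)
    (starProd_add_right σ) (starProd_smul_right σ)

lemma starProdₗ_apply (σ : T →ₗ[ℂ] T →ₗ[ℂ] ℂ) (F G : FieldAlg T) :
    starProdₗ σ F G = starProd σ F G := rfl

lemma mul'_leftField (ψ : T) (x : FieldAlg T ⊗[ℂ] FieldAlg T) :
    LinearMap.mul' ℂ (FieldAlg T) (leftField ψ x)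
      = field ψ * LinearMap.mul' ℂ (FieldAlg T) x := by
  induction x using TensorProduct.induction_on with
  | zero => simp
  | add y y' hy hy' => simp only [map_add, hy, hy', mul_add]
  | tmul b χ => simp [mul_assoc]

/-- Recursion for the star product in its left factor. -/
lemma starProd_field_mul (σ : T →ₗ[ℂ] T →ₗ[ℂ] ℂ) (ψ : T) (F G : FieldAlg T) :
    starProd σ (field ψ * F) G
      = field ψ * starProd σ F G + (Complex.I / 2) • starProd σ F (dirDeriv (σ ψ) G) := by
  obtain ⟨N₁, h₁⟩ := exists_starProd_eq_sum σ F
  obtain ⟨N₂, h₂⟩ := exists_starProd_eq_sum σ (field ψ * F)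
  obtain ⟨N₃, h₃⟩ := exists_contraction_pow_eq_zero σ F
  set N := max N₁ (max N₂ N₃) with hN
  rw [h₂ (N + 1) (by omega), h₁ (N + 1) (by omega), h₁ N (by omega), Finset.sum_range_succ',
    Finset.sum_range_succ', mul_add, Finset.mul_sum, Finset.smul_sum, add_right_comm,
    ← Finset.sum_add_distrib]
  congr 1
  · refine Finset.sum_congr rfl fun n _ => ?_
    rw [contraction_pow_field_mul, map_add, mul'_leftField, smul_add, mul_smul_comm, map_smul,
      smul_smul, smul_smul]
    congr 2
    -- The coefficient of order `n + 1` times `n + 1` is `i/2` times the coefficient of order `n`.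
    -- Truncating at `N + 1` and at `N` aligns the two sums after the term of order zero is split
    -- off.
    rw [Nat.factorial_succ]
    have h1 : (n.factorial : ℂ) ≠ 0 := Nat.cast_ne_zero.2 n.factorial_ne_zero
    have h2 : ((n + 1 : ℕ) : ℂ) ≠ 0 := Nat.cast_ne_zero.2 n.succ_ne_zero
    push_cast at h2 ⊢
    rw [pow_succ, pow_succ]
    field_simp
  · simp [mul_assoc]

lemma starProd_field (σ : T →ₗ[ℂ] T →ₗ[ℂ] ℂ) (ψ : T) (G : FieldAlg T) :
    starProd σ (field ψ) G = field ψ * G + (Complex.I / 2) • dirDeriv (σ ψ) G := by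
  simpa using starProd_field_mul σ ψ 1 G

/-- The contraction has constant coefficients, so a constant-coefficient derivation of the
commutative product is also one of the star product. -/
lemma dirDeriv_starProd (σ : T →ₗ[ℂ] T →ₗ[ℂ] ℂ) (l : T →ₗ[ℂ] ℂ) (F G : FieldAlg T) :
    dirDeriv l (starProd σ F G)
      = starProd σ (dirDeriv l F) G + starProd σ F (dirDeriv l G) := by
  induction F using fieldAlg_induction generalizing G with
  | one => simp [← starProdₗ_apply]; simp [starProdₗ_apply]
  | add F F' h h' =>
    simp only [starProd_add_left, map_add, h, h']
    abel
  | smul c F h => simp only [starProd_smul_left, map_smul, h, smul_add]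
  | mul ψ F h =>
    simp only [starProd_field_mul, dirDeriv_field_mul, starProd_add_left, starProd_smul_left,
      map_add, map_smul, h, mul_add, smul_add, dirDeriv_comm l]
    abel

end StarProduct

/-! ### Functoriality in the test functions and the `*`-operation. -/

section SecondQuantization

variable {T T' T'' : Type} [AddCommGroup T] [Module ℂ T] [AddCommGroup T'] [Module ℂ T']
  [AddCommGroup T''] [Module ℂ T'']

@[simp] lemma secondQuant_field (U : T →ₗ[ℂ] T') (ψ : T) :
    secondQuant U (field ψ) = field (U ψ) := by
  simp [secondQuant]

lemma secondQuant_comp (U : T →ₗ[ℂ] T') (V : T' →ₗ[ℂ] T'') (F : FieldAlg T) :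
    secondQuant (V ∘ₗ U) F = secondQuant V (secondQuant U F) := by
  have : secondQuant (V ∘ₗ U) = (secondQuant V).comp (secondQuant U) := by
    apply SymmetricAlgebra.algHom_ext
    ext ψ
    simp [secondQuant]
  rw [this]
  rfl

lemma secondQuant_id (F : FieldAlg T) : secondQuant (LinearMap.id : T →ₗ[ℂ] T) F = F := by
  have : secondQuant (LinearMap.id : T →ₗ[ℂ] T) = AlgHom.id ℂ (FieldAlg T) := by
    apply SymmetricAlgebra.algHom_ext
    ext ψ
    simp [secondQuant]
  rw [this]
  rfl

lemma dirDeriv_secondQuant (U : T →ₗ[ℂ] T') (l : T' →ₗ[ℂ] ℂ) (F : FieldAlg T) :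
    dirDeriv l (secondQuant U F) = secondQuant U (dirDeriv (l ∘ₗ U) F) := by
  induction F using fieldAlg_induction with
  | one => simp
  | add F G hF hG => simp only [map_add, hF, hG]
  | smul c F hF => simp only [map_smul, hF]
  | mul ψ F hF =>
    rw [map_mul, secondQuant_field, dirDeriv_field_mul, hF, dirDeriv_field_mul]
    simp

/-- Naturality of the star product. -/
lemma secondQuant_starProd (U : T →ₗ[ℂ] T') {σ : T →ₗ[ℂ] T →ₗ[ℂ] ℂ} {σ' : T' →ₗ[ℂ] T' →ₗ[ℂ] ℂ}
    (h : ∀ ψ χ, σ' (U ψ) (U χ) = σ ψ χ) (F G : FieldAlg T) :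
    secondQuant U (starProd σ F G) = starProd σ' (secondQuant U F) (secondQuant U G) := by
  induction F using fieldAlg_induction generalizing G with
  | one => simp
  | add F F' hF hF' => simp only [starProd_add_left, map_add, hF, hF']
  | smul c F hF => simp only [starProd_smul_left, map_smul, hF]
  | mul ψ F hF =>
    rw [starProd_field_mul, map_mul, secondQuant_field, starProd_field_mul, map_add, map_smul,
      map_mul, secondQuant_field, hF, hF, dirDeriv_secondQuant]
    have e : σ' (U ψ) ∘ₗ U = σ ψ := LinearMap.ext fun χ => h ψ χ
    rw [e]

lemma starOp_add (c : T →ₛₗ[starRingEnd ℂ] T) (F G : FieldAlg T) :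
    starOp c (F + G) = starOp c F + starOp c G :=
  map_add (SymmetricAlgebra.lift (conjField c)) F G

lemma starOp_mul (c : T →ₛₗ[starRingEnd ℂ] T) (F G : FieldAlg T) :
    starOp c (F * G) = starOp c F * starOp c G :=
  map_mul (SymmetricAlgebra.lift (conjField c)) F G

@[simp] lemma starOp_one (c : T →ₛₗ[starRingEnd ℂ] T) : starOp c (1 : FieldAlg T) = 1 :=
  map_one (SymmetricAlgebra.lift (conjField c))

lemma starOp_smul (c : T →ₛₗ[starRingEnd ℂ] T) (a : ℂ) (F : FieldAlg T) :
    starOp c (a • F) = (starRingEnd ℂ) a • starOp c F :=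
  (map_smul (SymmetricAlgebra.lift (conjField c)) a F).trans
    ((Algebra.smul_def (A := ConjAlg T) a _).trans
      (Algebra.smul_def (A := FieldAlg T) ((starRingEnd ℂ) a) _).symm)

@[simp] lemma starOp_field (c : T →ₛₗ[starRingEnd ℂ] T) (ψ : T) :
    starOp c (field ψ) = field (c ψ) :=
  SymmetricAlgebra.lift_ι_apply (conjField c) ψ

lemma secondQuant_starOp (U : T →ₗ[ℂ] T') {c : T →ₛₗ[starRingEnd ℂ] T}
    {c' : T' →ₛₗ[starRingEnd ℂ] T'} (h : ∀ ψ, U (c ψ) = c' (U ψ)) (F : FieldAlg T) :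
    secondQuant U (starOp c F) = starOp c' (secondQuant U F) := by
  induction F using fieldAlg_induction with
  | one => simp
  | add F F' hF hF' => simp only [starOp_add, map_add, hF, hF']
  | smul a F hF => simp only [starOp_smul, map_smul, hF]
  | mul ψ F hF => simp only [starOp_mul, map_mul, hF, starOp_field, secondQuant_field, h]

/-- The functional `χ ↦ conj (l (c χ))`. -/
def conjFunctional (c : T →ₛₗ[starRingEnd ℂ] T) (l : T →ₗ[ℂ] ℂ) : T →ₗ[ℂ] ℂ where
  toFun χ := (starRingEnd ℂ) (l (c χ))
  map_add' χ χ' := by simp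
  map_smul' a χ := by simp

@[simp] lemma conjFunctional_apply (c : T →ₛₗ[starRingEnd ℂ] T) (l : T →ₗ[ℂ] ℂ) (χ : T) :
    conjFunctional c l χ = (starRingEnd ℂ) (l (c χ)) := rfl

lemma starOp_dirDeriv {c : T →ₛₗ[starRingEnd ℂ] T} (hc : ∀ ψ, c (c ψ) = ψ) (l : T →ₗ[ℂ] ℂ)
    (F : FieldAlg T) :
    starOp c (dirDeriv l F) = dirDeriv (conjFunctional c l) (starOp c F) := by
  induction F using fieldAlg_induction with
  -- The value of `starOp` at zero is read off from antilinearity with scalar zero.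
  | one => simpa using starOp_smul c 0 1
  | add F F' hF hF' => simp only [starOp_add, map_add, hF, hF']
  | smul a F hF => simp only [starOp_smul, map_smul, hF]
  | mul ψ F hF =>
    rw [dirDeriv_field_mul, starOp_add, starOp_mul, starOp_smul, hF, starOp_mul, starOp_field,
      dirDeriv_field_mul, conjFunctional_apply, hc]

end SecondQuantization

/-! ### The Wick map, changing the form contracted by the star product. -/

section WickMap

variable {T T' : Type} [AddCommGroup T] [Module ℂ T] [AddCommGroup T'] [Module ℂ T']

/-- The defining properties of the exponential of half the second-order differential operator
with symbol `μ`. -/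
structure IsWickMap (μ : T →ₗ[ℂ] T →ₗ[ℂ] ℂ) (S : FieldAlg T →ₗ[ℂ] FieldAlg T) : Prop where
  map_one : S 1 = 1
  map_field_mul : ∀ ψ F, S (field ψ * F) = field ψ * S F + dirDeriv (μ ψ) (S F)

/-- Multiplication by `ψ` plus the directional derivative along `μ ψ`, as an operator. -/
def fieldOperator (μ : T →ₗ[ℂ] T →ₗ[ℂ] ℂ) : T →ₗ[ℂ] Module.End ℂ (FieldAlg T) where
  toFun ψ := LinearMap.mulLeft ℂ (field ψ) + dirDeriv (μ ψ)
  map_add' ψ χ := by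
    ext F
    simp only [LinearMap.add_apply, LinearMap.mulLeft_apply, map_add, add_mul,
      dirDeriv_add_functional]
    abel
  map_smul' a ψ := by
    ext F
    simp only [LinearMap.add_apply, LinearMap.mulLeft_apply, map_smul, smul_mul_assoc,
      dirDeriv_smul_functional, LinearMap.smul_apply, smul_add, RingHom.id_apply]

lemma fieldOperator_apply (μ : T →ₗ[ℂ] T →ₗ[ℂ] ℂ) (ψ : T) (F : FieldAlg T) :
    fieldOperator μ ψ F = field ψ * F + dirDeriv (μ ψ) F := rfl

/-- The commutator is multiplication by `μ ψ χ - μ χ ψ`, which vanishes for symmetric `μ`. -/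
lemma fieldOperator_comm {μ : T →ₗ[ℂ] T →ₗ[ℂ] ℂ} (hμ : ∀ ψ χ, μ ψ χ = μ χ ψ) (ψ χ : T) :
    fieldOperator μ ψ * fieldOperator μ χ = fieldOperator μ χ * fieldOperator μ ψ := by
  ext F
  simp only [Module.End.mul_apply, fieldOperator_apply, map_add, dirDeriv_field_mul, hμ χ ψ,
    dirDeriv_comm (μ χ), mul_left_comm (field ψ)]
  abel

/-- The operators `ψ + ∂_{μψ}` generate a commutative algebra, so the universal property extends
them to a representation `π` of the symmetric algebra. The Wick map is `F ↦ π(F) 1`; no exponential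
series is needed. -/
lemma exists_isWickMap {μ : T →ₗ[ℂ] T →ₗ[ℂ] ℂ} (hμ : ∀ ψ χ, μ ψ χ = μ χ ψ) :
    ∃ S : FieldAlg T →ₗ[ℂ] FieldAlg T, IsWickMap μ S := by
  let s : Set (Module.End ℂ (FieldAlg T)) := Set.range (fieldOperator μ)
  have hs : ∀ a ∈ s, ∀ b ∈ s, a * b = b * a := by
    rintro _ ⟨ψ, rfl⟩ _ ⟨χ, rfl⟩
    exact fieldOperator_comm hμ ψ χ
  have hcomm : IsMulCommutative (Algebra.adjoin ℂ s) := Algebra.isMulCommutative_adjoin ℂ hs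
  let _ : CommSemiring (Algebra.adjoin ℂ s) :=
    { (inferInstance : Semiring (Algebra.adjoin ℂ s)) with mul_comm := fun a b => mul_comm' a b }
  let B : T →ₗ[ℂ] Algebra.adjoin ℂ s :=
    (fieldOperator μ).codRestrict (Subalgebra.toSubmodule (Algebra.adjoin ℂ s))
      fun ψ => Algebra.subset_adjoin ⟨ψ, rfl⟩
  let π : FieldAlg T →ₐ[ℂ] Module.End ℂ (FieldAlg T) :=
    (Algebra.adjoin ℂ s).val.comp (SymmetricAlgebra.lift B)
  have hπ : ∀ ψ, π (field ψ) = fieldOperator μ ψ := by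
    intro ψ
    simp only [π, AlgHom.comp_apply, SymmetricAlgebra.lift_ι_apply]
    rfl
  refine ⟨LinearMap.applyₗ (1 : FieldAlg T) ∘ₗ π.toLinearMap, ?_, fun ψ F => ?_⟩
  · simp
  · simp [hπ, fieldOperator_apply]

namespace IsWickMap

variable {μ : T →ₗ[ℂ] T →ₗ[ℂ] ℂ} {S : FieldAlg T →ₗ[ℂ] FieldAlg T}

lemma dirDeriv_comm (h : IsWickMap μ S) (l : T →ₗ[ℂ] ℂ) (F : FieldAlg T) :
    S (dirDeriv l F) = dirDeriv l (S F) := by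
  induction F using fieldAlg_induction with
  | one => simp [h.map_one]
  | add F F' hF hF' => simp only [map_add, hF, hF']
  | smul a F hF => simp only [map_smul, hF]
  | mul ψ F hF =>
    rw [dirDeriv_field_mul, map_add, h.map_field_mul, h.map_field_mul, map_add, map_smul,
      dirDeriv_field_mul, hF, LightCone.dirDeriv_comm l]
    abel

lemma map_secondQuant {μ' : T' →ₗ[ℂ] T' →ₗ[ℂ] ℂ} {S' : FieldAlg T' →ₗ[ℂ] FieldAlg T'}
    (h : IsWickMap μ S) (h' : IsWickMap μ' S') (U : T →ₗ[ℂ] T')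
    (hU : ∀ ψ χ, μ' (U ψ) (U χ) = μ ψ χ) (F : FieldAlg T) :
    S' (secondQuant U F) = secondQuant U (S F) := by
  induction F using fieldAlg_induction with
  | one => simp [h.map_one, h'.map_one]
  | add F F' hF hF' => simp only [map_add, hF, hF']
  | smul a F hF => simp only [map_smul, hF]
  | mul ψ F hF =>
    rw [map_mul, secondQuant_field, h'.map_field_mul, h.map_field_mul, hF, map_add, map_mul,
      secondQuant_field, dirDeriv_secondQuant]
    have e : μ' (U ψ) ∘ₗ U = μ ψ := LinearMap.ext fun χ => hU ψ χ
    rw [e]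

lemma map_starOp (h : IsWickMap μ S) {c : T →ₛₗ[starRingEnd ℂ] T} (hc : ∀ ψ, c (c ψ) = ψ)
    (hμ : ∀ ψ χ, (starRingEnd ℂ) (μ ψ χ) = μ (c ψ) (c χ)) (F : FieldAlg T) :
    S (starOp c F) = starOp c (S F) := by
  induction F using fieldAlg_induction with
  | one => simp [h.map_one]
  | add F F' hF hF' => simp only [starOp_add, map_add, hF, hF']
  | smul a F hF => simp only [starOp_smul, map_smul, hF]
  | mul ψ F hF =>
    rw [starOp_mul, starOp_field, h.map_field_mul, h.map_field_mul, starOp_add, starOp_mul,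
      starOp_field, starOp_dirDeriv hc, hF]
    congr 3
    ext χ
    simp [hμ, hc]

/-- A generator on the left contributes the extra term `∂_{μψ}` of the whole product. By Leibniz it
splits: the part on the left factor builds `S(ψF)`, and the part on the right factor turns the
contraction `iσ/2` into `μ + iσ/2`. -/
lemma map_starProd (h : IsWickMap μ S) {σ τ : T →ₗ[ℂ] T →ₗ[ℂ] ℂ}
    (hτ : ∀ ψ χ, Complex.I / 2 * τ ψ χ = μ ψ χ + Complex.I / 2 * σ ψ χ) (F G : FieldAlg T) :
    S (starProd σ F G) = starProd τ (S F) (S G) := by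
  induction F using fieldAlg_induction generalizing G with
  | one => simp [h.map_one]
  | add F F' hF hF' => simp only [starProd_add_left, map_add, hF, hF']
  | smul a F hF => simp only [starProd_smul_left, map_smul, hF]
  | mul ψ F hF =>
    have e : (Complex.I / 2) • τ ψ = μ ψ + (Complex.I / 2) • σ ψ := by
      ext χ
      simpa using hτ ψ χ
    have e' : (Complex.I / 2) • starProd τ (S F) (dirDeriv (τ ψ) (S G))
        = starProd τ (S F) (dirDeriv (μ ψ) (S G))
          + (Complex.I / 2) • starProd τ (S F) (dirDeriv (σ ψ) (S G)) := by
      rw [← starProd_smul_right, ← dirDeriv_smul_functional, e, dirDeriv_add_functional,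
        starProd_add_right, dirDeriv_smul_functional, starProd_smul_right]
    rw [starProd_field_mul, map_add, map_smul, h.map_field_mul, h.map_field_mul, hF, hF,
      h.dirDeriv_comm, starProd_add_left, starProd_field_mul, dirDeriv_starProd, e']
    abel

end IsWickMap

end WickMap

/-! ### Quasi-free functionals: Wick recursion and uniqueness. -/

section QuasiFree

variable {T T' : Type} [AddCommGroup T] [Module ℂ T] [AddCommGroup T'] [Module ℂ T']

/-- Leibniz for the star product, with the derivative of each single field being a scalar; the sum
has the same shape as the recursion in `wick`. -/
lemma dirDeriv_fieldProd (σ : T →ₗ[ℂ] T →ₗ[ℂ] ℂ) (l : T →ₗ[ℂ] ℂ) (n : ℕ) (ψ : Fin (n + 1) → T) :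
    dirDeriv l (fieldProd σ (n + 1) ψ)
      = ∑ j, l (ψ j) • fieldProd σ n (Fin.removeNth j ψ) := by
  have hd : ∀ (φ : T) (G : FieldAlg T), dirDeriv l (starProd σ (field φ) G)
      = l φ • G + starProd σ (field φ) (dirDeriv l G) := by
    intro φ G
    rw [dirDeriv_starProd, dirDeriv_field, Algebra.algebraMap_eq_smul_one, starProd_smul_left,
      starProd_one_left]
  induction n with
  | zero =>
    rw [fieldProd, hd, fieldProd, dirDeriv_one, Fin.sum_univ_one, fieldProd,
      ← starProdₗ_apply, map_zero, add_zero]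
  | succ n ih =>
    rw [fieldProd, hd, ih, Fin.sum_univ_succ (n := n + 1), ← starProdₗ_apply, map_sum]
    congr 1
    refine Finset.sum_congr rfl fun j _ => ?_
    have e0 : Fin.removeNth j.succ ψ 0 = ψ 0 := by simp [Fin.removeNth]
    have e1 : Fin.tail (Fin.removeNth j.succ ψ) = Fin.removeNth j (Fin.tail ψ) := by
      ext i
      simp [Fin.removeNth, Fin.tail]
    rw [map_smul, starProdₗ_apply, fieldProd, e0, e1]
    rfl

/-- The products of fields span the algebra. -/
lemma span_fieldProd (σ : T →ₗ[ℂ] T →ₗ[ℂ] ℂ) :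
    Submodule.span ℂ {F : FieldAlg T | ∃ (n : ℕ) (ψ : Fin n → T), fieldProd σ n ψ = F} = ⊤ := by
  set W := Submodule.span ℂ {F : FieldAlg T | ∃ (n : ℕ) (ψ : Fin n → T), fieldProd σ n ψ = F}
    with hW
  have hmem : ∀ n (ψ : Fin n → T), fieldProd σ n ψ ∈ W := fun n ψ =>
    Submodule.subset_span ⟨n, ψ, rfl⟩
  have hd : ∀ (l : T →ₗ[ℂ] ℂ) n (ψ : Fin n → T), dirDeriv l (fieldProd σ n ψ) ∈ W := by
    intro l n ψ
    cases n with
    | zero => simp [fieldProd]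
    | succ n =>
      rw [dirDeriv_fieldProd]
      exact W.sum_mem fun j _ => W.smul_mem _ (hmem _ _)
  -- The pointwise and the star product with a field differ by a derivative, which stays in the span
  -- by `hd`.
  have hm : ∀ (φ : T) F, F ∈ W → field φ * F ∈ W := by
    intro φ F hF
    induction hF using Submodule.span_induction with
    | mem F hF =>
      obtain ⟨n, ψ, rfl⟩ := hF
      have h1 := starProd_field σ φ (fieldProd σ n ψ)
      have h2 : field φ * fieldProd σ n ψ = fieldProd σ (n + 1) (Fin.cons φ ψ)
          - (Complex.I / 2) • dirDeriv (σ φ) (fieldProd σ n ψ) := by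
        rw [fieldProd, Fin.cons_zero, Fin.tail_cons, h1, add_sub_cancel_right]
      rw [h2]
      exact W.sub_mem (hmem _ _) (W.smul_mem _ (hd _ _ _))
    | zero => simp
    | add x y _ _ hx hy => rw [mul_add]; exact W.add_mem hx hy
    | smul a x _ hx => rw [mul_smul_comm]; exact W.smul_mem _ hx
  rw [eq_top_iff]
  intro F _
  induction F using fieldAlg_induction with
  | one => exact hmem 0 Fin.elim0
  | add F F' hF hF' => exact W.add_mem (hF trivial) (hF' trivial)
  | smul a F hF => exact W.smul_mem _ (hF trivial)
  | mul ψ F hF => exact hm _ _ (hF trivial)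

lemma IsQuasiFree.unique {σ : T →ₗ[ℂ] T →ₗ[ℂ] ℂ} {w : T → T → ℂ} {Ω Ω' : FieldAlg T →ₗ[ℂ] ℂ}
    (h : IsQuasiFree σ w Ω) (h' : IsQuasiFree σ w Ω') : Ω = Ω' := by
  refine LinearMap.ext_on (span_fieldProd σ) ?_
  rintro _ ⟨n, ψ, rfl⟩
  rw [h, h']

/-- Evaluation of a polynomial functional at zero. -/
def vacuumPart : FieldAlg T →ₐ[ℂ] ℂ := SymmetricAlgebra.algebraMapInv

@[simp] lemma vacuumPart_field (ψ : T) : vacuumPart (field ψ) = 0 :=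
  SymmetricAlgebra.algebraMapInv_ι ψ

lemma vacuumPart_secondQuant (U : T →ₗ[ℂ] T') (F : FieldAlg T) :
    vacuumPart (secondQuant U F) = vacuumPart F := by
  have : vacuumPart.comp (secondQuant U) = vacuumPart := by
    apply SymmetricAlgebra.algHom_ext
    ext ψ
    simp
  exact DFunLike.congr_fun this F

/-- Evaluation at zero kills multiplication by the first field. Only the derivative along `μ φ +
(i/2) σ φ = β φ` survives, and `dirDeriv_fieldProd` pairs the first field with each of the others in
turn. -/
lemma IsWickMap.isQuasiFree {μ : T →ₗ[ℂ] T →ₗ[ℂ] ℂ} {S : FieldAlg T →ₗ[ℂ] FieldAlg T}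
    (h : IsWickMap μ S) {σ β : T →ₗ[ℂ] T →ₗ[ℂ] ℂ}
    (hβ : ∀ ψ χ, β ψ χ = μ ψ χ + Complex.I / 2 * σ ψ χ) :
    IsQuasiFree σ (fun ψ χ => β ψ χ) (vacuumPart.toLinearMap ∘ₗ S) := by
  have key : ∀ φ (G : FieldAlg T), vacuumPart (S (starProd σ (field φ) G))
      = vacuumPart (S (dirDeriv (β φ) G)) := by
    intro φ G
    have e : β φ = μ φ + (Complex.I / 2) • σ φ := by
      ext χ
      simpa using hβ φ χ
    rw [starProd_field, map_add, h.map_field_mul, e, dirDeriv_add_functional,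
      dirDeriv_smul_functional, map_add, map_add, map_add, map_mul, vacuumPart_field, zero_mul,
      zero_add, h.dirDeriv_comm, map_add]
  suffices H : ∀ n, ∀ ψ : Fin n → T, vacuumPart (S (fieldProd σ n ψ)) = wick (fun ψ χ => β ψ χ) n ψ
    from fun n ψ => H n ψ
  intro n
  induction n using Nat.strong_induction_on with
  | _ n ih =>
    intro ψ
    match n, ψ, ih with
    | 0, ψ, _ => simp [fieldProd, wick, h.map_one]
    | 1, ψ, _ => simp [fieldProd, wick, key]
    | n + 2, ψ, ih =>
      rw [fieldProd, key, dirDeriv_fieldProd, wick, map_sum, map_sum]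
      refine Finset.sum_congr rfl fun j _ => ?_
      rw [map_smul, map_smul, ih n (by omega), smul_eq_mul]
      rfl

end QuasiFree

/-! ### Positivity of the quasi-free functional. -/

section Positivity

variable {T T' : Type} [AddCommGroup T] [Module ℂ T] [AddCommGroup T'] [Module ℂ T']

/-- A bilinear form on test functions with the properties of the two-point function of a
quasi-free state: its antisymmetric part is `i σ / 2`, it is hermitian and positive with respect to
the conjugation `c`. -/
structure IsTwoPointForm (σ : T →ₗ[ℂ] T →ₗ[ℂ] ℂ) (c : T →ₛₗ[starRingEnd ℂ] T)
    (β : T →ₗ[ℂ] T →ₗ[ℂ] ℂ) : Prop where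
  invol : ∀ ψ, c (c ψ) = ψ
  comm : ∀ ψ χ, β ψ χ - β χ ψ = Complex.I * σ ψ χ
  herm : ∀ ψ χ, (starRingEnd ℂ) (β ψ χ) = β (c χ) (c ψ)
  pos : ∀ ψ, 0 ≤ (β (c ψ) ψ).re

/-- The symmetric part of a bilinear form. -/
def symmPart (β : T →ₗ[ℂ] T →ₗ[ℂ] ℂ) : T →ₗ[ℂ] T →ₗ[ℂ] ℂ := (1 / 2 : ℂ) • (β + β.flip)

lemma symmPart_apply (β : T →ₗ[ℂ] T →ₗ[ℂ] ℂ) (ψ χ : T) :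
    symmPart β ψ χ = 1 / 2 * (β ψ χ + β χ ψ) := by
  simp [symmPart, mul_add]

lemma symmPart_symm (β : T →ₗ[ℂ] T →ₗ[ℂ] ℂ) (ψ χ : T) : symmPart β ψ χ = symmPart β χ ψ := by
  rw [symmPart_apply, symmPart_apply, add_comm]

lemma IsTwoPointForm.eq_symmPart_add {σ : T →ₗ[ℂ] T →ₗ[ℂ] ℂ} {c : T →ₛₗ[starRingEnd ℂ] T}
    {β : T →ₗ[ℂ] T →ₗ[ℂ] ℂ} (h : IsTwoPointForm σ c β) (ψ χ : T) :
    β ψ χ = symmPart β ψ χ + Complex.I / 2 * σ ψ χ := by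
  have := h.comm ψ χ
  rw [symmPart_apply]
  linear_combination (1 / 2 : ℂ) * this

/-- The symplectic form for which the star product contracts with `β`. -/
def starForm (β : T →ₗ[ℂ] T →ₗ[ℂ] ℂ) : T →ₗ[ℂ] T →ₗ[ℂ] ℂ := (-(2 * Complex.I)) • β

lemma half_I_mul_starForm (β : T →ₗ[ℂ] T →ₗ[ℂ] ℂ) (ψ χ : T) :
    Complex.I / 2 * starForm β ψ χ = β ψ χ := by
  simp only [starForm, LinearMap.smul_apply, smul_eq_mul]
  linear_combination (-β ψ χ) * Complex.I_mul_I

/-- A form of rank one decouples the two factors; this is the reason for diagonalising the two-point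
function. -/
lemma contractTensor_smulRight (f g : T →ₗ[ℂ] ℂ) (x y : FieldAlg T ⊗[ℂ] T) :
    contractTensor (f.smulRight g) (x ⊗ₜ y)
      = TensorProduct.rid ℂ (FieldAlg T) (LinearMap.lTensor (FieldAlg T) f x)
        ⊗ₜ TensorProduct.rid ℂ (FieldAlg T) (LinearMap.lTensor (FieldAlg T) g y) := by
  induction x using TensorProduct.induction_on with
  | zero => simp
  | add x x' hx hx' => simp only [TensorProduct.add_tmul, map_add, hx, hx']
  | tmul a φ =>
    induction y using TensorProduct.induction_on with
    | zero => simp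
    | add y y' hy hy' => simp only [TensorProduct.tmul_add, map_add, hy, hy']
    | tmul b χ =>
      simp [contractTensor_tmul, TensorProduct.smul_tmul', TensorProduct.tmul_smul, smul_smul,
        mul_comm]

lemma contraction_add (σ τ : T →ₗ[ℂ] T →ₗ[ℂ] ℂ) :
    contraction (σ + τ) = contraction σ + contraction τ := by
  have : TensorProduct.lift (σ + τ) = TensorProduct.lift σ + TensorProduct.lift τ := by
    ext; simp
  simp only [contraction, this, LinearMap.lTensor_add, LinearMap.add_comp, LinearMap.comp_add]

lemma contraction_smul (a : ℂ) (σ : T →ₗ[ℂ] T →ₗ[ℂ] ℂ) :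
    contraction (a • σ) = a • contraction σ := by
  have : TensorProduct.lift (a • σ) = a • TensorProduct.lift σ := by
    ext; simp
  simp only [contraction, this, LinearMap.lTensor_smul, LinearMap.smul_comp, LinearMap.comp_smul]

lemma contraction_sum_smulRight {ι : Type} (s : Finset ι) (f g : ι → T →ₗ[ℂ] ℂ)
    (F G : FieldAlg T) :
    contraction (∑ i ∈ s, (f i).smulRight (g i)) (F ⊗ₜ G)
      = ∑ i ∈ s, dirDeriv (f i) F ⊗ₜ[ℂ] dirDeriv (g i) G := by
  classical
  induction s using Finset.induction_on with
  | empty =>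
    have h := contraction_smul (T := T) 0 0
    rw [zero_smul, zero_smul] at h
    simp [h]
  | insert i s hi ih =>
    rw [Finset.sum_insert hi, Finset.sum_insert hi, contraction_add, LinearMap.add_apply, ih,
      contraction_tmul, contractTensor_smulRight]
    rfl

/-- One contraction sends `F* ⊗ F` to `∑ᵢ (∂ᵢF)* ⊗ ∂ᵢF`, which has the same shape, so induction
applies; for `n = 0` the value is `|F(0)|²`. -/
lemma vacuumPart_contraction_pow_nonneg {c : T →ₛₗ[starRingEnd ℂ] T} (hc : ∀ ψ, c (c ψ) = ψ)
    {ι : Type} [Fintype ι] (l : ι → T →ₗ[ℂ] ℂ) (n : ℕ) (F : FieldAlg T) :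
    ∃ r : ℝ, 0 ≤ r ∧ vacuumPart (LinearMap.mul' ℂ (FieldAlg T)
      ((contraction (∑ i, (conjFunctional c (l i)).smulRight (l i)) ^ n) (starOp c F ⊗ₜ F)))
        = r := by
  induction n generalizing F with
  | zero =>
    have hv : ∀ F : FieldAlg T, vacuumPart (starOp c F) = (starRingEnd ℂ) (vacuumPart F) := by
      intro F
      induction F using fieldAlg_induction with
      | one => simp
      | add F F' hF hF' => simp only [starOp_add, map_add, hF, hF']
      | smul a F hF => simp only [starOp_smul, map_smul, hF, smul_eq_mul, map_mul]
      | mul ψ F hF => simp [starOp_mul]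
    refine ⟨Complex.normSq (vacuumPart F), Complex.normSq_nonneg _, ?_⟩
    rw [pow_zero, Module.End.one_apply, LinearMap.mul'_apply, map_mul, hv,
      Complex.normSq_eq_conj_mul_self]
  | succ n ih =>
    choose r hr hr' using fun i => ih (dirDeriv (l i) F)
    refine ⟨∑ i, r i, Finset.sum_nonneg fun i _ => hr i, ?_⟩
    rw [pow_succ, Module.End.mul_apply, contraction_sum_smulRight, map_sum, map_sum, map_sum,
      Complex.ofReal_sum]
    refine Finset.sum_congr rfl fun i _ => ?_
    rw [← hr' i, starOp_dirDeriv hc]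

lemma vacuumPart_starProd_nonneg_of_eq_sum {c : T →ₛₗ[starRingEnd ℂ] T} (hc : ∀ ψ, c (c ψ) = ψ)
    {ι : Type} [Fintype ι] (l : ι → T →ₗ[ℂ] ℂ) (F : FieldAlg T) :
    ∃ r : ℝ, 0 ≤ r ∧ vacuumPart (starProd (starForm
      (∑ i, (conjFunctional c (l i)).smulRight (l i))) (starOp c F) F) = r := by
  obtain ⟨N, hN⟩ := exists_starProd_eq_sum (starForm
      (∑ i, (conjFunctional c (l i)).smulRight (l i))) (starOp c F)
  choose r hr hr' using fun n => vacuumPart_contraction_pow_nonneg hc l n F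
  refine ⟨∑ n ∈ Finset.range N, r n / n.factorial,
    Finset.sum_nonneg fun n _ => div_nonneg (hr n) (Nat.cast_nonneg _), ?_⟩
  rw [hN N le_rfl, map_sum, Complex.ofReal_sum]
  refine Finset.sum_congr rfl fun n _ => ?_
  rw [starForm, contraction_smul, smul_pow, LinearMap.smul_apply, map_smul, map_smul, map_smul,
    hr', smul_smul, smul_eq_mul]
  -- The factor `-2i` in `starForm` reduces the coefficient `iⁿ/(2ⁿ n!)` to the positive number
  -- `1/n!`.
  have h1 : Complex.I ^ n * (-(2 * Complex.I)) ^ n = 2 ^ n := by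
    rw [← mul_pow]
    congr 1
    linear_combination (-2 : ℂ) * Complex.I_mul_I
  have h2 : (2 : ℂ) ^ n ≠ 0 := pow_ne_zero _ two_ne_zero
  rw [div_mul_eq_mul_div, h1, Complex.ofReal_div, Complex.ofReal_natCast]
  field_simp

open ComplexOrder MatrixOrder Matrix.Norms.L2Operator in
/-- A positive form on a finite-dimensional space is a finite sum of squares. -/
lemma IsTwoPointForm.exists_eq_sum [FiniteDimensional ℂ T] {σ : T →ₗ[ℂ] T →ₗ[ℂ] ℂ}
    {c : T →ₛₗ[starRingEnd ℂ] T} {β : T →ₗ[ℂ] T →ₗ[ℂ] ℂ} (h : IsTwoPointForm σ c β) :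
    ∃ (n : ℕ) (l : Fin n → T →ₗ[ℂ] ℂ), β = ∑ i, (conjFunctional c (l i)).smulRight (l i) := by
  let b := Module.finBasis ℂ T
  set n := Module.finrank ℂ T
  let G : Matrix (Fin n) (Fin n) ℂ := fun i j => β (c (b i)) (b j)
  have hexp : ∀ x y : Fin n → ℂ, β (c (∑ i, x i • b i)) (∑ j, y j • b j)
      = ∑ i, ∑ j, (starRingEnd ℂ) (x i) * y j * G i j := by
    intro x y
    simp only [map_sum, map_smulₛₗ, LinearMap.sum_apply, LinearMap.smul_apply, smul_eq_mul,
      Finset.mul_sum, RingHom.id_apply, G]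
    rw [Finset.sum_comm]
    refine Finset.sum_congr rfl fun i _ => Finset.sum_congr rfl fun j _ => by ring
  have hG : G.PosSemidef := by
    refine Matrix.PosSemidef.of_dotProduct_mulVec_nonneg ?_ fun x => ?_
    · ext i j
      simp only [G]
      exact (h.herm _ _).trans (by rw [h.invol])
    · have e : star x ⬝ᵥ (G *ᵥ x) = β (c (∑ i, x i • b i)) (∑ j, x j • b j) := by
        rw [hexp]
        simp only [dotProduct, Matrix.mulVec, Finset.mul_sum, Pi.star_apply]
        refine Finset.sum_congr rfl fun i _ => Finset.sum_congr rfl fun j _ => ?_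
        rw [starRingEnd_apply]
        ring
      rw [e]
      -- The field `pos` bounds the real part only; reality of the diagonal values comes from
      -- hermiticity.
      refine Complex.nonneg_iff.2 ⟨h.pos _, ?_⟩
      have := h.herm (c (∑ i, x i • b i)) (∑ j, x j • b j)
      rw [h.invol] at this
      exact (Complex.conj_eq_iff_im.1 this).symm
  obtain ⟨B, hB⟩ : ∃ B : Matrix (Fin n) (Fin n) ℂ, G = B.conjTranspose * B :=
    CStarAlgebra.nonneg_iff_eq_star_mul_self.1 hG.nonneg
  -- The rows of a factor `B` of the Gram matrix `G = B* B`, read in the dual basis, are the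
  -- functionals.
  refine ⟨n, fun k => ∑ j, B k j • b.coord j, ?_⟩
  refine LinearMap.ext fun ψ' => LinearMap.ext fun χ => ?_
  -- Writing the first argument as a conjugate turns the bilinear form into the sesquilinear one
  -- described by `G`.
  obtain ⟨ψ, rfl⟩ : ∃ ψ, c ψ = ψ' := ⟨c ψ', h.invol ψ'⟩
  have e1 := hexp (fun i => b.repr ψ i) (fun i => b.repr χ i)
  rw [b.sum_repr, b.sum_repr] at e1
  rw [e1]
  simp only [LinearMap.sum_apply, LinearMap.smulRight_apply, conjFunctional_apply, h.invol,
    LinearMap.smul_apply, smul_eq_mul, Module.Basis.coord_apply, map_sum, map_mul, Finset.sum_mul,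
    Finset.mul_sum]
  rw [hB]
  simp only [Matrix.mul_apply, Matrix.conjTranspose_apply, Finset.mul_sum]
  rw [Finset.sum_congr rfl fun i _ => Finset.sum_comm, Finset.sum_comm]
  refine Finset.sum_congr rfl fun k _ => ?_
  conv_rhs => rw [Finset.sum_comm]
  refine Finset.sum_congr rfl fun i _ => Finset.sum_congr rfl fun j _ => ?_
  rw [starRingEnd_apply, starRingEnd_apply]
  ring

/-- The restriction of a conjugation to a stable subspace. -/
def restrictConj (c : T →ₛₗ[starRingEnd ℂ] T) (W : Submodule ℂ T) (hW : ∀ ψ ∈ W, c ψ ∈ W) :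
    W →ₛₗ[starRingEnd ℂ] W where
  toFun ψ := ⟨c ψ, hW ψ ψ.2⟩
  map_add' ψ χ := Subtype.ext (map_add c ψ.1 χ.1)
  map_smul' a ψ := Subtype.ext (map_smulₛₗ c a ψ.1)

lemma IsTwoPointForm.comap {σ : T →ₗ[ℂ] T →ₗ[ℂ] ℂ} {c : T →ₛₗ[starRingEnd ℂ] T}
    {β : T →ₗ[ℂ] T →ₗ[ℂ] ℂ} (h : IsTwoPointForm σ c β) (U : T' →ₗ[ℂ] T)
    (hU : Function.Injective U)
    {c' : T' →ₛₗ[starRingEnd ℂ] T'} (hc : ∀ ψ, U (c' ψ) = c (U ψ)) :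
    IsTwoPointForm (σ.compl₁₂ U U) c' (β.compl₁₂ U U) where
  invol ψ := hU (by rw [hc, hc, h.invol])
  comm ψ χ := h.comm _ _
  herm ψ χ := by simpa [hc] using h.herm (U ψ) (U χ)
  pos ψ := by simpa [hc] using h.pos (U ψ)

/-- A polynomial functional involves finitely many test functions. The subspace must be stable under
`c`, hence each generator is adjoined together with its conjugate. -/
lemma exists_finiteDimensional_range (c : T →ₛₗ[starRingEnd ℂ] T) (hc : ∀ ψ, c (c ψ) = ψ)
    (F : FieldAlg T) : ∃ W : Submodule ℂ T, FiniteDimensional ℂ W ∧ (∀ ψ ∈ W, c ψ ∈ W) ∧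
      ∃ F₀ : FieldAlg W, secondQuant W.subtype F₀ = F := by
  have hmono : ∀ {W W' : Submodule ℂ T} (_ : W ≤ W') (F₀ : FieldAlg W),
      ∃ F₁ : FieldAlg W', secondQuant W'.subtype F₁ = secondQuant W.subtype F₀ :=
    fun {W W'} h F₀ => ⟨secondQuant (Submodule.inclusion h) F₀, by
      rw [← secondQuant_comp, Submodule.subtype_comp_inclusion]⟩
  have hsup : ∀ {W W' : Submodule ℂ T}, (∀ ψ ∈ W, c ψ ∈ W) → (∀ ψ ∈ W', c ψ ∈ W') →
      ∀ ψ ∈ W ⊔ W', c ψ ∈ W ⊔ W' := by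
    intro W W' h h' ψ hψ
    obtain ⟨x, hx, y, hy, rfl⟩ := Submodule.mem_sup.1 hψ
    rw [map_add]
    exact Submodule.add_mem_sup (h x hx) (h' y hy)
  induction F using fieldAlg_induction with
  | one => exact ⟨⊥, inferInstance, by simp, 1, by simp⟩
  | add F F' hF hF' =>
    obtain ⟨W, i, hW, F₀, rfl⟩ := hF
    obtain ⟨W', i', hW', F₀', rfl⟩ := hF'
    obtain ⟨G, hG⟩ := hmono (le_sup_left : W ≤ W ⊔ W') F₀
    obtain ⟨G', hG'⟩ := hmono (le_sup_right : W' ≤ W ⊔ W') F₀'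
    exact ⟨W ⊔ W', inferInstance, hsup hW hW', G + G', by rw [map_add, hG, hG']⟩
  | smul a F hF =>
    obtain ⟨W, i, hW, F₀, rfl⟩ := hF
    exact ⟨W, i, hW, a • F₀, by rw [map_smul]⟩
  | mul ψ F hF =>
    obtain ⟨W, i, hW, F₀, rfl⟩ := hF
    let W' := Submodule.span ℂ {ψ, c ψ}
    have i' : FiniteDimensional ℂ W' := FiniteDimensional.span_of_finite ℂ (by simp)
    have hW' : ∀ φ ∈ W', c φ ∈ W' := by
      intro φ hφ
      obtain ⟨a, b, rfl⟩ := Submodule.mem_span_pair.1 hφ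
      rw [map_add, map_smulₛₗ, map_smulₛₗ, hc]
      exact W'.add_mem (W'.smul_mem _ (Submodule.subset_span (by simp)))
        (W'.smul_mem _ (Submodule.subset_span (by simp)))
    have hψ : ψ ∈ W ⊔ W' := Submodule.mem_sup_right (Submodule.subset_span (by simp))
    obtain ⟨G, hG⟩ := hmono (le_sup_left : W ≤ W ⊔ W') F₀
    exact ⟨W ⊔ W', inferInstance, hsup hW hW', field ⟨ψ, hψ⟩ * G, by
      rw [map_mul, secondQuant_field, hG]; rfl⟩

/-- The inclusion of a stable finite-dimensional subspace respects the star product, the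
`*`-operation and the value at zero, so the sum-of-squares case suffices. -/
lemma IsTwoPointForm.vacuumPart_starProd_nonneg {σ : T →ₗ[ℂ] T →ₗ[ℂ] ℂ}
    {c : T →ₛₗ[starRingEnd ℂ] T} {β : T →ₗ[ℂ] T →ₗ[ℂ] ℂ} (h : IsTwoPointForm σ c β)
    (F : FieldAlg T) :
    ∃ r : ℝ, 0 ≤ r ∧ vacuumPart (starProd (starForm β) (starOp c F) F) = r := by
  obtain ⟨W, i, hW, F₀, rfl⟩ := exists_finiteDimensional_range c h.invol F
  have h' := h.comap W.subtype W.subtype_injective (c' := restrictConj c W hW) fun ψ => rfl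
  obtain ⟨n, l, hl⟩ := h'.exists_eq_sum
  obtain ⟨r, hr, hr'⟩ := vacuumPart_starProd_nonneg_of_eq_sum h'.invol l F₀
  refine ⟨r, hr, ?_⟩
  rw [← hr', ← hl, ← secondQuant_starOp W.subtype (c := restrictConj c W hW) fun ψ => rfl,
    ← secondQuant_starProd W.subtype (σ := starForm (β.compl₁₂ W.subtype W.subtype))
      fun ψ χ => rfl, vacuumPart_secondQuant]

/-- Existence of the quasi-free state, together with its normal-ordering map. -/
theorem IsTwoPointForm.exists_state {σ : T →ₗ[ℂ] T →ₗ[ℂ] ℂ}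
    {c : T →ₛₗ[starRingEnd ℂ] T} {β : T →ₗ[ℂ] T →ₗ[ℂ] ℂ} (h : IsTwoPointForm σ c β) :
    ∃ S : FieldAlg T →ₗ[ℂ] FieldAlg T, IsWickMap (symmPart β) S ∧
      IsQuasiFree σ (fun ψ χ => β ψ χ) (vacuumPart.toLinearMap ∘ₗ S) ∧
      IsAlgState σ c (vacuumPart.toLinearMap ∘ₗ S) := by
  obtain ⟨S, hS⟩ := exists_isWickMap (symmPart_symm β)
  refine ⟨S, hS, hS.isQuasiFree h.eq_symmPart_add, ?_, fun F => ?_⟩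
  · simp [hS.map_one]
  · have e : S (starProd σ (starOp c F) F) = starProd (starForm β) (starOp c (S F)) (S F) := by
      rw [hS.map_starProd (τ := starForm β), hS.map_starOp h.invol]
      · intro ψ χ
        rw [symmPart_apply, symmPart_apply, map_mul, map_add, h.herm, h.herm, add_comm]
        norm_num [Complex.conj_ofNat]
      · intro ψ χ
        rw [half_I_mul_starForm, ← h.eq_symmPart_add]
    obtain ⟨r, hr, hr'⟩ := h.vacuumPart_starProd_nonneg (S F)
    rw [LinearMap.comp_apply, e, AlgHom.toLinearMap_apply, hr']
    exact ⟨hr, Complex.ofReal_im r⟩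

lemma secondQuant_fieldProd (U : T →ₗ[ℂ] T') {σ : T →ₗ[ℂ] T →ₗ[ℂ] ℂ} {σ' : T' →ₗ[ℂ] T' →ₗ[ℂ] ℂ}
    (h : ∀ ψ χ, σ' (U ψ) (U χ) = σ ψ χ) (n : ℕ) (ψ : Fin n → T) :
    secondQuant U (fieldProd σ n ψ) = fieldProd σ' n fun i => U (ψ i) := by
  induction n with
  | zero => simp [fieldProd]
  | succ n ih =>
    rw [fieldProd, secondQuant_starProd U h, secondQuant_field, ih]
    rfl

lemma wick_comp {X X' : Type} (U : X → X') {w : X → X → ℂ} {w' : X' → X' → ℂ}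
    (h : ∀ ψ χ, w' (U ψ) (U χ) = w ψ χ) (n : ℕ) (ψ : Fin n → X) :
    wick w' n (fun i => U (ψ i)) = wick w n ψ := by
  induction n using Nat.strong_induction_on with
  | _ n ih =>
    match n, ψ, ih with
    | 0, ψ, _ => rfl
    | 1, ψ, _ => rfl
    | n + 2, ψ, ih =>
      rw [wick, wick]
      refine Finset.sum_congr rfl fun j _ => ?_
      rw [h, ← ih n (by omega)]
      rfl

lemma IsQuasiFree.comp {σ : T →ₗ[ℂ] T →ₗ[ℂ] ℂ} {σ' : T' →ₗ[ℂ] T' →ₗ[ℂ] ℂ} {w : T → T → ℂ}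
    {w' : T' → T' → ℂ} {Ω : FieldAlg T' →ₗ[ℂ] ℂ} (hΩ : IsQuasiFree σ' w' Ω) (U : T →ₗ[ℂ] T')
    (hσ : ∀ ψ χ, σ' (U ψ) (U χ) = σ ψ χ) (hw : ∀ ψ χ, w' (U ψ) (U χ) = w ψ χ) :
    IsQuasiFree σ w (Ω ∘ₗ (secondQuant U).toLinearMap) := by
  intro n ψ
  rw [LinearMap.comp_apply, AlgHom.toLinearMap_apply, secondQuant_fieldProd U hσ, hΩ,
    wick_comp U hw]

lemma bijective_secondQuant {U : T →ₗ[ℂ] T'} (hU : Function.Bijective U) :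
    Function.Bijective (secondQuant U) := by
  let e := LinearEquiv.ofBijective U hU
  refine Function.bijective_iff_has_inverse.2 ⟨secondQuant e.symm.toLinearMap, fun F => ?_,
    fun F => ?_⟩
  · have : e.symm.toLinearMap ∘ₗ U = LinearMap.id := by
      ext ψ
      exact e.symm_apply_apply ψ
    rw [← secondQuant_comp, this, secondQuant_id]
  · have : U ∘ₗ e.symm.toLinearMap = LinearMap.id := by
      ext ψ
      exact e.apply_symm_apply ψ
    rw [← secondQuant_comp, this, secondQuant_id]

/-- The correlation functions of transformed polynomial functionals are polynomials in the
two-point functions. -/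
lemma IsWickMap.mem_adjoin {σ : T →ₗ[ℂ] T →ₗ[ℂ] ℂ} {c : T →ₛₗ[starRingEnd ℂ] T}
    {β : T →ₗ[ℂ] T →ₗ[ℂ] ℂ} (h : IsTwoPointForm σ c β) {S : FieldAlg T →ₗ[ℂ] FieldAlg T}
    (hS : IsWickMap (symmPart β) S) {ι : Type} {U : ι → T →ₗ[ℂ] T}
    (hU : ∀ t ψ χ, β (U t ψ) (U t χ) = β ψ χ) {A : Subalgebra ℂ (ι → ℂ)}
    (hA : ∀ ψ χ, (fun t => β ψ (U t χ)) ∈ A) (F G : FieldAlg T) :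
    (fun t => vacuumPart (S (starProd σ F (secondQuant (U t) G)))) ∈ A := by
  have key : ∀ F G : FieldAlg T,
      (fun t => vacuumPart (starProd (starForm β) F (secondQuant (U t) G))) ∈ A := by
    intro F
    induction F using fieldAlg_induction with
    | one =>
      intro G
      have : (fun t => vacuumPart (starProd (starForm β) 1 (secondQuant (U t) G)))
          = algebraMap ℂ (ι → ℂ) (vacuumPart G) := by
        ext t
        rw [starProd_one_left, vacuumPart_secondQuant]
        rfl
      rw [this]
      exact A.algebraMap_mem _
    | add F F' hF hF' =>
      intro G
      simp only [starProd_add_left, map_add]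
      exact A.add_mem (hF G) (hF' G)
    | smul a F hF =>
      intro G
      simp only [starProd_smul_left, map_smul]
      exact A.smul_mem (hF G) a
    | mul ψ F hF =>
      intro G
      -- The `χ j` and `G' j` depend neither on the direction nor on `t`, so all dependence on `t`
      -- is in `β ψ (U t (χ j))` and in the terms covered by induction.
      obtain ⟨n, χ, G', hG'⟩ := exists_dirDeriv_eq_sum G
      have : (fun t => vacuumPart (starProd (starForm β) (field ψ * F) (secondQuant (U t) G)))
          = ∑ j, (fun t => β ψ (U t (χ j))) *
            (fun t => vacuumPart (starProd (starForm β) F (secondQuant (U t) (G' j)))) := by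
        ext t
        rw [starProd_field_mul, map_add, map_mul, vacuumPart_field, zero_mul, zero_add, map_smul,
          dirDeriv_secondQuant, hG', map_sum, ← starProdₗ_apply, map_sum, map_sum,
          Finset.smul_sum, Finset.sum_apply]
        refine Finset.sum_congr rfl fun j _ => ?_
        rw [Pi.mul_apply, map_smul, map_smul, map_smul, smul_smul, smul_eq_mul, starProdₗ_apply,
          LinearMap.comp_apply, half_I_mul_starForm]
      rw [this]
      exact A.sum_mem fun j _ => A.mul_mem (hA _ _) (hF _)
  have e : ∀ t, S (starProd σ F (secondQuant (U t) G))
      = starProd (starForm β) (S F) (secondQuant (U t) (S G)) := by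
    intro t
    rw [hS.map_starProd (τ := starForm β), hS.map_secondQuant hS (U t)]
    · intro ψ χ
      rw [symmPart_apply, symmPart_apply, hU, hU]
    · intro ψ χ
      rw [half_I_mul_starForm, ← h.eq_symmPart_add]
  simp only [e]
  exact key _ _

end Positivity

/-! ### Plancherel for the Fourier integral on the line. -/

section Plancherel

open FourierTransform

/-- The `L²` transform and the Fourier integral agree as distributions: tested against a smooth
compactly supported function, both move the transform onto it. -/
lemma fourier_toLp_ae_eq {f : ℝ → ℂ} (h1 : Integrable f) (h2 : MemLp f 2) :
    (𝓕 (h2.toLp f) : Lp ℂ 2 (volume : Measure ℝ)) =ᵐ[volume] 𝓕 f := by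
  have hcont : Continuous (𝓕 f) :=
    VectorFourier.fourierIntegral_continuous Real.continuous_fourierChar
      (by exact continuous_inner) h1
  refine ae_eq_of_integral_contDiff_smul_eq
    ((Lp.memLp _).locallyIntegrable (by norm_num)) hcont.locallyIntegrable fun g hg hgs => ?_
  have hgc : ContDiff ℝ ∞ fun x => (g x : ℂ) := Complex.ofRealCLM.contDiff.comp hg
  have hgs' : HasCompactSupport fun x => (g x : ℂ) :=
    hgs.comp_left (g := fun r : ℝ => (r : ℂ)) Complex.ofReal_zero
  let φ : SchwartzMap ℝ ℂ := hgs'.toSchwartzMap hgc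
  have e1 := DFunLike.congr_fun (Lp.fourier_toTemperedDistribution_eq (h2.toLp f)) φ
  rw [TemperedDistribution.fourier_apply, Lp.toTemperedDistribution_apply,
    Lp.toTemperedDistribution_apply] at e1
  have e2 : ∫ x, (𝓕 φ) x • (h2.toLp f) x = ∫ x, (𝓕 φ) x • f x := by
    refine integral_congr_ae ?_
    filter_upwards [h2.coeFn_toLp] with x hx
    rw [hx]
  have e3 := VectorFourier.integral_fourierIntegral_smul_eq_flip (L := innerₗ ℝ)
    Real.continuous_fourierChar continuous_inner (μ := volume) (ν := volume) φ.integrable h1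
  have e4 : ∫ x, g x • (𝓕 f) x = ∫ x, (𝓕 φ) x • f x := by
    rw [flip_innerₗ] at e3
    exact e3.symm
  rw [e4, ← e2, e1]
  rfl

/-- The Fourier transform on `L¹ ∩ L²` preserves the `L²` norm. -/
theorem lintegral_enorm_fourier_sq {f : ℝ → ℂ} (h1 : Integrable f) (h2 : MemLp f 2) :
    ∫⁻ k, ‖𝓕 f k‖ₑ ^ 2 = ∫⁻ x, ‖f x‖ₑ ^ 2 := by
  have key : ∀ g : ℝ → ℂ, ∫⁻ x, ‖g x‖ₑ ^ 2 = eLpNorm g 2 volume ^ 2 := by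
    intro g
    rw [eLpNorm_eq_lintegral_rpow_enorm_toReal (by norm_num) (by norm_num)]
    simp only [ENNReal.toReal_ofNat, ENNReal.rpow_ofNat, one_div]
    rw [← ENNReal.rpow_ofNat, ← ENNReal.rpow_mul]
    simp
  rw [key, key, ← eLpNorm_congr_ae (fourier_toLp_ae_eq h1 h2), ← eLpNorm_congr_ae h2.coeFn_toLp]
  congr 1
  have := Lp.norm_fourier_eq (h2.toLp f)
  rw [Lp.norm_def, Lp.norm_def] at this
  exact (ENNReal.toReal_eq_toReal_iff' (Lp.eLpNorm_ne_top _) (Lp.eLpNorm_ne_top _)).1 this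

end Plancherel

/-! ### Restriction to the generators of the cone. -/

section ConeMeasure

lemma ae_fiber {p : Cone → Prop} (h : ∀ᵐ x ∂coneMeasure, p x) :
    ∀ᵐ s ∂sphereMeasure, ∀ᵐ V : ℝ, p (V, s) := by
  have h' : ∀ᵐ z ∂(sphereMeasure.prod (volume : Measure ℝ)), p z.swap :=
    Measure.measurePreserving_swap.quasiMeasurePreserving.ae h
  exact Measure.ae_ae_of_ae_prod h'

lemma lintegral_cone {f : Cone → ℝ≥0∞} (hf : AEMeasurable f coneMeasure) :
    ∫⁻ x, f x ∂coneMeasure = ∫⁻ s, (∫⁻ V : ℝ, f (V, s)) ∂sphereMeasure :=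
  lintegral_prod_symm f hf

/-- Strong measurability makes the coincidence set measurable, without which the fibrewise statement
would not imply the global one. -/
lemma ae_cone_of_fiber {f g : Cone → ℂ} (hf : StronglyMeasurable f) (hg : StronglyMeasurable g)
    (h : ∀ᵐ s ∂sphereMeasure, ∀ᵐ V : ℝ, f (V, s) = g (V, s)) : f =ᵐ[coneMeasure] g := by
  have hm : MeasurableSet {x : Cone | f x = g x} := measurableSet_eq_fun hf.measurable hg.measurable
  refine (Measure.ae_prod_iff_ae_ae hm).2 ?_
  exact (Measure.ae_ae_comm (p := fun V s => f (V, s) = g (V, s)) hm).2 h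

lemma eLpNorm_cone_sq (f : Cone → ℂ) :
    eLpNorm f 2 coneMeasure ^ 2 = ∫⁻ x, ‖f x‖ₑ ^ 2 ∂coneMeasure := by
  rw [eLpNorm_eq_lintegral_rpow_enorm_toReal (by norm_num) (by norm_num)]
  simp only [ENNReal.toReal_ofNat, ENNReal.rpow_ofNat, one_div]
  rw [← ENNReal.rpow_ofNat, ← ENNReal.rpow_mul]
  simp

lemma memLp_fiber (u : L2Cone) : ∀ᵐ s ∂sphereMeasure, MemLp (fun V => u (V, s)) 2 := by
  have hm := Lp.stronglyMeasurable u
  have h1 : ∫⁻ x, ‖u x‖ₑ ^ 2 ∂coneMeasure ≠ ⊤ := by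
    rw [← eLpNorm_cone_sq]
    exact ENNReal.pow_ne_top (Lp.eLpNorm_ne_top u)
  have hme : Measurable fun x : Cone => ‖u x‖ₑ ^ 2 := hm.measurable.enorm.pow_const 2
  rw [lintegral_cone hme.aemeasurable] at h1
  have h2 := ae_lt_top (hme.lintegral_prod_left') h1
  filter_upwards [h2] with s hs
  refine ⟨(hm.comp_measurable measurable_prodMk_right).aestronglyMeasurable, ?_⟩
  rw [eLpNorm_eq_lintegral_rpow_enorm_toReal (by norm_num) (by norm_num)]
  refine ENNReal.rpow_lt_top_of_nonneg (by norm_num) ?_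
  simpa using hs.ne

end ConeMeasure

/-! ### Bounded multipliers on `L²(𝒞)`. -/

section Multipliers

lemma norm_mul_toLp_le {m : Cone → ℂ} {C : ℝ} (hC : ∀ x, ‖m x‖ ≤ C) (u : L2Cone) (v : L2Cone)
    (h : (v : Cone → ℂ) =ᵐ[coneMeasure] fun x => m x * u x) : ‖v‖ ≤ C * ‖u‖ := by
  refine Lp.norm_le_mul_norm_of_ae_le_mul ?_
  filter_upwards [h] with x hx
  rw [hx, norm_mul]
  exact mul_le_mul_of_nonneg_right (hC x) (norm_nonneg _)

lemma memLp_mul {m : Cone → ℂ} (hm : Measurable m) {C : ℝ} (hC : ∀ x, ‖m x‖ ≤ C) (u : L2Cone) :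
    MemLp (fun x => m x * u x) 2 coneMeasure := by
  refine MemLp.of_le_mul (c := C) (Lp.memLp u)
    (hm.aestronglyMeasurable.mul (Lp.aestronglyMeasurable u)) (ae_of_all _ fun x => ?_)
  rw [norm_mul]
  exact mul_le_mul_of_nonneg_right (hC x) (norm_nonneg _)

open Classical in
/-- Multiplication by a bounded measurable function, as an operator on `L²(𝒞)` (zero if the
function is not measurable or not bounded). -/
def mulL2 (m : Cone → ℂ) : L2Cone →L[ℂ] L2Cone :=
  if h : Measurable m ∧ ∃ C, ∀ x, ‖m x‖ ≤ C then
    LinearMap.mkContinuous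
      { toFun := fun u => (memLp_mul h.1 h.2.choose_spec u).toLp _
        map_add' := fun u v => by
          rw [← MemLp.toLp_add]
          refine (MemLp.toLp_eq_toLp_iff _ _).2 ?_
          filter_upwards [Lp.coeFn_add u v] with x hx
          rw [hx, Pi.add_apply, mul_add]
          rfl
        map_smul' := fun c u => by
          rw [RingHom.id_apply, ← MemLp.toLp_const_smul]
          refine (MemLp.toLp_eq_toLp_iff _ _).2 ?_
          filter_upwards [Lp.coeFn_smul c u] with x hx
          rw [hx, Pi.smul_apply, Pi.smul_apply, smul_eq_mul, smul_eq_mul, mul_left_comm] }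
      h.2.choose
      fun u => norm_mul_toLp_le h.2.choose_spec u _ (MemLp.coeFn_toLp (memLp_mul h.1 h.2.choose_spec u))
  else 0

lemma coeFn_mulL2 {m : Cone → ℂ} (hm : Measurable m) {C : ℝ} (hC : ∀ x, ‖m x‖ ≤ C) (u : L2Cone) :
    (mulL2 m u : Cone → ℂ) =ᵐ[coneMeasure] fun x => m x * u x := by
  have h : Measurable m ∧ ∃ C, ∀ x, ‖m x‖ ≤ C := ⟨hm, C, hC⟩
  rw [mulL2, dif_pos h]
  exact MemLp.coeFn_toLp (memLp_mul h.1 h.2.choose_spec u)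

lemma norm_mulL2_le {m : Cone → ℂ} (hm : Measurable m) {C : ℝ} (hC : ∀ x, ‖m x‖ ≤ C)
    (u : L2Cone) : ‖mulL2 m u‖ ≤ C * ‖u‖ :=
  norm_mul_toLp_le hC u _ (coeFn_mulL2 hm hC u)

/-- Dominated convergence for `|(m n - 1) u|²`, with majorant `(C + 1)² |u|²`; used to remove
cutoffs in `V`. -/
lemma tendsto_mulL2_one {m : ℕ → Cone → ℂ} (hm : ∀ n, Measurable (m n)) {C : ℝ}
    (hC : ∀ n x, ‖m n x‖ ≤ C) (h1 : ∀ x, Tendsto (fun n => m n x) atTop (𝓝 1)) (u : L2Cone) :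
    Tendsto (fun n => mulL2 (m n) u) atTop (𝓝 u) := by
  rw [tendsto_iff_norm_sub_tendsto_zero]
  have hsq : ∀ n, ‖mulL2 (m n) u - u‖ ^ 2 = ∫ x, ‖(m n x - 1) * u x‖ ^ 2 ∂coneMeasure := by
    intro n
    have h2 : ‖mulL2 (m n) u - u‖ ^ 2
        = RCLike.re (inner ℂ (mulL2 (m n) u - u) (mulL2 (m n) u - u)) :=
      (inner_self_eq_norm_sq _).symm
    rw [h2, L2.inner_def, ← integral_re (L2.integrable_inner _ _)]
    refine integral_congr_ae ?_
    filter_upwards [Lp.coeFn_sub (mulL2 (m n) u) u, coeFn_mulL2 (hm n) (hC n) u] with x hx hx'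
    rw [hx, Pi.sub_apply, hx', inner_self_eq_norm_sq, sub_mul, one_mul]
  have hlim : Tendsto (fun n => ∫ x, ‖(m n x - 1) * u x‖ ^ 2 ∂coneMeasure) atTop (𝓝 0) := by
    have : (0 : ℝ) = ∫ x : Cone, (0 : ℝ) ∂coneMeasure := by simp
    rw [this]
    refine tendsto_integral_of_dominated_convergence (fun x => (C + 1) ^ 2 * ‖u x‖ ^ 2)
      (fun n => ?_) ?_ (fun n => ae_of_all _ fun x => ?_) (ae_of_all _ fun x => ?_)
    · exact ((((hm n).sub_const 1).mul (Lp.stronglyMeasurable u).measurable).norm.pow_const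
        2).aestronglyMeasurable
    · exact ((memLp_two_iff_integrable_sq_norm (Lp.aestronglyMeasurable u)).1
        (Lp.memLp u)).const_mul _
    · rw [Real.norm_of_nonneg (by positivity), norm_mul, mul_pow]
      have h3 : ‖m n x - 1‖ ≤ C + 1 := (norm_sub_le _ _).trans (by simpa using hC n x)
      gcongr
    · have h4 : Tendsto (fun n => ‖(m n x - 1) * u x‖ ^ 2) atTop (𝓝 (‖((1 : ℂ) - 1) * u x‖ ^ 2)) :=
        ((((h1 x).sub_const 1).mul_const (u x)).norm).pow 2
      simpa using h4
  have := (hlim.congr fun n => (hsq n).symm).sqrt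
  simpa [Real.sqrt_sq] using this

end Multipliers

/-! ### The Fourier transform in `V`. -/

section PartialFourier

open FourierTransform

/-- The Fourier transform in the variable `V`, given by the integral. -/
def partialFourier (u : Cone → ℂ) (x : Cone) : ℂ := 𝓕 (fun V => u (V, x.2)) x.1

lemma partialFourier_eq (u : Cone → ℂ) (x : Cone) :
    partialFourier u x
      = ∫ V : ℝ, Complex.exp (((-2 * Real.pi * V * x.1 : ℝ) : ℂ) * Complex.I) * u (V, x.2) := by
  rw [partialFourier, Real.fourier_real_eq_integral_exp_smul]
  rfl

lemma stronglyMeasurable_partialFourier {u : Cone → ℂ} (hu : StronglyMeasurable u) :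
    StronglyMeasurable (partialFourier u) := by
  have h : StronglyMeasurable fun y : Cone × ℝ =>
      Complex.exp (((-2 * Real.pi * y.2 * y.1.1 : ℝ) : ℂ) * Complex.I) * u (y.2, y.1.2) := by
    refine StronglyMeasurable.mul (Continuous.stronglyMeasurable (by fun_prop))
      (hu.comp_measurable (by fun_prop))
  have e : partialFourier u = fun x => ∫ V : ℝ,
      Complex.exp (((-2 * Real.pi * V * x.1 : ℝ) : ℂ) * Complex.I) * u (V, x.2) :=
    funext (partialFourier_eq u)
  rw [e]
  exact h.integral_prod_right' (ν := (volume : Measure ℝ))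

/-- The square integrable functions that are integrable along almost every generator. -/
def fiberIntegrable : Submodule ℂ L2Cone where
  carrier := {u | ∀ᵐ s ∂sphereMeasure, Integrable fun V => u (V, s)}
  zero_mem' := by
    filter_upwards [ae_fiber (Lp.coeFn_zero ℂ 2 coneMeasure)] with s hs
    exact (integrable_zero ℝ ℂ volume).congr (hs.mono fun V hV => hV.symm)
  add_mem' := by
    intro u v hu hv
    filter_upwards [hu, hv, ae_fiber (Lp.coeFn_add u v)] with s h1 h2 h3
    exact (h1.add h2).congr (h3.mono fun V hV => hV.symm)
  smul_mem' := by
    intro c u hu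
    filter_upwards [hu, ae_fiber (Lp.coeFn_smul c u)] with s h1 h3
    exact (h1.smul c).congr (h3.mono fun V hV => hV.symm)

lemma mem_fiberIntegrable {u : L2Cone} :
    u ∈ fiberIntegrable ↔ ∀ᵐ s ∂sphereMeasure, Integrable fun V => u (V, s) := Iff.rfl

/-- Plancherel on almost every generator, integrated over the sphere. -/
lemma eLpNorm_partialFourier {u : L2Cone} (hu : u ∈ fiberIntegrable) :
    eLpNorm (partialFourier u) 2 coneMeasure = eLpNorm u 2 coneMeasure := by
  have h : eLpNorm (partialFourier u) 2 coneMeasure ^ 2 = eLpNorm u 2 coneMeasure ^ 2 := by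
    have hm := Lp.stronglyMeasurable u
    have m1 : Measurable fun x : Cone => ‖u x‖ₑ ^ 2 := hm.measurable.enorm.pow_const 2
    have m2 : Measurable fun x : Cone => ‖partialFourier u x‖ₑ ^ 2 :=
      (stronglyMeasurable_partialFourier hm).measurable.enorm.pow_const 2
    rw [eLpNorm_cone_sq, eLpNorm_cone_sq, lintegral_cone m1.aemeasurable,
      lintegral_cone m2.aemeasurable]
    refine lintegral_congr_ae ?_
    filter_upwards [mem_fiberIntegrable.1 hu, memLp_fiber u] with s h1 h2
    have h3 := lintegral_enorm_fourier_sq h1 h2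
    simpa only [partialFourier] using h3
  exact (ENNReal.pow_right_strictMono two_ne_zero).injective h

lemma memLp_partialFourier {u : L2Cone} (hu : u ∈ fiberIntegrable) :
    MemLp (partialFourier u) 2 coneMeasure :=
  ⟨(stronglyMeasurable_partialFourier (Lp.stronglyMeasurable u)).aestronglyMeasurable, by
    rw [eLpNorm_partialFourier hu]
    exact Lp.eLpNorm_lt_top u⟩

/-- The Fourier transform in `V` on `fiberIntegrable`. -/
def vFourierAux : fiberIntegrable →ₗ[ℂ] L2Cone where
  toFun u := (memLp_partialFourier u.2).toLp _
  map_add' u v := by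
    rw [← MemLp.toLp_add]
    refine (MemLp.toLp_eq_toLp_iff _ _).2 ?_
    refine ae_cone_of_fiber (stronglyMeasurable_partialFourier (Lp.stronglyMeasurable _))
      ((stronglyMeasurable_partialFourier (Lp.stronglyMeasurable _)).add
        (stronglyMeasurable_partialFourier (Lp.stronglyMeasurable _))) ?_
    filter_upwards [mem_fiberIntegrable.1 u.2, mem_fiberIntegrable.1 v.2, ae_fiber (Lp.coeFn_add u.1 v.1)] with s h1 h2 h3
    refine ae_of_all _ fun k => ?_
    have e : partialFourier (u + v : fiberIntegrable).1 (k, s)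
        = 𝓕 ((fun V => u.1 (V, s)) + fun V => v.1 (V, s)) k := by
      rw [partialFourier, Real.fourier_real_eq, Real.fourier_real_eq]
      refine integral_congr_ae ?_
      filter_upwards [h3] with V hV
      exact congrArg _ hV
    rw [e]
    exact congrFun (VectorFourier.fourierIntegral_add Real.continuous_fourierChar
      (L := innerₗ ℝ) continuous_inner h1 h2) k
  map_smul' c u := by
    rw [RingHom.id_apply, ← MemLp.toLp_const_smul]
    refine (MemLp.toLp_eq_toLp_iff _ _).2 ?_
    refine ae_cone_of_fiber (stronglyMeasurable_partialFourier (Lp.stronglyMeasurable _))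
      ((stronglyMeasurable_partialFourier (Lp.stronglyMeasurable _)).const_smul c) ?_
    filter_upwards [ae_fiber (Lp.coeFn_smul c u.1)] with s h3
    refine ae_of_all _ fun k => ?_
    rw [partialFourier_eq, Pi.smul_apply, partialFourier_eq, smul_eq_mul, ← integral_const_mul]
    refine integral_congr_ae ?_
    filter_upwards [h3] with V hV
    exact (congrArg _ hV).trans (by simp only [Pi.smul_apply, smul_eq_mul]; ring)

lemma norm_vFourierAux (u : fiberIntegrable) : ‖vFourierAux u‖ = ‖u‖ := by
  rw [Submodule.coe_norm, Lp.norm_def (u : L2Cone), ← eLpNorm_partialFourier u.2]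
  exact Lp.norm_toLp _ (memLp_partialFourier u.2)

/-- The indicator function of `|V| ≤ n`. -/
def cutoff (n : ℕ) (x : Cone) : ℂ := if |x.1| ≤ n then 1 else 0

lemma measurable_cutoff (n : ℕ) : Measurable (cutoff n) :=
  Measurable.ite (measurableSet_le (by fun_prop) measurable_const) measurable_const
    measurable_const

lemma norm_cutoff_le (n : ℕ) (x : Cone) : ‖cutoff n x‖ ≤ 1 := by
  unfold cutoff
  split_ifs <;> simp

lemma tendsto_cutoff (u : L2Cone) : Tendsto (fun n => mulL2 (cutoff n) u) atTop (𝓝 u) := by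
  refine tendsto_mulL2_one measurable_cutoff norm_cutoff_le (fun x => ?_) u
  refine tendsto_const_nhds.congr' ?_
  filter_upwards [(tendsto_natCast_atTop_atTop (R := ℝ)).eventually_ge_atTop |x.1|] with n hn
  rw [cutoff, if_pos hn]

/-- On a bounded interval square integrability implies integrability; hence truncations in `V` are
dense in `L²` and have a Fourier integral. -/
lemma mulL2_mem_fiberIntegrable {m : Cone → ℂ} (hm : Measurable m) {C : ℝ} (hC : ∀ x, ‖m x‖ ≤ C)
    {R : ℝ} (hR : ∀ x : Cone, R < |x.1| → m x = 0) (u : L2Cone) :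
    mulL2 m u ∈ fiberIntegrable := by
  have h : ∀ᵐ s ∂sphereMeasure, Integrable fun V => mulL2 m u (V, s) := by
    filter_upwards [memLp_fiber (mulL2 m u), ae_fiber (coeFn_mulL2 hm hC u)] with s h1 h2
    have h3 : IntegrableOn (fun V => mulL2 m u (V, s)) (Icc (-R) R) :=
      (h1.restrict _).integrable (by norm_num)
    refine ((integrable_indicator_iff measurableSet_Icc).2 h3).congr ?_
    filter_upwards [h2] with V hV
    by_cases hVR : V ∈ Icc (-R) R
    · rw [indicator_of_mem hVR]
    · rw [indicator_of_notMem hVR, hV, hR (V, s) (not_le.1 fun h => hVR (abs_le.1 h)), zero_mul]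
  exact h

lemma dense_fiberIntegrable : DenseRange fiberIntegrable.subtype := by
  intro u
  refine mem_closure_of_tendsto (tendsto_cutoff u) (Eventually.of_forall fun n => ?_)
  refine ⟨⟨_, mulL2_mem_fiberIntegrable (measurable_cutoff n) (norm_cutoff_le n) (R := n) ?_ u⟩,
    rfl⟩
  intro x hx
  rw [cutoff, if_neg (not_le.2 hx)]

/-- The Fourier transform in `V` on `L²(𝒞)`. -/
def vFourier : L2Cone →L[ℂ] L2Cone := vFourierAux.extendOfNorm fiberIntegrable.subtype

lemma vFourier_coe (u : fiberIntegrable) : vFourier u = vFourierAux u :=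
  LinearMap.extendOfNorm_eq dense_fiberIntegrable
    ⟨1, fun x => by rw [norm_vFourierAux, one_mul]; rfl⟩ u

lemma coeFn_vFourier {u : L2Cone} (hu : u ∈ fiberIntegrable) :
    (vFourier u : Cone → ℂ) =ᵐ[coneMeasure] partialFourier u := by
  rw [show vFourier u = vFourierAux ⟨u, hu⟩ from vFourier_coe ⟨u, hu⟩]
  exact MemLp.coeFn_toLp (memLp_partialFourier hu)

lemma norm_vFourier (u : L2Cone) : ‖vFourier u‖ = ‖u‖ := by
  induction u using dense_fiberIntegrable.induction_on with
  | hp => exact isClosed_eq (by fun_prop) (by fun_prop)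
  | ih u => 
    rw [Submodule.subtype_apply, vFourier_coe, norm_vFourierAux]
    rfl

end PartialFourier

/-! ### Reflection, conjugation and Parseval for the bilinear pairing. -/

section Reflection

/-- The reflection `(k, s) ↦ (-k, s)`. -/
def reflect (x : Cone) : Cone := (-x.1, x.2)

lemma measurePreserving_reflect : MeasurePreserving reflect coneMeasure coneMeasure :=
  (Measure.measurePreserving_neg (volume : Measure ℝ)).prod (MeasurePreserving.id sphereMeasure)

/-- Reflection as an isometry of `L²(𝒞)`. -/
def reflectL2 : L2Cone →ₗᵢ[ℂ] L2Cone :=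
  Lp.compMeasurePreservingₗᵢ ℂ reflect measurePreserving_reflect

lemma coeFn_reflectL2 (u : L2Cone) :
    (reflectL2 u : Cone → ℂ) =ᵐ[coneMeasure] fun x => u (-x.1, x.2) :=
  Lp.coeFn_compMeasurePreserving u measurePreserving_reflect

lemma norm_star_sub (u v : L2Cone) : ‖star u - star v‖ = ‖u - v‖ := by
  have h : ‖star u - star v‖ₑ = ‖u - v‖ₑ := by
    rw [Lp.enorm_def, Lp.enorm_def]
    refine eLpNorm_congr_norm_ae ?_
    filter_upwards [Lp.coeFn_sub (star u) (star v), Lp.coeFn_sub u v, Lp.coeFn_star u,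
      Lp.coeFn_star v] with x h1 h2 h3 h4
    rw [h1, h2, Pi.sub_apply, Pi.sub_apply, h3, h4, Pi.star_apply, Pi.star_apply, ← star_sub,
      norm_star]
  simpa [enorm_eq_nnnorm] using congrArg ENNReal.toReal h

lemma continuous_star_L2 : Continuous fun u : L2Cone => star u :=
  (Isometry.of_dist_eq fun u v => by rw [dist_eq_norm, dist_eq_norm, norm_star_sub]).continuous

lemma pairing_apply (u v : L2Cone) : pairing u v = ∫ x, u x * v x ∂coneMeasure := rfl

/-- Reduces continuity and Parseval for the bilinear pairing to facts about the inner product. -/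
lemma pairing_eq_inner (u v : L2Cone) : pairing u v = inner ℂ (star u) v := by
  rw [pairing_apply, L2.inner_def]
  refine integral_congr_ae ?_
  filter_upwards [Lp.coeFn_star u] with x hx
  rw [hx, RCLike.inner_apply, Pi.star_apply, mul_comm]
  simp

lemma tendsto_pairing {ι : Type} {l : Filter ι} {f g : ι → L2Cone} {u v : L2Cone}
    (hf : Tendsto f l (𝓝 u)) (hg : Tendsto g l (𝓝 v)) :
    Tendsto (fun i => pairing (f i) (g i)) l (𝓝 (pairing u v)) := by
  simp only [pairing_eq_inner]
  exact ((continuous_star_L2.tendsto u).comp hf).inner hg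

lemma vFourier_star (u : L2Cone) : vFourier (star u) = star (reflectL2 (vFourier u)) := by
  induction u using dense_fiberIntegrable.induction_on with
  | hp =>
    exact isClosed_eq (vFourier.continuous.comp continuous_star_L2)
      (continuous_star_L2.comp (reflectL2.continuous.comp vFourier.continuous))
  | ih u =>
    rw [Submodule.subtype_apply]
    have hu : star (u : L2Cone) ∈ fiberIntegrable := by
      rw [mem_fiberIntegrable]
      filter_upwards [mem_fiberIntegrable.1 u.2, ae_fiber (Lp.coeFn_star (u : L2Cone))]
        with s h1 h2
      refine (Complex.conjCLE.toContinuousLinearMap.integrable_comp h1).congr ?_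
      filter_upwards [h2] with V hV
      rw [hV]
      rfl
    refine Lp.ext ?_
    have h1 := measurePreserving_reflect.quasiMeasurePreserving.ae_eq_comp (coeFn_vFourier u.2)
    have h2 : partialFourier (star (u : L2Cone) : L2Cone) =ᵐ[coneMeasure]
        fun x => star (partialFourier (u : L2Cone) (-x.1, x.2)) := by
      refine ae_cone_of_fiber (stronglyMeasurable_partialFourier (Lp.stronglyMeasurable _))
        (((stronglyMeasurable_partialFourier (Lp.stronglyMeasurable _)).comp_measurable
          (by fun_prop)).star) ?_
      filter_upwards [ae_fiber (Lp.coeFn_star (u : L2Cone))] with s hs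
      refine ae_of_all _ fun k => ?_
      rw [partialFourier_eq, partialFourier_eq]
      change _ = (starRingEnd ℂ) _
      rw [← integral_conj]
      refine integral_congr_ae ?_
      filter_upwards [hs] with V hV
      rw [hV, map_mul, ← Complex.exp_conj, map_mul, Complex.conj_I, Complex.conj_ofReal]
      congr 2
      push_cast
      ring
    filter_upwards [coeFn_vFourier hu, Lp.coeFn_star (reflectL2 (vFourier u)),
      coeFn_reflectL2 (vFourier (u : L2Cone)), h1, h2] with x e1 e2 e3 e4 e5
    rw [e1, e2, e5, Pi.star_apply, e3]
    exact congrArg star e4.symm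

/-- An isometry preserves the inner product; conjugating before the transform instead of after it
costs the reflection `k ↦ -k`. -/
lemma pairing_vFourier (u v : L2Cone) :
    pairing (reflectL2 (vFourier u)) (vFourier v) = pairing u v := by
  let e : L2Cone →ₗᵢ[ℂ] L2Cone := ⟨vFourier.toLinearMap, norm_vFourier⟩
  rw [pairing_eq_inner, pairing_eq_inner, ← vFourier_star]
  exact e.inner_map_map (star u) v

lemma reflectL2_reflectL2 (u : L2Cone) : reflectL2 (reflectL2 u) = u := by
  refine Lp.ext ?_
  have h1 := measurePreserving_reflect.quasiMeasurePreserving.ae_eq_comp (coeFn_reflectL2 u)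
  filter_upwards [coeFn_reflectL2 (reflectL2 u), h1] with x e1 e2
  rw [e1]
  simpa [reflect] using e2

lemma pairing_reflectL2 (u v : L2Cone) : pairing (reflectL2 u) (reflectL2 v) = pairing u v := by
  rw [pairing_eq_inner, pairing_eq_inner]
  have : star (reflectL2 u) = reflectL2 (star u) := by
    refine Lp.ext ?_
    have h1 := measurePreserving_reflect.quasiMeasurePreserving.ae_eq_comp (Lp.coeFn_star u)
    filter_upwards [coeFn_reflectL2 u, coeFn_reflectL2 (star u), Lp.coeFn_star (reflectL2 u), h1]
      with x e1 e2 e3 e4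
    rw [e2, e3, Pi.star_apply, e1]
    exact e4.symm
  rw [this]
  exact reflectL2.inner_map_map (star u) v

end Reflection

/-! ### The weak derivative on almost every generator. -/

section WeakDerivative

lemma measurableEmbedding_sphere : MeasurableEmbedding (Subtype.val : S2 → E3) :=
  MeasurableEmbedding.subtype_coe (Metric.isClosed_sphere).measurableSet

/-- Pushing the sphere measure forward to `ℝ³` and extending `u` by zero reduces this to the
fundamental lemma of the calculus of variations there. -/
lemma ae_eq_zero_of_sphere_tests {u : S2 → ℂ} (hu : Integrable u sphereMeasure)
    (h : ∀ g : E3 → ℝ, ContDiff ℝ ∞ g → HasCompactSupport g →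
      ∫ s, (g (s : E3) : ℂ) * u s ∂sphereMeasure = 0) : ∀ᵐ s ∂sphereMeasure, u s = 0 := by
  have he : ∀ s : S2, Function.extend (Subtype.val : S2 → E3) u 0 s = u s :=
    fun s => Subtype.val_injective.extend_apply _ _ _
  have hi : Integrable (Function.extend (Subtype.val : S2 → E3) u 0)
      (sphereMeasure.map Subtype.val) := by
    rw [measurableEmbedding_sphere.integrable_map_iff]
    exact hu.congr (ae_of_all _ fun s => (he s).symm)
  have h0 := ae_eq_zero_of_integral_contDiff_smul_eq_zero hi.locallyIntegrable fun g hg hgs => by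
    rw [measurableEmbedding_sphere.integral_map]
    simpa only [he, Complex.real_smul] using h g hg hgs
  have h1 := (measurableEmbedding_sphere.ae_map_iff).1 h0
  filter_upwards [h1] with s hs
  rwa [he] at hs

lemma isWeakVDeriv_coe (ψ : TestSpace) : IsWeakVDeriv ψ.1.1 ψ.1.2 := ψ.2

/-- Testing with products `a(V) g(s)` and letting `g` vary localises the weak derivative on
generators. The exceptional null set may depend on `a`. -/
lemma weak_deriv_fiber_real (ψ : TestSpace) {a : ℝ → ℝ} (ha : ContDiff ℝ ∞ a)
    (has : HasCompactSupport a) : ∀ᵐ s ∂sphereMeasure,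
      ∫ V, (ψ.1.1 (V, s) * ((deriv a V : ℝ) : ℂ) + ψ.1.2 (V, s) * (a V : ℂ)) = 0 := by
  have ha' : Continuous (deriv a) := ha.continuous_deriv (by simp)
  have hint : ∀ (u : L2Cone) {b : ℝ → ℝ}, Continuous b → HasCompactSupport b →
      Integrable (fun x : Cone => u x * (b x.1 : ℂ)) coneMeasure := by
    intro u b hb hbs
    have hc : Continuous fun x : Cone => (b x.1 : ℂ) := by fun_prop
    have hs : HasCompactSupport fun x : Cone => (b x.1 : ℂ) := by
      refine HasCompactSupport.intro (K := tsupport b ×ˢ univ) (hbs.isCompact.prod isCompact_univ)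
        fun x hx => ?_
      have : x.1 ∉ tsupport b := fun h => hx ⟨h, mem_univ _⟩
      simp [image_eq_zero_of_notMem_tsupport this]
    exact (Lp.memLp u).integrable_mul (hc.memLp_of_hasCompactSupport (p := 2) hs)
  have h1 := hint ψ.1.1 ha' has.deriv
  have h2 := hint ψ.1.2 ha.continuous has
  have h12 := h1.add h2
  refine ae_eq_zero_of_sphere_tests h12.integral_prod_right fun g hg hgs => ?_
  let χ : ℝ × E3 → ℝ := fun y => a y.1 * g y.2
  have hχ : ContDiff ℝ ∞ χ := (ha.comp contDiff_fst).mul (hg.comp contDiff_snd)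
  have hχs : HasCompactSupport χ := by
    refine HasCompactSupport.intro (K := tsupport a ×ˢ tsupport g)
      (has.isCompact.prod hgs.isCompact) fun y hy => ?_
    by_cases h : y.1 ∈ tsupport a
    · have : y.2 ∉ tsupport g := fun h' => hy ⟨h, h'⟩
      simp [χ, image_eq_zero_of_notMem_tsupport this]
    · simp [χ, image_eq_zero_of_notMem_tsupport h]
  have hd : ∀ y : ℝ × E3, fderiv ℝ χ y (1, 0) = deriv a y.1 * g y.2 := by
    intro y
    have e1 : HasFDerivAt (fun y : ℝ × E3 => a y.1)
        ((deriv a y.1) • ContinuousLinearMap.fst ℝ ℝ E3) y :=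
      ((ha.differentiable (by simp)) y.1).hasDerivAt.comp_hasFDerivAt y hasFDerivAt_fst
    have e2 : HasFDerivAt (fun y : ℝ × E3 => g y.2)
        ((fderiv ℝ g y.2).comp (ContinuousLinearMap.snd ℝ ℝ E3)) y :=
      ((hg.differentiable (by simp)) y.2).hasFDerivAt.comp y hasFDerivAt_snd
    rw [show fderiv ℝ χ y = _ from (e1.mul e2).fderiv]
    simp [mul_comm]
  have h := isWeakVDeriv_coe ψ χ hχ hχs
  have h3 := integrable_mul_test ψ.1.1 (continuous_fderiv_test hχ) (hasCompactSupport_fderiv_test hχs)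
  have h4 := integrable_mul_test ψ.1.2 hχ.continuous hχs
  have h5 : ∫ x : Cone, (ψ.1.1 x * ((fderiv ℝ χ (incl x) (1, 0) : ℝ) : ℂ)
      + ψ.1.2 x * ((χ (incl x) : ℝ) : ℂ)) ∂coneMeasure = 0 := by
    rw [integral_add h3 h4, h, neg_add_cancel]
  refine Eq.trans ?_ ((integral_prod_symm _ (h3.add h4)).symm.trans h5)
  refine integral_congr_ae (ae_of_all _ fun s => ?_)
  change _ * ∫ V : ℝ, _ = _
  rw [← integral_const_mul]
  refine integral_congr_ae (ae_of_all _ fun V => ?_)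
  simp only [hd, incl, χ, Pi.add_apply]
  push_cast
  ring

lemma integrable_fiber_mul (u : L2Cone) : ∀ᵐ s ∂sphereMeasure, ∀ b : ℝ → ℂ, Continuous b →
    HasCompactSupport b → Integrable fun V => u (V, s) * b V := by
  filter_upwards [memLp_fiber u] with s hs b hb hbs
  exact hs.integrable_mul (hb.memLp_of_hasCompactSupport (p := 2) hbs)

/-- Weak derivatives are defined with real test functions, whereas the exponentials below are
complex; real and imaginary parts are treated separately. -/
lemma weak_deriv_fiber (ψ : TestSpace) {a : ℝ → ℂ} (ha : ContDiff ℝ ∞ a)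
    (has : HasCompactSupport a) : ∀ᵐ s ∂sphereMeasure,
      ∫ V, (ψ.1.1 (V, s) * deriv a V + ψ.1.2 (V, s) * a V) = 0 := by
  have hre : ContDiff ℝ ∞ fun V => (a V).re := Complex.reCLM.contDiff.comp ha
  have him : ContDiff ℝ ∞ fun V => (a V).im := Complex.imCLM.contDiff.comp ha
  have hres : HasCompactSupport fun V => (a V).re := has.comp_left (g := Complex.re) rfl
  have hims : HasCompactSupport fun V => (a V).im := has.comp_left (g := Complex.im) rfl
  filter_upwards [weak_deriv_fiber_real ψ hre hres, weak_deriv_fiber_real ψ him hims,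
    integrable_fiber_mul ψ.1.1, integrable_fiber_mul ψ.1.2] with s h1 h2 h3 h4
  have hda : ∀ V, HasDerivAt a (deriv a V) V := fun V =>
    ((ha.differentiable (by simp)) V).hasDerivAt
  have d1 : ∀ V, deriv (fun V => (a V).re) V = (deriv a V).re := fun V =>
    (Complex.reCLM.hasFDerivAt.comp_hasDerivAt V (hda V)).deriv
  have d2 : ∀ V, deriv (fun V => (a V).im) V = (deriv a V).im := fun V =>
    (Complex.imCLM.hasFDerivAt.comp_hasDerivAt V (hda V)).deriv
  have hi : ∀ b : ℝ → ℝ, ContDiff ℝ ∞ b → HasCompactSupport b →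
      Integrable fun V => ψ.1.1 (V, s) * ((deriv b V : ℝ) : ℂ) + ψ.1.2 (V, s) * (b V : ℂ) := by
    intro b hb hbs
    have hb' : Continuous (deriv b) := hb.continuous_deriv (by simp)
    have hbc := hb.continuous
    exact (h3 _ (by fun_prop) (hbs.deriv.comp_left (g := fun r : ℝ => (r : ℂ))
      Complex.ofReal_zero)).add (h4 _ (by fun_prop)
        (hbs.comp_left (g := fun r : ℝ => (r : ℂ)) Complex.ofReal_zero))
  have e : ∀ V, ψ.1.1 (V, s) * deriv a V + ψ.1.2 (V, s) * a V
      = (ψ.1.1 (V, s) * ((deriv (fun V => (a V).re) V : ℝ) : ℂ) + ψ.1.2 (V, s) * ((a V).re : ℂ))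
        + Complex.I * (ψ.1.1 (V, s) * ((deriv (fun V => (a V).im) V : ℝ) : ℂ)
          + ψ.1.2 (V, s) * ((a V).im : ℂ)) := by
    intro V
    rw [d1, d2]
    conv_lhs => rw [← Complex.re_add_im (deriv a V), ← Complex.re_add_im (a V)]
    ring
  simp only [e]
  rw [integral_add (hi _ hre hres) ((hi _ him hims).const_mul _), h1, integral_const_mul, h2]
  simp

end WeakDerivative

/-! ### The Fourier transform diagonalises `∂_V`. -/

section FourierDerivative

lemma exists_norm_le_of_hasCompactSupport {b : ℝ → ℂ} (hb : Continuous b)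
    (hbs : HasCompactSupport b) : ∃ C R : ℝ, (∀ x : Cone, ‖b x.1‖ ≤ C) ∧
      ∀ x : Cone, R < |x.1| → b x.1 = 0 := by
  obtain ⟨C, hC⟩ := hbs.exists_bound_of_continuous hb
  obtain ⟨R, hR⟩ := hbs.isCompact.isBounded.exists_norm_le
  refine ⟨C, R, fun x => hC _, fun x hx => ?_⟩
  by_contra h
  exact absurd (hR x.1 (subset_tsupport _ h)) (not_le.2 hx)

/-- Multiplication by a continuous compactly supported function of `V`. -/
def mulV (b : ℝ → ℂ) : L2Cone →L[ℂ] L2Cone := mulL2 fun x => b x.1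

lemma coeFn_mulV {b : ℝ → ℂ} (hb : Continuous b) (hbs : HasCompactSupport b) (u : L2Cone) :
    (mulV b u : Cone → ℂ) =ᵐ[coneMeasure] fun x => b x.1 * u x := by
  obtain ⟨C, R, hC, -⟩ := exists_norm_le_of_hasCompactSupport hb hbs
  exact coeFn_mulL2 (hb.measurable.comp measurable_fst) hC u

lemma mulV_mem_fiberIntegrable {b : ℝ → ℂ} (hb : Continuous b) (hbs : HasCompactSupport b)
    (u : L2Cone) : mulV b u ∈ fiberIntegrable := by
  obtain ⟨C, R, hC, hR⟩ := exists_norm_le_of_hasCompactSupport hb hbs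
  exact mulL2_mem_fiberIntegrable (hb.measurable.comp measurable_fst) hC hR u

lemma partialFourier_mulV {b : ℝ → ℂ} (hb : Continuous b) (hbs : HasCompactSupport b)
    (u : L2Cone) : ∀ᵐ s ∂sphereMeasure, ∀ k : ℝ, partialFourier (mulV b u) (k, s)
      = ∫ V : ℝ, u (V, s) * (Complex.exp (((-2 * Real.pi * V * k : ℝ) : ℂ) * Complex.I) * b V) := by
  filter_upwards [ae_fiber (coeFn_mulV hb hbs u)] with s hs k
  rw [partialFourier_eq]
  refine integral_congr_ae ?_
  filter_upwards [hs] with V hV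
  rw [hV]
  ring

/-- The cutoff `b` makes the transforms genuine integrals and `exp(-2πikV) b(V)` an admissible test
function, so this is the product rule for the weak derivative. -/
lemma vFourier_mulV_deriv (ψ : TestSpace) {b : ℝ → ℂ} (hb : ContDiff ℝ ∞ b)
    (hbs : HasCompactSupport b) :
    (fun x => vFourier (mulV (deriv b) ψ.1.1) x + vFourier (mulV b ψ.1.2) x)
      =ᵐ[coneMeasure] fun x => 2 * Real.pi * Complex.I * x.1 * vFourier (mulV b ψ.1.1) x := by
  have hb' : Continuous (deriv b) := hb.continuous_deriv (by simp)
  have hm := fun u => stronglyMeasurable_partialFourier (Lp.stronglyMeasurable (mulV b u))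
  have hm' := fun u => stronglyMeasurable_partialFourier (Lp.stronglyMeasurable (mulV (deriv b) u))
  -- The null set depends on the test function, hence on `k`; joint measurability afterwards gives
  -- the identity for almost every `(k, s)`.
  have key : ∀ k : ℝ, ∀ᵐ s ∂sphereMeasure,
      partialFourier (mulV (deriv b) ψ.1.1) (k, s) + partialFourier (mulV b ψ.1.2) (k, s)
        = 2 * Real.pi * Complex.I * k * partialFourier (mulV b ψ.1.1) (k, s) := by
    intro k
    let e : ℝ → ℂ := fun V => Complex.exp (((-2 * Real.pi * V * k : ℝ) : ℂ) * Complex.I)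
    have he : ContDiff ℝ ∞ e :=
      Complex.contDiff_exp.comp ((Complex.ofRealCLM.contDiff.comp
        ((contDiff_const.mul contDiff_id).mul contDiff_const)).mul contDiff_const)
    have hde : ∀ V, HasDerivAt e (-(2 * Real.pi * Complex.I * k) * e V) V := by
      intro V
      have h1 : HasDerivAt (fun V : ℝ => ((-2 * Real.pi * V * k : ℝ) : ℂ) * Complex.I)
          (((-2 * Real.pi * 1 * k : ℝ) : ℂ) * Complex.I) V :=
        ((((hasDerivAt_id V).const_mul (-2 * Real.pi)).mul_const k).ofReal_comp).mul_const _
      have h2 := h1.cexp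
      convert h2 using 1
      simp only [e]
      push_cast
      ring
    have hd : ∀ V, deriv (fun V => e V * b V) V
        = -(2 * Real.pi * Complex.I * k) * (e V * b V) + e V * deriv b V := by
      intro V
      have := ((hde V).mul ((hb.differentiable (by simp)) V).hasDerivAt).deriv
      refine Eq.trans this ?_
      ring
    filter_upwards [weak_deriv_fiber ψ (he.mul hb) hbs.mul_left,
      partialFourier_mulV hb' hbs.deriv ψ.1.1, partialFourier_mulV hb.continuous hbs ψ.1.2,
      partialFourier_mulV hb.continuous hbs ψ.1.1, integrable_fiber_mul ψ.1.1,
      integrable_fiber_mul ψ.1.2] with s h0 h1 h2 h3 h4 h5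
    have i1 := h4 (fun V => e V * deriv b V) (he.continuous.mul hb') hbs.deriv.mul_left
    have i2 := h5 (fun V => e V * b V) (he.continuous.mul hb.continuous) hbs.mul_left
    have i3 := h4 (fun V => e V * b V) (he.continuous.mul hb.continuous) hbs.mul_left
    have i12 : Integrable fun V => ψ.1.1 (V, s) * (e V * deriv b V)
        + ψ.1.2 (V, s) * (e V * b V) := i1.add i2
    rw [h1, h2, h3, ← integral_const_mul, ← integral_add i1 i2, ← sub_eq_zero]
    refine (integral_sub i12 (i3.const_mul (2 * Real.pi * Complex.I * k))).symm.trans ?_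
    rw [← h0]
    refine integral_congr_ae (ae_of_all _ fun V => ?_)
    simp only [hd]
    ring
  have key' : (fun x => partialFourier (mulV (deriv b) ψ.1.1) x + partialFourier (mulV b ψ.1.2) x)
      =ᵐ[coneMeasure]
        fun x => 2 * Real.pi * Complex.I * x.1 * partialFourier (mulV b ψ.1.1) x := by
    have hms : MeasurableSet {x : Cone |
        partialFourier (mulV (deriv b) ψ.1.1) x + partialFourier (mulV b ψ.1.2) x
          = 2 * Real.pi * Complex.I * x.1 * partialFourier (mulV b ψ.1.1) x} :=
      measurableSet_eq_fun ((hm' _).measurable.add (hm _).measurable)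
        ((by fun_prop : Measurable fun x : Cone => 2 * Real.pi * Complex.I * (x.1 : ℂ)).mul
          (hm _).measurable)
    exact (Measure.ae_prod_iff_ae_ae hms).2 (ae_of_all _ key)
  filter_upwards [key', coeFn_vFourier (mulV_mem_fiberIntegrable hb' hbs.deriv ψ.1.1),
    coeFn_vFourier (mulV_mem_fiberIntegrable hb.continuous hbs ψ.1.2),
    coeFn_vFourier (mulV_mem_fiberIntegrable hb.continuous hbs ψ.1.1)] with x h0 h1 h2 h3
  rw [h1, h2, h3, h0]

/-- The Fourier transform turns `∂_V` into multiplication. -/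
theorem vFourier_deriv (ψ : TestSpace) :
    (vFourier ψ.1.2 : Cone → ℂ) =ᵐ[coneMeasure]
      fun x => 2 * Real.pi * Complex.I * x.1 * vFourier ψ.1.1 x := by
  let f : ContDiffBump (0 : ℝ) := ⟨1, 2, one_pos, one_lt_two⟩
  -- A stretched bump tends to `1` boundedly while its derivative is `O(1/(n + 1))`; `n + 1` avoids
  -- division by zero.
  let b : ℕ → ℝ → ℂ := fun n V => (f (V / (n + 1)) : ℂ)
  have hfs : ContDiff ℝ ∞ f := f.contDiff
  have hb : ∀ n, ContDiff ℝ ∞ (b n) := fun n =>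
    Complex.ofRealCLM.contDiff.comp (hfs.comp (contDiff_id.div_const _))
  have hbs : ∀ n, HasCompactSupport (b n) := by
    intro n
    have h1 : HasCompactSupport fun V : ℝ => f (V / (n + 1)) := by
      have := f.hasCompactSupport.comp_homeomorph
        (Homeomorph.mulRight₀ ((n : ℝ) + 1)⁻¹ (by positivity))
      simpa [Function.comp_def, div_eq_mul_inv] using this
    exact h1.comp_left (g := fun r : ℝ => (r : ℂ)) Complex.ofReal_zero
  have hbm : ∀ n, Measurable fun x : Cone => b n x.1 := fun n =>
    (hb n).continuous.measurable.comp measurable_fst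
  have hb1 : ∀ n (x : Cone), ‖b n x.1‖ ≤ 1 := by
    intro n x
    rw [Complex.norm_real, Real.norm_of_nonneg f.nonneg]
    exact f.le_one
  obtain ⟨C, hC⟩ := f.hasCompactSupport.deriv.exists_bound_of_continuous
    (hfs.continuous_deriv (by simp))
  have hdb : ∀ n (x : Cone), ‖deriv (b n) x.1‖ ≤ C / (n + 1) := by
    intro n x
    have hn : (0 : ℝ) < n + 1 := by positivity
    have h1 : HasDerivAt (b n) ((deriv f (x.1 / (n + 1)) * (1 / (n + 1)) : ℝ) : ℂ) x.1 := by
      have h2 := ((hfs.differentiable (by simp)) (x.1 / (n + 1))).hasDerivAt.comp x.1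
        ((hasDerivAt_id x.1).div_const ((n : ℝ) + 1))
      exact h2.ofReal_comp
    rw [h1.deriv, Complex.norm_real, norm_mul, div_eq_mul_one_div C,
      Real.norm_of_nonneg (by positivity : (0 : ℝ) ≤ 1 / (n + 1))]
    exact mul_le_mul_of_nonneg_right (hC _) (by positivity)
  have hdbm : ∀ n, Measurable fun x : Cone => deriv (b n) x.1 := fun n =>
    ((hb n).continuous_deriv (by simp)).measurable.comp measurable_fst
  have hlim : ∀ u, Tendsto (fun n => mulV (b n) u) atTop (𝓝 u) := by
    refine fun u => tendsto_mulL2_one hbm hb1 (fun x => ?_) u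
    refine tendsto_const_nhds.congr' ?_
    filter_upwards [(tendsto_natCast_atTop_atTop (R := ℝ)).eventually_ge_atTop |x.1|] with n hn
    have hn' : (0 : ℝ) < n + 1 := by positivity
    have : f (x.1 / (n + 1)) = 1 := by
      refine f.one_of_mem_closedBall ?_
      rw [mem_closedBall_zero_iff, norm_div, Real.norm_eq_abs, Real.norm_of_nonneg hn'.le,
        div_le_one hn']
      linarith
    simp [b, this]
  have hlim' : Tendsto (fun n => mulV (deriv (b n)) ψ.1.1) atTop (𝓝 0) := by
    refine squeeze_zero_norm (fun n => norm_mulL2_le (hdbm n) (hdb n) ψ.1.1) ?_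
    have := (tendsto_const_div_atTop_nhds_zero_nat C).comp (tendsto_add_atTop_nat 1)
    simpa [Function.comp_def] using this.mul_const ‖ψ.1.1‖
  -- Multiplication by `k` is unbounded. Dividing the identity by `1 + |k|` leaves bounded
  -- multipliers, and the limit can be taken in `L²`.
  let p : Cone → ℂ := fun x => 2 * Real.pi * Complex.I * x.1 / (1 + |x.1| : ℝ)
  let q : Cone → ℂ := fun x => 1 / (1 + |x.1| : ℝ)
  have hpm : Measurable p := by fun_prop
  have hqm : Measurable q := by fun_prop
  have hp : ∀ x, ‖p x‖ ≤ 2 * Real.pi := by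
    intro x
    have h1 : (0 : ℝ) < 1 + |x.1| := by positivity
    simp only [p, norm_div, norm_mul, Complex.norm_real, Complex.norm_I, Complex.norm_ofNat,
      Real.norm_eq_abs, mul_one, abs_of_pos Real.pi_pos, abs_of_pos h1]
    rw [div_le_iff₀ h1]
    nlinarith [Real.pi_pos, abs_nonneg x.1]
  have hq : ∀ x, ‖q x‖ ≤ 1 := by
    intro x
    have h1 : (0 : ℝ) < 1 + |x.1| := by positivity
    simp only [q, norm_div, Complex.norm_real, Real.norm_eq_abs, abs_of_pos h1, norm_one]
    rw [div_le_one h1]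
    linarith [abs_nonneg x.1]
  have heq : ∀ n, mulL2 q (vFourier (mulV (deriv (b n)) ψ.1.1) + vFourier (mulV (b n) ψ.1.2))
      = mulL2 p (vFourier (mulV (b n) ψ.1.1)) := by
    intro n
    refine Lp.ext ?_
    filter_upwards [coeFn_mulL2 hqm hq
        (vFourier (mulV (deriv (b n)) ψ.1.1) + vFourier (mulV (b n) ψ.1.2)),
      coeFn_mulL2 hpm hp (vFourier (mulV (b n) ψ.1.1)),
      Lp.coeFn_add (vFourier (mulV (deriv (b n)) ψ.1.1)) (vFourier (mulV (b n) ψ.1.2)),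
      vFourier_mulV_deriv ψ (hb n) (hbs n)] with x h1 h2 h3 h4
    rw [h1, h2, h3, Pi.add_apply, h4]
    simp only [p, q]
    ring
  have l1 : Tendsto (fun n => mulL2 q (vFourier (mulV (deriv (b n)) ψ.1.1)
      + vFourier (mulV (b n) ψ.1.2))) atTop (𝓝 (mulL2 q (vFourier 0 + vFourier ψ.1.2))) :=
    ((mulL2 q).continuous.tendsto _).comp (((vFourier.continuous.tendsto _).comp hlim').add
      ((vFourier.continuous.tendsto _).comp (hlim _)))
  have l2 : Tendsto (fun n => mulL2 p (vFourier (mulV (b n) ψ.1.1))) atTop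
      (𝓝 (mulL2 p (vFourier ψ.1.1))) :=
    ((mulL2 p).continuous.tendsto _).comp ((vFourier.continuous.tendsto _).comp (hlim _))
  have l3 := tendsto_nhds_unique (l1.congr heq) l2
  rw [map_zero, zero_add] at l3
  have e1 := coeFn_mulL2 hqm hq (vFourier ψ.1.2)
  rw [l3] at e1
  filter_upwards [e1, coeFn_mulL2 hpm hp (vFourier ψ.1.1)] with x h1 h2
  rw [h2] at h1
  have h3 : ((1 + |x.1| : ℝ) : ℂ) ≠ 0 := by
    exact_mod_cast (by positivity : (0 : ℝ) < 1 + |x.1|).ne'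
  simp only [p, q] at h1
  field_simp at h1
  exact h1.symm

end FourierDerivative

/-! ### Classical derivatives and the Fourier characterisation of test functions. -/

section ClassicalDerivative

/-- A function that is continuous in `V` and differentiable off `V = 0` has its pointwise derivative
as weak derivative. -/
lemma isWeakVDeriv_of_hasDerivAt {f f' : Cone → ℂ} (hf : MemLp f 2 coneMeasure)
    (hf' : MemLp f' 2 coneMeasure) (hc : ∀ s, Continuous fun V => f (V, s))
    (hd : ∀ s V, V ≠ 0 → HasDerivAt (fun V => f (V, s)) (f' (V, s)) V) :
    IsWeakVDeriv (hf.toLp f) (hf'.toLp f') := by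
  intro χ hχ hχs
  have h3 := integrable_mul_test (hf.toLp f) (continuous_fderiv_test hχ)
    (hasCompactSupport_fderiv_test hχs)
  have h4 := integrable_mul_test (hf'.toLp f') hχ.continuous hχs
  have h34 : Integrable (fun x : Cone => f x * ((fderiv ℝ χ (incl x) (1, 0) : ℝ) : ℂ)
      + f' x * ((χ (incl x) : ℝ) : ℂ)) coneMeasure := by
    refine (h3.add h4).congr ?_
    filter_upwards [hf.coeFn_toLp, hf'.coeFn_toLp] with x h1 h2
    rw [Pi.add_apply, h1, h2]
  rw [← add_eq_zero_iff_eq_neg, ← integral_add h3 h4]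
  have e : ∫ x, ((hf.toLp f) x * ((fderiv ℝ χ (incl x) (1, 0) : ℝ) : ℂ)
      + (hf'.toLp f') x * ((χ (incl x) : ℝ) : ℂ)) ∂coneMeasure
      = ∫ x, (f x * ((fderiv ℝ χ (incl x) (1, 0) : ℝ) : ℂ)
      + f' x * ((χ (incl x) : ℝ) : ℂ)) ∂coneMeasure := by
    refine integral_congr_ae ?_
    filter_upwards [hf.coeFn_toLp, hf'.coeFn_toLp] with x h1 h2
    rw [h1, h2]
  rw [e]
  refine (integral_prod_symm _ h34).trans (integral_eq_zero_of_ae ?_)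
  obtain ⟨R, hR⟩ := hχs.isCompact.isBounded.exists_norm_le
  have hout : ∀ (V : ℝ) (x : E3), R < |V| → (V, x) ∉ tsupport χ := by
    intro V x hV h
    exact absurd ((norm_fst_le (V, x)).trans (hR _ h)) (not_le.2 hV)
  have h0 : ∀ (V : ℝ) (x : E3), R < |V| → χ (V, x) = 0 := fun V x hV =>
    image_eq_zero_of_notMem_tsupport (hout V x hV)
  have h0' : ∀ (V : ℝ) (x : E3), R < |V| → fderiv ℝ χ (V, x) (1, 0) = 0 := by
    intro V x hV
    have : fderiv ℝ χ (V, x) = 0 := by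
      by_contra hne
      exact hout V x hV (support_fderiv_subset ℝ hne)
    rw [this]
    rfl
  filter_upwards [h34.prod_left_ae] with s hs
  let P : ℝ → ℂ := fun V => f (V, s) * (χ (V, (s : E3)) : ℂ)
  have hχd : ∀ V, HasDerivAt (fun V : ℝ => χ (V, (s : E3)))
      (fderiv ℝ χ (V, (s : E3)) (1, 0)) V := by
    intro V
    have h1 : HasDerivAt (fun V : ℝ => (V, (s : E3))) ((1 : ℝ), (0 : E3)) V :=
      (hasDerivAt_id V).prodMk (hasDerivAt_const V (s : E3))
    exact ((hχ.differentiable (by simp)) (V, (s : E3))).hasFDerivAt.comp_hasDerivAt V h1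
  have hPc : Continuous P := by
    refine (hc s).mul (Complex.continuous_ofReal.comp (hχ.continuous.comp ?_))
    fun_prop
  have hI : IntervalIntegrable (fun V => f (V, s) * ((fderiv ℝ χ (incl (V, s)) (1, 0) : ℝ) : ℂ)
      + f' (V, s) * ((χ (incl (V, s)) : ℝ) : ℂ)) volume (-(|R| + 1)) (|R| + 1) :=
    hs.intervalIntegrable
  -- Continuity across `V = 0` lets the fundamental theorem of calculus ignore that point; the
  -- endpoints lie outside the support of `χ`, so the boundary terms vanish.
  have hFTC := integral_eq_of_hasDerivAt_off_countable P _ (a := -(|R| + 1)) (b := |R| + 1)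
    (countable_singleton 0) hPc.continuousOn (fun V hV => by
      have := (hd s V hV.2).mul (hχd V).ofReal_comp
      rw [add_comm] at this
      exact this) hI
  have hlt : R < |R| + 1 := (le_abs_self R).trans_lt (lt_add_one _)
  have hpos : (0 : ℝ) ≤ |R| + 1 := by positivity
  have hz1 : P (|R| + 1) = 0 := by
    simp only [P]
    rw [h0 _ _ (by rwa [abs_of_nonneg hpos])]
    simp
  have hz2 : P (-(|R| + 1)) = 0 := by
    simp only [P]
    rw [h0 _ _ (by rwa [abs_neg, abs_of_nonneg hpos])]
    simp
  rw [hz1, hz2, sub_zero] at hFTC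
  rw [Pi.zero_apply, ← hFTC]
  refine (intervalIntegral.integral_eq_integral_of_support_subset fun V hV => ?_).symm
  by_contra hV'
  have hRV : R < |V| := by
    by_contra hle
    have := abs_le.1 (not_lt.1 hle)
    exact hV' ⟨by linarith, by linarith⟩
  refine hV ?_
  simp only [incl]
  rw [h0 _ _ hRV, h0' _ _ hRV]
  simp

lemma memLp_test {g : ℝ × E3 → ℝ} (hg : Continuous g) (hs : HasCompactSupport g) :
    MemLp (fun x : Cone => ((g (incl x) : ℝ) : ℂ)) 2 coneMeasure := by
  have hc : Continuous fun x : Cone => ((g (incl x) : ℝ) : ℂ) :=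
    Complex.continuous_ofReal.comp (hg.comp isClosedEmbedding_incl.continuous)
  exact hc.memLp_of_hasCompactSupport
    ((hs.comp_isClosedEmbedding isClosedEmbedding_incl).comp_left (g := fun r : ℝ => (r : ℂ))
      Complex.ofReal_zero)

/-- Characterization of the test functions by the Fourier transform. -/
theorem mem_testSpace_iff {u d : L2Cone} : (u, d) ∈ TestSpace ↔
    (vFourier d : Cone → ℂ) =ᵐ[coneMeasure]
      fun x => 2 * Real.pi * Complex.I * x.1 * vFourier u x := by
  refine ⟨fun h => vFourier_deriv ⟨(u, d), h⟩, fun h => ?_⟩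
  intro χ hχ hχs
  have m1 := memLp_test hχ.continuous hχs
  have m2 := memLp_test (continuous_fderiv_test hχ) (hasCompactSupport_fderiv_test hχs)
  -- The test function itself obeys `vFourier_deriv`. Parseval then transfers the weak identity to
  -- Fourier space, where `k ↦ -k` supplies its minus sign.
  have hmem : (m1.toLp _, m2.toLp _) ∈ TestSpace := by
    refine isWeakVDeriv_of_hasDerivAt m1 m2 (fun s => ?_) (fun s V _ => ?_)
    · refine Complex.continuous_ofReal.comp (hχ.continuous.comp ?_)
      simp only [incl]
      fun_prop
    · have h1 : HasDerivAt (fun V : ℝ => (V, (s : E3))) ((1 : ℝ), (0 : E3)) V :=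
        (hasDerivAt_id V).prodMk (hasDerivAt_const V (s : E3))
      exact (((hχ.differentiable (by simp)) (V, (s : E3))).hasFDerivAt.comp_hasDerivAt
        V h1).ofReal_comp
  have hF := vFourier_deriv ⟨_, hmem⟩
  have e1 : ∫ x, u x * ((fderiv ℝ χ (incl x) (1, 0) : ℝ) : ℂ) ∂coneMeasure
      = pairing u (m2.toLp _) := by
    rw [pairing_apply]
    refine integral_congr_ae ?_
    filter_upwards [m2.coeFn_toLp] with x hx
    rw [hx]
  have e2 : ∫ x, d x * ((χ (incl x) : ℝ) : ℂ) ∂coneMeasure = pairing d (m1.toLp _) := by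
    rw [pairing_apply]
    refine integral_congr_ae ?_
    filter_upwards [m1.coeFn_toLp] with x hx
    rw [hx]
  rw [e1, e2, ← pairing_vFourier, ← pairing_vFourier d, pairing_apply, pairing_apply,
    ← integral_neg]
  refine integral_congr_ae ?_
  have h' := measurePreserving_reflect.quasiMeasurePreserving.ae_eq_comp h
  filter_upwards [hF, h', coeFn_reflectL2 (vFourier u), coeFn_reflectL2 (vFourier d)]
    with x h1 h2 h3 h4
  have h5 : vFourier d (-x.1, x.2) = 2 * Real.pi * Complex.I * (-x.1 : ℝ)
      * vFourier u (-x.1, x.2) := h2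
  change _ * vFourier (m2.toLp _) x = -(_ * _)
  rw [h1, h3, h4, h5]
  push_cast
  ring

end ClassicalDerivative

/-! ### The two-point function in Fourier space. -/

section TwoPointForm

/-- The indicator function of the positive frequencies. -/
def posFreq (x : Cone) : ℂ := if 0 < x.1 then 1 else 0

lemma measurable_posFreq : Measurable posFreq :=
  Measurable.ite (measurableSet_lt measurable_const measurable_fst) measurable_const
    measurable_const

lemma norm_posFreq_le (x : Cone) : ‖posFreq x‖ ≤ 1 := by
  unfold posFreq
  split_ifs <;> simp

lemma coeFn_posFreq (u : L2Cone) :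
    (mulL2 posFreq u : Cone → ℂ) =ᵐ[coneMeasure] fun x => posFreq x * u x :=
  coeFn_mulL2 measurable_posFreq norm_posFreq_le u

/-- The two-point function in Fourier space. -/
def twoPointForm : TestSpace →ₗ[ℂ] TestSpace →ₗ[ℂ] ℂ :=
  (-(2 * Complex.I)) • pairing.compl₁₂
    ((mulL2 posFreq).toLinearMap ∘ₗ vFourier.toLinearMap ∘ₗ dVₗ)
    (reflectL2.toLinearMap ∘ₗ vFourier.toLinearMap ∘ₗ toL2ₗ)

lemma twoPointForm_eq (ψ χ : TestSpace) : twoPointForm ψ χ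
    = -(2 * Complex.I) * pairing (mulL2 posFreq (vFourier ψ.1.2)) (reflectL2 (vFourier χ.1.1)) :=
  rfl

/-- The constant is `-2i · 2πik = 4πk`. -/
lemma twoPointForm_eq_integral (ψ χ : TestSpace) : twoPointForm ψ χ
    = ∫ x, 4 * Real.pi * (posFreq x * x.1 * vFourier ψ.1.1 x * vFourier χ.1.1 (-x.1, x.2))
      ∂coneMeasure := by
  rw [twoPointForm_eq, pairing_apply, ← integral_const_mul]
  refine integral_congr_ae ?_
  filter_upwards [coeFn_posFreq (vFourier ψ.1.2), coeFn_reflectL2 (vFourier χ.1.1),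
    vFourier_deriv ψ] with x h1 h2 h3
  rw [h1, h2, h3]
  linear_combination (-4 * Real.pi * (posFreq x * x.1 * vFourier ψ.1.1 x
    * vFourier χ.1.1 (-x.1, x.2))) * Complex.I_mul_I

/-- The factor `k` is absorbed into the transform of `∂_V ψ`, leaving a product of two square
integrable functions. -/
lemma integrable_twoPointForm (ψ χ : TestSpace) :
    Integrable (fun x => 4 * Real.pi * (posFreq x * x.1 * vFourier ψ.1.1 x
      * vFourier χ.1.1 (-x.1, x.2))) coneMeasure := by
  refine ((integrable_mul_L2 (mulL2 posFreq (vFourier ψ.1.2))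
    (reflectL2 (vFourier χ.1.1))).const_mul (-(2 * Complex.I))).congr ?_
  filter_upwards [coeFn_posFreq (vFourier ψ.1.2), coeFn_reflectL2 (vFourier χ.1.1),
    vFourier_deriv ψ] with x h1 h2 h3
  rw [h1, h2, h3]
  linear_combination (-4 * Real.pi * (posFreq x * x.1 * vFourier ψ.1.1 x
    * vFourier χ.1.1 (-x.1, x.2))) * Complex.I_mul_I

lemma integral_reflect (f : Cone → ℂ) :
    ∫ x, f (-x.1, x.2) ∂coneMeasure = ∫ x, f x ∂coneMeasure := by
  have he : MeasurableEmbedding reflect :=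
    ((Homeomorph.neg ℝ).prodCongr (Homeomorph.refl S2)).measurableEmbedding
  exact measurePreserving_reflect.integral_comp he f

lemma ae_fst_ne_zero : ∀ᵐ x ∂coneMeasure, x.1 ≠ 0 := by
  have h : MeasurableSet {x : Cone | x.1 ≠ 0} :=
    (measurableSet_singleton (0 : ℝ)).compl.preimage measurable_fst
  refine (Measure.ae_prod_iff_ae_ae h).2 ?_
  filter_upwards [Measure.ae_ne volume (0 : ℝ)] with V hV
  exact ae_of_all _ fun s => hV

lemma sympl_apply (ψ χ : TestSpace) :
    sympl ψ χ = pairing ψ.1.1 χ.1.2 - pairing ψ.1.2 χ.1.1 := rfl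

lemma pairing_deriv_eq (ψ χ : TestSpace) : pairing ψ.1.2 χ.1.1
    = ∫ x, 2 * Real.pi * Complex.I * x.1 * vFourier ψ.1.1 x * vFourier χ.1.1 (-x.1, x.2)
      ∂coneMeasure := by
  rw [← pairing_vFourier, ← pairing_reflectL2, reflectL2_reflectL2, pairing_apply]
  refine integral_congr_ae ?_
  filter_upwards [coeFn_reflectL2 (vFourier χ.1.1), vFourier_deriv ψ] with x h2 h3
  rw [h2, h3]

lemma integrable_pairing_deriv (ψ χ : TestSpace) :
    Integrable (fun x => 2 * Real.pi * Complex.I * x.1 * vFourier ψ.1.1 x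
      * vFourier χ.1.1 (-x.1, x.2)) coneMeasure := by
  refine (integrable_mul_L2 (vFourier ψ.1.2) (reflectL2 (vFourier χ.1.1))).congr ?_
  filter_upwards [coeFn_reflectL2 (vFourier χ.1.1), vFourier_deriv ψ] with x h2 h3
  rw [h2, h3]

/-- Integration by parts, which in Fourier space is the oddness of `k` under reflection. -/
lemma pairing_deriv_antisymm (ψ χ : TestSpace) :
    pairing ψ.1.1 χ.1.2 = - pairing ψ.1.2 χ.1.1 := by
  have h : pairing ψ.1.1 χ.1.2 = pairing χ.1.2 ψ.1.1 := by
    rw [pairing_apply, pairing_apply]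
    simp only [mul_comm]
  rw [h, pairing_deriv_eq, pairing_deriv_eq, ← integral_reflect, ← integral_neg]
  refine integral_congr_ae (ae_of_all _ fun x => ?_)
  simp only [neg_neg]
  push_cast
  ring

/-- Exchanging the arguments and reflecting `k` gives minus the same integrand on the negative half
line. The difference is the integral over all `k`, which is `iσ` because `σ(ψ, χ) = -2 ∫ ∂_Vψ χ`. -/
lemma twoPointForm_comm (ψ χ : TestSpace) :
    twoPointForm ψ χ - twoPointForm χ ψ = Complex.I * sympl ψ χ := by
  have h1 : twoPointForm χ ψ = ∫ x, 4 * Real.pi * (posFreq (-x.1, x.2) * (-x.1 : ℝ)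
      * vFourier χ.1.1 (-x.1, x.2) * vFourier ψ.1.1 x) ∂coneMeasure := by
    rw [twoPointForm_eq_integral, ← integral_reflect]
    simp only [neg_neg]
  have i1 : Integrable (fun x => 4 * Real.pi * (posFreq (-x.1, x.2) * (-x.1 : ℝ)
      * vFourier χ.1.1 (-x.1, x.2) * vFourier ψ.1.1 x)) coneMeasure := by
    have := measurePreserving_reflect.integrable_comp_of_integrable (integrable_twoPointForm χ ψ)
    simpa [Function.comp_def, reflect] using this
  rw [h1, twoPointForm_eq_integral, ← integral_sub (integrable_twoPointForm ψ χ) i1, sympl_apply,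
    pairing_deriv_antisymm, pairing_deriv_eq, ← integral_neg, ← integral_sub, ← integral_const_mul]
  · refine integral_congr_ae ?_
    filter_upwards [ae_fst_ne_zero] with x hx
    have hp : posFreq x + posFreq (-x.1, x.2) = 1 := by
      simp only [posFreq]
      rcases lt_or_gt_of_ne hx with h | h
      · simp [h, h.le]
      · simp [h, h.le]
    push_cast
    linear_combination (4 * Real.pi * x.1 * vFourier ψ.1.1 x * vFourier χ.1.1 (-x.1, x.2)) * hp
      + (4 * Real.pi * x.1 * vFourier ψ.1.1 x * vFourier χ.1.1 (-x.1, x.2)) * Complex.I_mul_I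
  · exact (integrable_pairing_deriv ψ χ).neg
  · exact integrable_pairing_deriv ψ χ

lemma vFourier_star_apply (u : L2Cone) : (vFourier (star u) : Cone → ℂ) =ᵐ[coneMeasure]
    fun x => (starRingEnd ℂ) (vFourier u (-x.1, x.2)) := by
  rw [vFourier_star]
  filter_upwards [Lp.coeFn_star (reflectL2 (vFourier u)), coeFn_reflectL2 (vFourier u)]
    with x h1 h2
  rw [h1, Pi.star_apply, h2]
  rfl

/-- Conjugating `ψ` replaces `ψ̂(k)` by the conjugate of `ψ̂(-k)`. This gives hermiticity and turns
the diagonal integrand into `4πk |ψ̂(-k, s)|²` on `k > 0`. -/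
theorem isTwoPointForm_twoPointForm : IsTwoPointForm sympl conjTest twoPointForm where
  invol ψ := Subtype.ext (Prod.ext (star_star ψ.1.1) (star_star ψ.1.2))
  comm := twoPointForm_comm
  herm ψ χ := by
    rw [twoPointForm_eq_integral, twoPointForm_eq_integral, ← integral_conj]
    refine integral_congr_ae ?_
    have h' := measurePreserving_reflect.quasiMeasurePreserving.ae_eq_comp
      (vFourier_star_apply ψ.1.1)
    filter_upwards [vFourier_star_apply χ.1.1, h'] with x h1 h2
    have h3 : vFourier (star ψ.1.1) (-x.1, x.2) = (starRingEnd ℂ) (vFourier ψ.1.1 x) := by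
      simpa [reflect] using h2
    have h4 : (starRingEnd ℂ) (posFreq x) = posFreq x := by
      unfold posFreq
      split_ifs <;> simp
    change _ = 4 * Real.pi * (posFreq x * x.1 * vFourier (star χ.1.1) x
      * vFourier (star ψ.1.1) (-x.1, x.2))
    rw [h1, h3]
    simp only [map_mul, h4, Complex.conj_ofReal, Complex.conj_ofNat]
    ring
  pos ψ := by
    rw [twoPointForm_eq_integral]
    have hre := integral_re (integrable_twoPointForm (conjTest ψ) ψ)
    refine le_of_le_of_eq (integral_nonneg_of_ae ?_) hre
    filter_upwards [vFourier_star_apply ψ.1.1] with x h1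
    change 0 ≤ Complex.re (4 * Real.pi * (posFreq x * x.1 * vFourier (star ψ.1.1) x
      * vFourier ψ.1.1 (-x.1, x.2)))
    rw [h1, mul_assoc (posFreq x * x.1), mul_comm ((starRingEnd ℂ) _), Complex.mul_conj]
    unfold posFreq
    split_ifs with h
    · have : (4 * Real.pi * (1 * x.1 * (Complex.normSq (vFourier ψ.1.1 (-x.1, x.2)) : ℂ)) : ℂ)
          = ((4 * Real.pi * (x.1 * Complex.normSq (vFourier ψ.1.1 (-x.1, x.2))) : ℝ) : ℂ) := by
        push_cast
        ring
      rw [this, Complex.ofReal_re]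
      have := Complex.normSq_nonneg (vFourier ψ.1.1 (-x.1, x.2))
      positivity
    · simp

end TwoPointForm

/-! ### The limit `ε → 0⁺` of the regularised two-point function. -/

section TwoPointLimit

lemma integral_Ioi_mul_exp_neg_mul {z : ℂ} (hz : 0 < z.re) :
    IntegrableOn (fun k : ℝ => (k : ℂ) * Complex.exp (-(k * z))) (Ioi 0) ∧
      ∫ k in Ioi (0 : ℝ), (k : ℂ) * Complex.exp (-(k * z)) = 1 / z ^ 2 := by
  have hz0 : z ≠ 0 := by
    rintro rfl
    simp at hz
  have hn : ∀ k : ℝ, ‖Complex.exp (-(k * z))‖ = Real.exp (-(z.re * k)) := by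
    intro k
    rw [Complex.norm_exp]
    simp [mul_comm]
  have hi : IntegrableOn (fun k : ℝ => (k : ℂ) * Complex.exp (-(k * z))) (Ioi 0) := by
    have h := integrableOn_rpow_mul_exp_neg_mul_rpow (p := 1) (s := 1) (b := z.re) (by norm_num)
      one_pos hz
    refine Integrable.mono' h (by fun_prop) ?_
    refine (ae_restrict_iff' measurableSet_Ioi).2 (ae_of_all _ fun k hk => ?_)
    rw [norm_mul, hn, Complex.norm_real, Real.norm_of_nonneg (le_of_lt hk), Real.rpow_one]
    simp
  refine ⟨hi, ?_⟩
  -- An explicit antiderivative of `k exp(-kz)`; it vanishes at infinity and equals `-1/z²` at zero.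
  have hd : ∀ k : ℝ, HasDerivAt (fun k : ℝ => -((k : ℂ) / z + 1 / z ^ 2) * Complex.exp (-(k * z)))
      ((k : ℂ) * Complex.exp (-(k * z))) k := by
    intro k
    have h1 : HasDerivAt (fun k : ℝ => (k : ℂ)) 1 k := Complex.ofRealCLM.hasDerivAt
    have h2 := (((h1.div_const z).add_const (1 / z ^ 2)).neg).mul ((h1.mul_const z).neg.cexp)
    refine h2.congr_deriv ?_
    simp only [Pi.neg_apply]
    field_simp
    ring
  have ht : Tendsto (fun k : ℝ => -((k : ℂ) / z + 1 / z ^ 2) * Complex.exp (-(k * z))) atTop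
      (𝓝 0) := by
    rw [tendsto_zero_iff_norm_tendsto_zero]
    have h1 : Tendsto (fun k : ℝ => k * Real.exp (-(z.re * k))) atTop (𝓝 0) := by
      have := Real.tendsto_pow_mul_exp_neg_atTop_nhds_zero 1
      have h2 := (this.comp (tendsto_id.const_mul_atTop hz)).const_mul (z.re)⁻¹
      simp only [mul_zero] at h2
      refine h2.congr fun k => ?_
      simp only [Function.comp, pow_one, id]
      field_simp
    have h3 : Tendsto (fun k : ℝ => Real.exp (-(z.re * k))) atTop (𝓝 0) :=
      Real.tendsto_exp_neg_atTop_nhds_zero.comp (tendsto_id.const_mul_atTop hz)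
    have h4 := (h1.const_mul ‖z‖⁻¹).add (h3.const_mul ‖1 / z ^ 2‖)
    simp only [mul_zero, add_zero] at h4
    refine squeeze_zero' (Eventually.of_forall fun _ => norm_nonneg _) ?_ h4
    filter_upwards [eventually_ge_atTop 0] with k hk
    rw [norm_mul, hn, norm_neg]
    have h5 : ‖(k : ℂ) / z + 1 / z ^ 2‖ ≤ k * ‖z‖⁻¹ + ‖1 / z ^ 2‖ := by
      refine (norm_add_le _ _).trans (le_of_eq ?_)
      rw [norm_div, Complex.norm_real, Real.norm_of_nonneg hk, div_eq_mul_inv]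
    refine (mul_le_mul_of_nonneg_right h5 (Real.exp_pos _).le).trans (le_of_eq ?_)
    ring
  rw [integral_Ioi_of_hasDerivAt_of_tendsto' (fun k _ => hd k) hi ht]
  simp

/-- The function whose partial Fourier transform is the kernel of the regularised two-point
function. -/
def regFreq (ε k : ℝ) : ℂ := if 0 < k then 4 * Real.pi * k * Real.exp (-(2 * Real.pi * k * ε)) else 0

lemma measurable_regFreq (ε : ℝ) : Measurable (regFreq ε) := by
  refine Measurable.ite (measurableSet_lt measurable_const measurable_id) ?_ measurable_const
  fun_prop

lemma regFreq_eq_indicator (ε k x : ℝ) :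
    regFreq ε k * Complex.exp (((-2 * Real.pi * x * k : ℝ) : ℂ) * Complex.I)
      = (Ioi (0 : ℝ)).indicator (fun k : ℝ => 4 * Real.pi * ((k : ℂ)
        * Complex.exp (-(k * (2 * Real.pi * (ε + x * Complex.I)))))) k := by
  unfold regFreq
  by_cases hk : 0 < k
  · rw [indicator_of_mem (show k ∈ Ioi (0 : ℝ) from hk), if_pos hk, Complex.ofReal_exp, mul_assoc,
      ← Complex.exp_add, mul_assoc (4 * Real.pi : ℂ)]
    congr 3
    push_cast
    ring
  · rw [indicator_of_notMem (show k ∉ Ioi (0 : ℝ) from hk), if_neg hk, zero_mul]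

lemma integrable_regFreq {ε : ℝ} (hε : 0 < ε) : Integrable (regFreq ε) := by
  have h := (integral_Ioi_mul_exp_neg_mul (z := 2 * Real.pi * (ε + (0 : ℝ) * Complex.I)) (by
    simp; positivity)).1
  have h2 := (integrable_indicator_iff measurableSet_Ioi).2 (h.const_mul (4 * Real.pi : ℂ))
  refine h2.congr (ae_of_all _ fun k => ?_)
  have := regFreq_eq_indicator ε k 0
  simp only [mul_zero, zero_mul, Complex.ofReal_zero, Complex.exp_zero, mul_one] at this
  simp only [Complex.ofReal_zero, zero_mul]
  exact this.symm

/-- With `z = 2π(ε + ix) = 2πi(x - iε)`, the value `4π/z²` is `-1/(π (x - iε)²)`. -/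
lemma integral_regFreq {ε : ℝ} (hε : 0 < ε) (x : ℝ) :
    ∫ k, regFreq ε k * Complex.exp (((-2 * Real.pi * x * k : ℝ) : ℂ) * Complex.I)
      = -(1 / (Real.pi : ℂ)) * (1 / ((x : ℂ) - Complex.I * ε) ^ 2) := by
  have h := (integral_Ioi_mul_exp_neg_mul (z := 2 * Real.pi * (ε + x * Complex.I)) (by
    simp; positivity)).2
  simp only [regFreq_eq_indicator]
  rw [integral_indicator measurableSet_Ioi, integral_const_mul, h]
  have h0 : (x : ℂ) - Complex.I * ε ≠ 0 := by
    intro h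
    have := congrArg Complex.im h
    simp at this
    exact hε.ne' this
  have hpi : (Real.pi : ℂ) ≠ 0 := Complex.ofReal_ne_zero.2 Real.pi_ne_zero
  have h1 : (ε + x * Complex.I) = Complex.I * ((x : ℂ) - Complex.I * ε) := by
    linear_combination (ε : ℂ) * Complex.I_mul_I
  rw [h1]
  have h2 : (2 * Real.pi * (Complex.I * ((x : ℂ) - Complex.I * ε))) ^ 2
      = -(4 * Real.pi ^ 2 * ((x : ℂ) - Complex.I * ε) ^ 2) := by
    rw [mul_pow, mul_pow Complex.I, Complex.I_sq]
    ring
  rw [h2]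
  field_simp

/-- From `y ≤ exp y` at `y = 2πkε`. For fixed `ε` the multiplier is bounded on `L²`, but the bound
blows up as `ε → 0`. -/
lemma norm_regFreq_le (ε k : ℝ) (hε : 0 < ε) : ‖regFreq ε k‖ ≤ 2 / ε := by
  unfold regFreq
  split_ifs with hk
  · have h : (4 * Real.pi * k * Real.exp (-(2 * Real.pi * k * ε)) : ℂ)
        = ((4 * Real.pi * k * Real.exp (-(2 * Real.pi * k * ε)) : ℝ) : ℂ) := by push_cast; ring
    rw [h, Complex.norm_real, Real.norm_of_nonneg (by positivity)]
    have h1 := Real.add_one_le_exp (2 * Real.pi * k * ε)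
    rw [Real.exp_neg, ← div_eq_mul_inv, div_le_div_iff₀ (Real.exp_pos _) hε]
    nlinarith
  · rw [norm_zero]
    positivity

lemma norm_sub_I_mul_sq (ε x : ℝ) : ‖((x : ℂ) - Complex.I * ε) ^ 2‖ = x ^ 2 + ε ^ 2 := by
  rw [norm_pow, ← Complex.normSq_eq_norm_sq, Complex.normSq_apply]
  simp
  ring

lemma measurePreserving_exchange : MeasurePreserving
    (fun y : ℝ × ℝ × S2 => (y.2.1, y.1, y.2.2)) twoPointMeasure twoPointMeasure := by
  have h1 := (measurePreserving_prodAssoc (volume : Measure ℝ) (volume : Measure ℝ) sphereMeasure)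
  have h2 := (Measure.measurePreserving_swap (μ := (volume : Measure ℝ)) (ν := (volume : Measure ℝ))).prod
    (MeasurePreserving.id sphereMeasure)
  exact h1.comp (h2.comp h1.symm)

/-- For fixed `(V', s)` this is a translation of `V`; it turns a kernel in `V - V'` into a function
of one factor of a product. -/
lemma measurePreserving_shear : MeasurePreserving
    (fun y : ℝ × ℝ × S2 => (y.1 - y.2.1, y.2)) twoPointMeasure twoPointMeasure := by
  have h1 : MeasurePreserving (fun y : Cone × ℝ => (y.1, y.2 - y.1.1))
      (coneMeasure.prod volume) (coneMeasure.prod volume) := by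
    refine (MeasurePreserving.id coneMeasure).skew_product (g := fun x V => V - x.1) (by fun_prop)
      (ae_of_all _ fun x => ?_)
    exact (measurePreserving_sub_right volume x.1).map_eq
  exact Measure.measurePreserving_swap.comp (h1.comp Measure.measurePreserving_swap)

lemma quasiMeasurePreserving_left : Measure.QuasiMeasurePreserving
    (fun y : ℝ × ℝ × S2 => (y.1, y.2.2)) twoPointMeasure coneMeasure :=
  Measure.quasiMeasurePreserving_snd.comp measurePreserving_exchange.quasiMeasurePreserving

lemma quasiMeasurePreserving_right : Measure.QuasiMeasurePreserving
    (fun y : ℝ × ℝ × S2 => y.2) twoPointMeasure coneMeasure :=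
  Measure.quasiMeasurePreserving_snd

/-- The kernel of the regularised two-point function on `L²`. -/
def regIntegrand (ε : ℝ) (u v : Cone → ℂ) (y : ℝ × ℝ × S2) : ℂ :=
  u (y.1, y.2.2) * v (y.2.1, y.2.2) / ((y.1 : ℂ) - (y.2.1 : ℂ) - Complex.I * (ε : ℂ)) ^ 2

lemma norm_regIntegrand (ε : ℝ) (u v : Cone → ℂ) (y : ℝ × ℝ × S2) : ‖regIntegrand ε u v y‖
    = ‖u (y.1, y.2.2)‖ * ‖v (y.2.1, y.2.2)‖ * ((y.1 - y.2.1) ^ 2 + ε ^ 2)⁻¹ := by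
  unfold regIntegrand
  rw [← Complex.ofReal_sub, norm_div, norm_sub_I_mul_sq, norm_mul, div_eq_mul_inv]

lemma stronglyMeasurable_regIntegrand (ε : ℝ) {u v : Cone → ℂ} (hu : StronglyMeasurable u)
    (hv : StronglyMeasurable v) : StronglyMeasurable (regIntegrand ε u v) := by
  have h1 : Measurable fun y : ℝ × ℝ × S2 => u (y.1, y.2.2) := hu.measurable.comp (by fun_prop)
  have h2 : Measurable fun y : ℝ × ℝ × S2 => v (y.2.1, y.2.2) := hv.measurable.comp (by fun_prop)
  have h3 : Measurable fun y : ℝ × ℝ × S2 =>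
    ((y.1 : ℂ) - (y.2.1 : ℂ) - Complex.I * (ε : ℂ)) ^ 2 := by fun_prop
  exact ((h1.mul h2).div h3).stronglyMeasurable

lemma integrable_inv_sq_add_sq {ε : ℝ} (hε : 0 < ε) :
    Integrable fun x : ℝ => (x ^ 2 + ε ^ 2)⁻¹ := by
  have h := (integrable_inv_one_add_sq.comp_div hε.ne').const_mul (ε ^ 2)⁻¹
  refine h.congr (ae_of_all _ fun x => ?_)
  simp only
  rw [← mul_inv]
  congr 1
  field_simp
  ring

lemma integrable_norm_sq_mul_kernel {K : ℝ → ℝ} (hK : Integrable K) (u : L2Cone) :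
    Integrable (fun y : ℝ × ℝ × S2 => ‖u (y.1, y.2.2)‖ ^ 2 * K (y.1 - y.2.1)) twoPointMeasure ∧
    Integrable (fun y : ℝ × ℝ × S2 => ‖u (y.2.1, y.2.2)‖ ^ 2 * K (y.1 - y.2.1))
      twoPointMeasure := by
  have hf : Integrable (fun x => ‖u x‖ ^ 2) coneMeasure := (Lp.memLp u).integrable_norm_pow two_ne_zero
  have key : ∀ {K : ℝ → ℝ}, Integrable K → Integrable
      (fun y : ℝ × ℝ × S2 => ‖u (y.2.1, y.2.2)‖ ^ 2 * K (y.1 - y.2.1)) twoPointMeasure := by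
    intro K hK
    refine (measurePreserving_shear.integrable_comp_of_integrable (hK.mul_prod hf)).congr
      (ae_of_all _ fun y => ?_)
    exact mul_comm _ _
  refine ⟨?_, key hK⟩
  refine (measurePreserving_exchange.integrable_comp_of_integrable (key hK.comp_neg)).congr
    (ae_of_all _ fun y => ?_)
  simp only [Function.comp, neg_sub]

/-- The product `|u| |v|` is at most `|u|² + |v|²`, and each square against the integrable kernel
`1/((V - V')² + ε²)` is integrable after the shear. -/
lemma integrable_regIntegrand {ε : ℝ} (hε : 0 < ε) (u v : L2Cone) :
    Integrable (regIntegrand ε u v) twoPointMeasure := by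
  have hK := integrable_inv_sq_add_sq hε
  refine ((integrable_norm_sq_mul_kernel hK u).1.add (integrable_norm_sq_mul_kernel hK v).2).mono'
    (stronglyMeasurable_regIntegrand ε (Lp.stronglyMeasurable u)
      (Lp.stronglyMeasurable v)).aestronglyMeasurable (ae_of_all _ fun y => ?_)
  rw [norm_regIntegrand, Pi.add_apply, ← add_mul]
  refine mul_le_mul_of_nonneg_right ?_ (by positivity)
  nlinarith [sq_nonneg (‖u (y.1, y.2.2)‖ - ‖v (y.2.1, y.2.2)‖), norm_nonneg (u (y.1, y.2.2)),
    norm_nonneg (v (y.2.1, y.2.2)), mul_nonneg (norm_nonneg (u (y.1, y.2.2)))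
    (norm_nonneg (v (y.2.1, y.2.2)))]

/-- The multiplier `regFreq` as a function on `𝒞`. -/
def regMul (ε : ℝ) : L2Cone →L[ℂ] L2Cone := mulL2 fun x => regFreq ε x.1

lemma coeFn_regMul {ε : ℝ} (hε : 0 < ε) (u : L2Cone) :
    (regMul ε u : Cone → ℂ) =ᵐ[coneMeasure] fun x => regFreq ε x.1 * u x :=
  coeFn_mulL2 ((measurable_regFreq ε).comp measurable_fst) (fun x => norm_regFreq_le ε x.1 hε) u

lemma pairing_regMul {ε : ℝ} (hε : 0 < ε) (u v : L2Cone) :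
    (fun x => regMul ε (vFourier u) x * reflectL2 (vFourier v) x) =ᵐ[coneMeasure]
      fun x => regFreq ε x.1 * vFourier u x * vFourier v (-x.1, x.2) := by
  filter_upwards [coeFn_regMul hε (vFourier u), coeFn_reflectL2 (vFourier v)] with x h1 h2
  rw [h1, h2]

lemma integral_fiber_product {u v : L2Cone}
    (hW : Integrable (fun y : ℝ × ℝ × S2 => u (y.1, y.2.2) * v (y.2.1, y.2.2)) twoPointMeasure)
    (k : ℝ) :
    ∫ y : ℝ × ℝ × S2, Complex.exp (((-2 * Real.pi * (y.1 - y.2.1) * k : ℝ) : ℂ) * Complex.I)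
        * (u (y.1, y.2.2) * v (y.2.1, y.2.2)) ∂twoPointMeasure
      = ∫ s, partialFourier u (k, s) * partialFourier v (-k, s) ∂sphereMeasure := by
  have hI : Integrable (fun y : ℝ × ℝ × S2 =>
      Complex.exp (((-2 * Real.pi * (y.1 - y.2.1) * k : ℝ) : ℂ) * Complex.I)
        * (u (y.1, y.2.2) * v (y.2.1, y.2.2))) twoPointMeasure := by
    refine hW.bdd_mul (c := 1) (Continuous.aestronglyMeasurable (by fun_prop))
      (ae_of_all _ fun y => ?_)
    rw [Complex.norm_exp_ofReal_mul_I]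
  have hA := measurePreserving_prodAssoc (volume : Measure ℝ) (volume : Measure ℝ) sphereMeasure
  rw [← hA.integral_comp', integral_prod_symm]
  · refine integral_congr_ae (ae_of_all _ fun s => ?_)
    simp only [partialFourier_eq]
    rw [← integral_prod_mul]
    refine integral_congr_ae (ae_of_all _ fun p => ?_)
    simp only [MeasurableEquiv.prodAssoc, MeasurableEquiv.coe_mk, Equiv.prodAssoc_apply]
    rw [mul_mul_mul_comm, ← Complex.exp_add]
    congr 2
    push_cast
    ring
  · exact hA.integrable_comp_of_integrable hI

/-- Insert the Fourier representation of the kernel and exchange the integrals. Fubini applies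
because both `regFreq ε` and the product of `u` and `v` are integrable; the exponential then splits
into the two partial transforms, at `k` and `-k`. -/
lemma regPairing_of_integrable {ε : ℝ} (hε : 0 < ε) {u v : L2Cone} (hu : u ∈ fiberIntegrable)
    (hv : v ∈ fiberIntegrable)
    (hW : Integrable (fun y : ℝ × ℝ × S2 => u (y.1, y.2.2) * v (y.2.1, y.2.2)) twoPointMeasure) :
    -(1 / (Real.pi : ℂ)) * ∫ y, regIntegrand ε u v y ∂twoPointMeasure
      = pairing (regMul ε (vFourier u)) (reflectL2 (vFourier v)) := by
  have h1 : -(1 / (Real.pi : ℂ)) * ∫ y, regIntegrand ε u v y ∂twoPointMeasure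
      = ∫ y : ℝ × ℝ × S2, (∫ k : ℝ, regFreq ε k *
        (Complex.exp (((-2 * Real.pi * (y.1 - y.2.1) * k : ℝ) : ℂ) * Complex.I)
        * (u (y.1, y.2.2) * v (y.2.1, y.2.2)))) ∂twoPointMeasure := by
    rw [← integral_const_mul]
    refine integral_congr_ae (ae_of_all _ fun y => ?_)
    simp only [← mul_assoc (regFreq _ _)]
    rw [integral_mul_const, integral_regFreq hε, regIntegrand, Complex.ofReal_sub]
    ring
  have hG : Integrable (fun p : (ℝ × ℝ × S2) × ℝ => regFreq ε p.2 *
        (Complex.exp (((-2 * Real.pi * (p.1.1 - p.1.2.1) * p.2 : ℝ) : ℂ) * Complex.I)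
        * (u (p.1.1, p.1.2.2) * v (p.1.2.1, p.1.2.2)))) (twoPointMeasure.prod volume) := by
    refine ((hW.mul_prod (integrable_regFreq hε)).bdd_mul (c := 1) (f := fun p : (ℝ × ℝ × S2) × ℝ =>
      Complex.exp (((-2 * Real.pi * (p.1.1 - p.1.2.1) * p.2 : ℝ) : ℂ) * Complex.I))
      (Continuous.aestronglyMeasurable (by fun_prop)) (ae_of_all _ fun y => ?_)).congr
      (ae_of_all _ fun p => ?_)
    · rw [Complex.norm_exp_ofReal_mul_I]
    · simp only
      ring
  rw [h1, integral_integral_swap hG, pairing_apply, integral_congr_ae (pairing_regMul hε u v)]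
  have hJ : Integrable (fun x => regFreq ε x.1 * vFourier u x * vFourier v (-x.1, x.2))
      coneMeasure := (integrable_mul_L2 _ _).congr (pairing_regMul hε u v)
  have he : (fun x => regFreq ε x.1 * vFourier u x * vFourier v (-x.1, x.2)) =ᵐ[coneMeasure]
      fun x => regFreq ε x.1 * (partialFourier u x * partialFourier v (-x.1, x.2)) := by
    have h' := measurePreserving_reflect.quasiMeasurePreserving.ae_eq_comp (coeFn_vFourier hv)
    filter_upwards [coeFn_vFourier hu, h'] with x e1 e2
    have e3 : vFourier v (-x.1, x.2) = partialFourier v (-x.1, x.2) := e2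
    rw [e1, e3, mul_assoc]
  rw [integral_congr_ae he, integral_prod _ (hJ.congr he)]
  refine integral_congr_ae (ae_of_all _ fun k => ?_)
  simp only [integral_const_mul]
  rw [integral_fiber_product hW]

lemma integrable_cutoff_product (n : ℕ) (u v : L2Cone) :
    Integrable (fun y : ℝ × ℝ × S2 => mulL2 (cutoff n) u (y.1, y.2.2)
      * mulL2 (cutoff n) v (y.2.1, y.2.2)) twoPointMeasure := by
  have h := integrable_regIntegrand one_pos (mulL2 (cutoff n) u) (mulL2 (cutoff n) v)
  -- Multiplying the regularised integrand at `ε = 1` by its own denominator leaves the bare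
  -- product; the cutoffs bound the denominator by `(2n)² + 1`.
  let m : ℝ × ℝ × S2 → ℂ := fun y => cutoff n (y.1, y.2.2) * cutoff n (y.2.1, y.2.2)
    * ((y.1 : ℂ) - (y.2.1 : ℂ) - Complex.I * ((1 : ℝ) : ℂ)) ^ 2
  have hm : Measurable m := by
    have h1 : Measurable fun y : ℝ × ℝ × S2 => cutoff n (y.1, y.2.2) :=
      (measurable_cutoff n).comp (by fun_prop)
    have h2 : Measurable fun y : ℝ × ℝ × S2 => cutoff n (y.2.1, y.2.2) :=
      (measurable_cutoff n).comp (by fun_prop)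
    exact (h1.mul h2).mul (by fun_prop)
  refine (h.bdd_mul (f := m) (c := (2 * n) ^ 2 + 1) hm.aestronglyMeasurable
    (ae_of_all _ fun y => ?_)).congr ?_
  · simp only [m]
    rw [← Complex.ofReal_sub, norm_mul, norm_sub_I_mul_sq, norm_mul]
    unfold cutoff
    split_ifs with h1 h2
    · rw [norm_one, one_mul, one_mul, one_pow]
      have h3 := abs_le.1 h1
      have h4 := abs_le.1 h2
      simp only at h3 h4
      have h5 : (y.1 - y.2.1) ^ 2 ≤ (2 * n) ^ 2 := sq_le_sq' (by linarith) (by linarith)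
      linarith
    all_goals
      simp only [norm_zero, norm_one, mul_zero, zero_mul]
      positivity
  · filter_upwards [quasiMeasurePreserving_left.ae
      (coeFn_mulL2 (measurable_cutoff n) (norm_cutoff_le n) u),
      quasiMeasurePreserving_right.ae (coeFn_mulL2 (measurable_cutoff n) (norm_cutoff_le n) v)]
      with y h1 h2
    have h0 : ((y.1 : ℂ) - (y.2.1 : ℂ) - Complex.I * ((1 : ℝ) : ℂ)) ^ 2 ≠ 0 := by
      rw [← norm_pos_iff, ← Complex.ofReal_sub, norm_sub_I_mul_sq]
      positivity
    replace h0 := ne_zero_pow two_ne_zero h0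
    have hc : ∀ x : Cone, cutoff n x * cutoff n x = cutoff n x := by
      intro x
      unfold cutoff
      split_ifs <;> simp
    have h3 : mulL2 (cutoff n) v (y.2.1, y.2.2) = cutoff n (y.2.1, y.2.2) * v (y.2.1, y.2.2) := h2
    simp only [m, regIntegrand]
    rw [h1, h3]
    calc _ = (cutoff n (y.1, y.2.2) * cutoff n (y.1, y.2.2)) * (cutoff n (y.2.1, y.2.2)
          * cutoff n (y.2.1, y.2.2)) * u (y.1, y.2.2) * v (y.2.1, y.2.2) := by
          field_simp
      _ = _ := by
          rw [hc, hc]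
          ring

/-- Truncate in `V` and let `n → ∞`: the right side is continuous on `L²`, and the left side
converges by domination with the untruncated integrand. -/
theorem regPairing {ε : ℝ} (hε : 0 < ε) (u v : L2Cone) :
    -(1 / (Real.pi : ℂ)) * ∫ y, regIntegrand ε u v y ∂twoPointMeasure
      = pairing (regMul ε (vFourier u)) (reflectL2 (vFourier v)) := by
  have hcut : ∀ (n : ℕ) (u : L2Cone), mulL2 (cutoff n) u ∈ fiberIntegrable := fun n u =>
    mulL2_mem_fiberIntegrable (measurable_cutoff n) (norm_cutoff_le n) (R := n)
      (fun x hx => if_neg (not_le.2 hx)) u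
  have hn : ∀ n : ℕ, _ := fun n => regPairing_of_integrable hε (hcut n u) (hcut n v)
    (integrable_cutoff_product n u v)
  have hR : Tendsto (fun n => pairing (regMul ε (vFourier (mulL2 (cutoff n) u)))
      (reflectL2 (vFourier (mulL2 (cutoff n) v)))) atTop
      (𝓝 (pairing (regMul ε (vFourier u)) (reflectL2 (vFourier v)))) :=
    tendsto_pairing
      ((((regMul ε).comp vFourier).continuous.tendsto u).comp (tendsto_cutoff u))
      (((reflectL2.continuous.comp vFourier.continuous).tendsto v).comp (tendsto_cutoff v))
  have hae := ae_all_iff.2 fun n => quasiMeasurePreserving_left.ae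
      (coeFn_mulL2 (measurable_cutoff n) (norm_cutoff_le n) u)
  have hae' := ae_all_iff.2 fun n => quasiMeasurePreserving_right.ae
      (coeFn_mulL2 (measurable_cutoff n) (norm_cutoff_le n) v)
  have hL : Tendsto (fun n => ∫ y, regIntegrand ε (mulL2 (cutoff n) u) (mulL2 (cutoff n) v) y
      ∂twoPointMeasure) atTop (𝓝 (∫ y, regIntegrand ε u v y ∂twoPointMeasure)) := by
    refine tendsto_integral_of_dominated_convergence (fun y => ‖regIntegrand ε u v y‖)
      (fun n => (stronglyMeasurable_regIntegrand ε (Lp.stronglyMeasurable _)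
        (Lp.stronglyMeasurable _)).aestronglyMeasurable) (integrable_regIntegrand hε u v).norm
      (fun n => ?_) ?_
    · filter_upwards [hae, hae'] with y h1 h2
      have h3 : mulL2 (cutoff n) v (y.2.1, y.2.2) = cutoff n (y.2.1, y.2.2) * v (y.2.1, y.2.2) :=
        h2 n
      rw [norm_regIntegrand, norm_regIntegrand, h1, h3, norm_mul, norm_mul]
      gcongr
      · exact mul_le_of_le_one_left (norm_nonneg _) (norm_cutoff_le _ _)
      · exact mul_le_of_le_one_left (norm_nonneg _) (norm_cutoff_le _ _)
    · filter_upwards [hae, hae'] with y h1 h2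
      refine tendsto_const_nhds.congr' ?_
      filter_upwards [(tendsto_natCast_atTop_atTop (R := ℝ)).eventually_ge_atTop |y.1|,
        (tendsto_natCast_atTop_atTop (R := ℝ)).eventually_ge_atTop |y.2.1|] with n hn hn'
      have h3 : mulL2 (cutoff n) v (y.2.1, y.2.2) = cutoff n (y.2.1, y.2.2) * v (y.2.1, y.2.2) :=
        h2 n
      rw [regIntegrand, regIntegrand, h1, h3, cutoff, cutoff, if_pos hn, if_pos hn', one_mul,
        one_mul]
  refine tendsto_nhds_unique (hL.const_mul _) ?_
  simp only [hn]
  exact hR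

/-- Dominated convergence in Fourier space: the multipliers are bounded by `4πk` on `k > 0`
uniformly in `ε`, and the limiting integrand is integrable. -/
theorem tendsto_regTwoPoint (ψ χ : TestSpace) :
    Tendsto (fun ε => regTwoPoint ε ψ χ) (𝓝[>] 0) (𝓝 (twoPointForm ψ χ)) := by
  have h1 : (fun ε => ∫ x, regFreq ε x.1 * vFourier ψ.1.1 x * vFourier χ.1.1 (-x.1, x.2)
      ∂coneMeasure) =ᶠ[𝓝[>] 0] fun ε => regTwoPoint ε ψ χ := by
    filter_upwards [self_mem_nhdsWithin] with ε hε
    rw [← integral_congr_ae (pairing_regMul hε ψ.1.1 χ.1.1), ← pairing_apply, ← regPairing hε]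
    rfl
  refine Tendsto.congr' h1 ?_
  rw [twoPointForm_eq_integral]
  refine tendsto_integral_filter_of_dominated_convergence _ ?_ ?_
    (integrable_twoPointForm ψ χ).norm (ae_of_all _ fun x => ?_)
  · filter_upwards [self_mem_nhdsWithin] with ε hε
    exact ((integrable_mul_L2 _ _).congr (pairing_regMul hε ψ.1.1 χ.1.1)).aestronglyMeasurable
  · filter_upwards [self_mem_nhdsWithin] with ε hε
    refine ae_of_all _ fun x => ?_
    have : ‖regFreq ε x.1‖ ≤ ‖4 * Real.pi * (posFreq x * x.1)‖ := by
      unfold regFreq posFreq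
      split_ifs with hx
      · rw [one_mul, norm_mul]
        refine mul_le_of_le_one_right (norm_nonneg _) ?_
        rw [Complex.norm_real, Real.norm_of_nonneg (Real.exp_pos _).le, Real.exp_le_one_iff]
        have hε' : 0 < ε := hε
        have : 0 < 2 * Real.pi * x.1 * ε := by positivity
        linarith
      · simp
    calc _ = ‖regFreq ε x.1‖ * ‖vFourier ψ.1.1 x * vFourier χ.1.1 (-x.1, x.2)‖ := by
          rw [mul_assoc, norm_mul]
      _ ≤ ‖4 * Real.pi * (posFreq x * x.1)‖ * ‖vFourier ψ.1.1 x * vFourier χ.1.1 (-x.1, x.2)‖ :=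
          mul_le_mul_of_nonneg_right this (norm_nonneg _)
      _ = _ := by
          rw [← norm_mul]
          congr 1
          ring
  · have h2 : Tendsto (fun ε => regFreq ε x.1) (𝓝[>] 0) (𝓝 (4 * Real.pi * (posFreq x * x.1))) := by
      unfold regFreq posFreq
      split_ifs with hx
      · have hc : Continuous fun ε : ℝ => (4 * Real.pi * x.1
            * (Real.exp (-(2 * Real.pi * x.1 * ε)) : ℂ) : ℂ) := by fun_prop
        have := (hc.tendsto 0).mono_left (nhdsWithin_le_nhds (s := Ioi 0))
        simpa using this
      · simp
    have h3 := (h2.mul_const (vFourier ψ.1.1 x)).mul_const (vFourier χ.1.1 (-x.1, x.2))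
    convert h3 using 2
    ring

theorem twoPoint_eq (ψ χ : TestSpace) : twoPoint ψ χ = twoPointForm ψ χ :=
  (tendsto_regTwoPoint ψ χ).limUnder_eq

theorem integrable_twoPointIntegrand (ψ χ : TestSpace) {ε : ℝ} (hε : 0 < ε) :
    Integrable (twoPointIntegrand ε ψ χ) twoPointMeasure :=
  integrable_regIntegrand hε ψ.1.1 χ.1.1

end TwoPointLimit

/-! ### Fibrewise affine transformations of the cone. -/

lemma exists_norm_le_sphere {f : S2 → ℝ} (hf : Continuous f) : ∃ C, ∀ s, |f s| ≤ C := by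
  obtain ⟨C, hC⟩ := isCompact_univ.exists_bound_of_continuousOn hf.continuousOn
  exact ⟨C, fun s => hC s (mem_univ s)⟩

lemma exists_pos_le_sphere {f : S2 → ℝ} (hf : Continuous f) (h0 : ∀ s, 0 < f s) :
    ∃ c, 0 < c ∧ ∀ s, c ≤ f s := by
  obtain ⟨C, hC⟩ := exists_norm_le_sphere (hf.inv₀ fun s => (h0 s).ne')
  refine ⟨(|C| + 1)⁻¹, by positivity, fun s => ?_⟩
  rw [inv_le_comm₀ (by positivity) (h0 s)]
  have : (f s)⁻¹ ≤ C := (le_abs_self _).trans (hC s)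
  linarith [le_abs_self C]

/-- The maps `(V, s) ↦ (a(s) V + b(s), θ(s))` of `𝒞` for which the weight `w` satisfies
`θ_* (w² dS²) = dS²`. -/
structure ConeMap where
  base : S2 → S2
  scale : S2 → ℝ
  shift : S2 → ℝ
  weight : S2 → ℝ
  continuous_base : Continuous base
  continuous_scale : Continuous scale
  continuous_shift : Continuous shift
  continuous_weight : Continuous weight
  scale_pos : ∀ s, 0 < scale s
  weight_pos : ∀ s, 0 < weight s
  lintegral_base : ∀ f : S2 → ℝ≥0∞, Measurable f →
    ∫⁻ s, ENNReal.ofReal (weight s ^ 2) * f (base s) ∂sphereMeasure = ∫⁻ s, f s ∂sphereMeasure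

lemma lintegral_affine {f : ℝ → ℝ≥0∞} (hf : Measurable f) {a : ℝ} (ha : 0 < a) (b : ℝ) :
    ENNReal.ofReal a * ∫⁻ V, f (a * V + b) = ∫⁻ V, f V := by
  have h := Real.smul_map_volume_mul_left ha.ne'
  rw [abs_of_pos ha] at h
  calc _ = ENNReal.ofReal a * ∫⁻ V, f (V + b) ∂(Measure.map (a * ·) volume) := by
        rw [lintegral_map (f := fun V => f (V + b)) (hf.comp (by fun_prop)) (by fun_prop)]
    _ = ∫⁻ V, f (V + b) := by
        rw [← smul_eq_mul, ← lintegral_smul_measure, h]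
    _ = _ := lintegral_add_right_eq_self f b

namespace ConeMap

variable (G : ConeMap)

/-- The transformation of `𝒞`. -/
def map (x : Cone) : Cone := (G.scale x.2 * x.1 + G.shift x.2, G.base x.2)

/-- The density whose image is the measure of `𝒞`. -/
def density (x : Cone) : ℝ := G.scale x.2 * G.weight x.2 ^ 2

lemma continuous_map : Continuous G.map := by
  have := G.continuous_base
  have := G.continuous_scale
  have := G.continuous_shift
  unfold map
  fun_prop

lemma continuous_density : Continuous G.density := by
  have := G.continuous_scale
  have := G.continuous_weight
  unfold density
  fun_prop

lemma density_pos (x : Cone) : 0 < G.density x :=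
  mul_pos (G.scale_pos _) (pow_pos (G.weight_pos _) 2)

lemma lintegral_map {f : Cone → ℝ≥0∞} (hf : Measurable f) :
    ∫⁻ x, ENNReal.ofReal (G.density x) * f (G.map x) ∂coneMeasure = ∫⁻ x, f x ∂coneMeasure := by
  have h1 : Measurable fun x => ENNReal.ofReal (G.density x) * f (G.map x) :=
    (G.continuous_density.measurable.ennreal_ofReal).mul (hf.comp G.continuous_map.measurable)
  rw [lintegral_cone h1.aemeasurable, lintegral_cone hf.aemeasurable]
  have h2 : Measurable fun s => ∫⁻ V : ℝ, f (V, s) := by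
    exact Measurable.lintegral_prod_left' hf
  rw [← G.lintegral_base _ h2]
  refine lintegral_congr fun s => ?_
  have h3 : Measurable fun V : ℝ => f (V, G.base s) := hf.comp (by fun_prop)
  rw [← lintegral_affine h3 (G.scale_pos s) (G.shift s), ← mul_assoc,
    ← ENNReal.ofReal_mul (by positivity), ← lintegral_const_mul]
  · refine lintegral_congr fun V => ?_
    simp only [density, map]
    rw [mul_comm (G.scale s)]
  · exact h3.comp (by fun_prop)

/-- The measure with density `density`. -/
def srcMeasure : Measure Cone := coneMeasure.withDensity fun x => ENNReal.ofReal (G.density x)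

lemma measurePreserving : MeasurePreserving G.map G.srcMeasure coneMeasure := by
  refine ⟨G.continuous_map.measurable, Measure.ext fun E hE => ?_⟩
  rw [Measure.map_apply G.continuous_map.measurable hE, srcMeasure,
    withDensity_apply _ (G.continuous_map.measurable hE),
    ← lintegral_indicator (G.continuous_map.measurable hE), ← lintegral_indicator_one hE,
    ← G.lintegral_map (measurable_one.indicator hE)]
  refine lintegral_congr fun x => ?_
  by_cases h : G.map x ∈ E
  · rw [indicator_of_mem h, indicator_of_mem (show x ∈ G.map ⁻¹' E from h)]
    simp
  · rw [indicator_of_notMem h, indicator_of_notMem (show x ∉ G.map ⁻¹' E from h)]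
    simp

lemma quasiMeasurePreserving : Measure.QuasiMeasurePreserving G.map coneMeasure coneMeasure := by
  refine G.measurePreserving.quasiMeasurePreserving.mono_left ?_
  refine withDensity_absolutelyContinuous' (by
    exact G.continuous_density.measurable.ennreal_ofReal.aemeasurable) (ae_of_all _ fun x => ?_)
  exact (ENNReal.ofReal_pos.2 (G.density_pos x)).ne'

/-- The density depends on `s` only and is bounded below by compactness of the sphere; this makes
composition with `G` bounded on `L²`. -/
lemma exists_measure_le : ∃ C : ℝ≥0∞, C ≠ ⊤ ∧ coneMeasure ≤ C • G.srcMeasure := by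
  obtain ⟨c, hc, h⟩ := exists_pos_le_sphere (f := fun s => G.density (0, s))
    (G.continuous_density.comp (by fun_prop)) fun s => G.density_pos _
  refine ⟨ENNReal.ofReal c⁻¹, ENNReal.ofReal_ne_top, Measure.le_iff.2 fun E hE => ?_⟩
  rw [Measure.smul_apply, srcMeasure, withDensity_apply _ hE, smul_eq_mul, ← lintegral_const_mul,
    ← setLIntegral_one]
  · refine lintegral_mono fun x => ?_
    rw [← ENNReal.ofReal_mul (by positivity), ← ENNReal.ofReal_one]
    refine ENNReal.ofReal_le_ofReal ?_
    have h1 : c ≤ G.density x := h x.2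
    rw [inv_mul_eq_div, one_le_div hc]
    exact h1
  · exact G.continuous_density.measurable.ennreal_ofReal

lemma exists_eLpNorm_le : ∃ C : ℝ≥0∞, C ≠ ⊤ ∧ ∀ u : L2Cone,
    eLpNorm (u ∘ G.map) 2 coneMeasure ≤ C * eLpNorm u 2 coneMeasure := by
  obtain ⟨C, hC, hle⟩ := G.exists_measure_le
  refine ⟨C ^ (1 / (2 : ℝ≥0∞)).toReal, ENNReal.rpow_ne_top_of_nonneg (by simp) hC, fun u => ?_⟩
  refine (eLpNorm_mono_measure _ hle).trans ?_
  rw [eLpNorm_smul_measure_of_ne_top (by simp), smul_eq_mul,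
    eLpNorm_comp_measurePreserving (Lp.aestronglyMeasurable u) G.measurePreserving]

lemma memLp_comp (u : L2Cone) : MemLp (u ∘ G.map) 2 coneMeasure := by
  obtain ⟨C, hC, h⟩ := G.exists_eLpNorm_le
  exact ⟨(Lp.aestronglyMeasurable u).comp_quasiMeasurePreserving G.quasiMeasurePreserving,
    (h u).trans_lt (ENNReal.mul_lt_top hC.lt_top (Lp.eLpNorm_lt_top u))⟩

/-- Composition with a transformation of `𝒞`, on `L²(𝒞)`. -/
def compL2 : L2Cone →L[ℂ] L2Cone :=
  LinearMap.mkContinuousOfExistsBound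
    { toFun := fun u => (G.memLp_comp u).toLp _
      map_add' := fun u v => by
        rw [← MemLp.toLp_add]
        exact (MemLp.toLp_eq_toLp_iff _ _).2 (G.quasiMeasurePreserving.ae_eq_comp (Lp.coeFn_add u v))
      map_smul' := fun c u => by
        rw [RingHom.id_apply, ← MemLp.toLp_const_smul]
        exact (MemLp.toLp_eq_toLp_iff _ _).2
          (G.quasiMeasurePreserving.ae_eq_comp (Lp.coeFn_smul c u)) }
    (by
      obtain ⟨C, hC, h⟩ := G.exists_eLpNorm_le
      refine ⟨C.toReal, fun u => ?_⟩
      change ‖(G.memLp_comp u).toLp _‖ ≤ _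
      rw [Lp.norm_toLp, Lp.norm_def, ← ENNReal.toReal_mul]
      exact ENNReal.toReal_mono (ENNReal.mul_ne_top hC (Lp.eLpNorm_ne_top u)) (h u))

lemma coeFn_compL2 (u : L2Cone) :
    (G.compL2 u : Cone → ℂ) =ᵐ[coneMeasure] fun x => u (G.map x) :=
  (G.memLp_comp u).coeFn_toLp

/-- The action on the Fourier variable. -/
def dual : ConeMap where
  base := G.base
  scale s := (G.scale s)⁻¹
  shift _ := 0
  weight := G.weight
  continuous_base := G.continuous_base
  continuous_scale := G.continuous_scale.inv₀ fun s => (G.scale_pos s).ne'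
  continuous_shift := continuous_const
  continuous_weight := G.continuous_weight
  scale_pos s := inv_pos.2 (G.scale_pos s)
  weight_pos := G.weight_pos
  lintegral_base := G.lintegral_base

/-- The factor by which the Fourier transform changes. -/
def phase (x : Cone) : ℂ := (((G.scale x.2)⁻¹ : ℝ) : ℂ)
  * Complex.exp (((2 * Real.pi * x.1 * (G.shift x.2 / G.scale x.2) : ℝ) : ℂ) * Complex.I)

lemma measurable_phase : Measurable G.phase := by
  have h1 := G.continuous_scale
  have h2 := G.continuous_shift
  have h3 : Continuous fun s => (G.scale s)⁻¹ := G.continuous_scale.inv₀ fun s => (G.scale_pos s).ne'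
  have h4 : Continuous fun s => G.shift s / G.scale s := h2.div h1 fun s => (G.scale_pos s).ne'
  refine Continuous.measurable ?_
  refine (Complex.continuous_ofReal.comp (h3.comp continuous_snd)).mul (Complex.continuous_exp.comp
    ((Complex.continuous_ofReal.comp ((continuous_const.mul continuous_fst).mul
      (h4.comp continuous_snd))).mul continuous_const))

lemma norm_phase (x : Cone) : ‖G.phase x‖ = (G.scale x.2)⁻¹ := by
  rw [phase, norm_mul, Complex.norm_exp_ofReal_mul_I, mul_one, Complex.norm_real,
    Real.norm_of_nonneg (inv_pos.2 (G.scale_pos _)).le]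

/-- The shift contributes opposite phases at `k` and `-k`, so the two-point function does not see
it. -/
lemma phase_mul_phase (x : Cone) :
    G.phase x * G.phase (-x.1, x.2) = (((G.scale x.2)⁻¹ ^ 2 : ℝ) : ℂ) := by
  simp only [phase]
  rw [mul_mul_mul_comm, ← Complex.exp_add]
  have : (((2 * Real.pi * x.1 * (G.shift x.2 / G.scale x.2) : ℝ) : ℂ) * Complex.I
      + ((2 * Real.pi * -x.1 * (G.shift x.2 / G.scale x.2) : ℝ) : ℂ) * Complex.I) = 0 := by
    push_cast
    ring
  rw [this, Complex.exp_zero]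
  push_cast
  ring

lemma exists_norm_phase_le : ∃ C, ∀ x, ‖G.phase x‖ ≤ C := by
  obtain ⟨C, hC⟩ := exists_norm_le_sphere
    (G.continuous_scale.inv₀ fun s => (G.scale_pos s).ne')
  exact ⟨C, fun x => by rw [norm_phase]; exact (le_abs_self _).trans (hC x.2)⟩

lemma ae_base {p : S2 → Prop} (h : ∀ᵐ s ∂sphereMeasure, p s) :
    ∀ᵐ s ∂sphereMeasure, p (G.base s) := by
  obtain ⟨E, hE, hm, h0⟩ := exists_measurable_superset_of_null (ae_iff.1 h)
  have h1 := G.lintegral_base (E.indicator 1) (measurable_one.indicator hm)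
  rw [lintegral_indicator_one hm, h0, lintegral_eq_zero_iff] at h1
  · filter_upwards [h1] with s hs
    by_contra hp
    have h2 : G.base s ∈ E := hE hp
    rw [Pi.zero_apply, indicator_of_mem h2, Pi.one_apply, mul_one, ENNReal.ofReal_eq_zero] at hs
    exact absurd hs (not_le.2 (pow_pos (G.weight_pos s) 2))
  · exact (G.continuous_weight.pow 2).measurable.ennreal_ofReal.mul
      ((measurable_one.indicator hm).comp G.continuous_base.measurable)

lemma compL2_mem_fiberIntegrable {u : L2Cone} (hu : u ∈ fiberIntegrable) :
    G.compL2 u ∈ fiberIntegrable := by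
  rw [mem_fiberIntegrable] at hu ⊢
  filter_upwards [G.ae_base hu, ae_fiber (G.coeFn_compL2 u)] with s h1 h2
  have h3 := (h1.comp_add_right (G.shift s)).comp_mul_left' (G.scale_pos s).ne'
  exact h3.congr (h2.mono fun V hV => hV.symm)

lemma partialFourier_affine (u : Cone → ℂ) (x : Cone) :
    ∫ V : ℝ, Complex.exp (((-2 * Real.pi * V * x.1 : ℝ) : ℂ) * Complex.I) * u (G.map (V, x.2))
      = G.phase x * partialFourier u (G.dual.map x) := by
  have ha := (G.scale_pos x.2)
  rw [partialFourier_eq]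
  let g : ℝ → ℂ := fun W =>
    Complex.exp (((-2 * Real.pi * ((W - G.shift x.2) / G.scale x.2) * x.1 : ℝ) : ℂ) * Complex.I)
      * u (W, G.base x.2)
  have h1 : ∫ V : ℝ, Complex.exp (((-2 * Real.pi * V * x.1 : ℝ) : ℂ) * Complex.I)
      * u (G.map (V, x.2)) = ∫ V : ℝ, g (G.scale x.2 * V + G.shift x.2) := by
    refine integral_congr_ae (ae_of_all _ fun V => ?_)
    simp only [g, map]
    rw [add_sub_cancel_right, mul_div_cancel_left₀ _ ha.ne']
  rw [h1, Measure.integral_comp_mul_left (fun V => g (V + G.shift x.2)),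
    integral_add_right_eq_self g, abs_of_pos (inv_pos.2 ha), Complex.real_smul]
  simp only [g, phase, dual, map]
  rw [mul_assoc]
  congr 1
  rw [← integral_const_mul]
  refine integral_congr_ae (ae_of_all _ fun V => ?_)
  simp only
  rw [← mul_assoc, ← Complex.exp_add]
  congr 2
  push_cast
  field_simp
  ring

theorem vFourier_compL2_eq (u : L2Cone) :
    vFourier (G.compL2 u) = mulL2 G.phase (G.dual.compL2 (vFourier u)) := by
  obtain ⟨C, hC⟩ := G.exists_norm_phase_le
  induction u using dense_fiberIntegrable.induction_on with
  | hp => exact isClosed_eq (by fun_prop) (by fun_prop)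
  | ih u =>
    refine Lp.ext ?_
    have h1 := G.dual.quasiMeasurePreserving.ae_eq_comp (coeFn_vFourier u.2)
    have h2 : ∀ᵐ x ∂coneMeasure, partialFourier (G.compL2 (u : L2Cone)) x
        = G.phase x * partialFourier (u : L2Cone) (G.dual.map x) := by
      have h3 : ∀ᵐ s ∂sphereMeasure, ∀ k : ℝ, partialFourier (G.compL2 (u : L2Cone)) (k, s)
          = G.phase (k, s) * partialFourier (u : L2Cone) (G.dual.map (k, s)) := by
        filter_upwards [ae_fiber (G.coeFn_compL2 (u : L2Cone))] with s hs k
        rw [← G.partialFourier_affine, partialFourier_eq]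
        refine integral_congr_ae ?_
        filter_upwards [hs] with V hV
        rw [hV]
      filter_upwards [Measure.quasiMeasurePreserving_snd.ae h3] with x hx
      exact hx x.1
    filter_upwards [coeFn_vFourier (G.compL2_mem_fiberIntegrable u.2), h1, h2,
      coeFn_mulL2 G.measurable_phase hC (G.dual.compL2 (vFourier u)),
      G.dual.coeFn_compL2 (vFourier u)] with x e1 e2 e3 e4 e5
    have e2' : vFourier u (G.dual.map x) = partialFourier (u : L2Cone) (G.dual.map x) := e2
    rw [Submodule.subtype_apply, e1, e3, e4, e5, e2']

lemma vFourier_compL2 (u : L2Cone) : (vFourier (G.compL2 u) : Cone → ℂ) =ᵐ[coneMeasure]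
    fun x => G.phase x * vFourier u (G.dual.map x) := by
  obtain ⟨C, hC⟩ := G.exists_norm_phase_le
  rw [vFourier_compL2_eq]
  filter_upwards [coeFn_mulL2 G.measurable_phase hC (G.dual.compL2 (vFourier u)),
      G.dual.coeFn_compL2 (vFourier u)] with x e4 e5
  rw [e4, e5]

end ConeMap

/-- Multiplication of square integrable functions by continuous functions on the sphere. -/
def mulS (f : S2 → ℝ) : L2Cone →L[ℂ] L2Cone := mulL2 fun x => (f x.2 : ℂ)

lemma coeFn_mulS {f : S2 → ℝ} (hf : Continuous f) (u : L2Cone) :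
    (mulS f u : Cone → ℂ) =ᵐ[coneMeasure] fun x => (f x.2 : ℂ) * u x := by
  obtain ⟨C, hC⟩ := exists_norm_le_sphere hf
  have hm : Measurable fun x : Cone => (f x.2 : ℂ) :=
    (Complex.continuous_ofReal.comp (hf.comp continuous_snd)).measurable
  exact coeFn_mulL2 hm (fun x => by rw [Complex.norm_real]; exact hC x.2) u

lemma mulS_mem_fiberIntegrable {f : S2 → ℝ} (hf : Continuous f) {u : L2Cone}
    (hu : u ∈ fiberIntegrable) : mulS f u ∈ fiberIntegrable := by
  rw [mem_fiberIntegrable] at hu ⊢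
  filter_upwards [hu, ae_fiber (coeFn_mulS hf u)] with s h1 h2
  exact (h1.const_mul _).congr (h2.mono fun V hV => hV.symm)

lemma vFourier_mulS {f : S2 → ℝ} (hf : Continuous f) (u : L2Cone) :
    vFourier (mulS f u) = mulS f (vFourier u) := by
  induction u using dense_fiberIntegrable.induction_on with
  | hp => exact isClosed_eq (by fun_prop) (by fun_prop)
  | ih u =>
    refine Lp.ext ?_
    have h2 : ∀ᵐ x ∂coneMeasure, partialFourier (mulS f (u : L2Cone)) x
        = (f x.2 : ℂ) * partialFourier (u : L2Cone) x := by
      have h3 : ∀ᵐ s ∂sphereMeasure, ∀ k : ℝ, partialFourier (mulS f (u : L2Cone)) (k, s)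
          = (f s : ℂ) * partialFourier (u : L2Cone) (k, s) := by
        filter_upwards [ae_fiber (coeFn_mulS hf (u : L2Cone))] with s hs k
        rw [partialFourier_eq, partialFourier_eq, ← integral_const_mul]
        refine integral_congr_ae ?_
        filter_upwards [hs] with V hV
        rw [hV]
        ring
      filter_upwards [Measure.quasiMeasurePreserving_snd.ae h3] with x hx
      exact hx x.1
    filter_upwards [coeFn_vFourier (mulS_mem_fiberIntegrable hf u.2), h2,
      coeFn_mulS hf (vFourier u), coeFn_vFourier u.2] with x e1 e2 e3 e4
    rw [Submodule.subtype_apply, e1, e2, e3, e4]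

/-- The transform of the derivative is determined by that of the function, and the transform is
injective. -/
lemma toL2_injective {ψ χ : TestSpace} (h : toL2 ψ = toL2 χ) : ψ = χ := by
  have h' : ψ.1.1 = χ.1.1 := h
  have hF : ∀ u : L2Cone, vFourier u = 0 → u = 0 := fun u hu => by
    rw [← norm_eq_zero, ← norm_vFourier, hu, norm_zero]
  refine Subtype.ext (Prod.ext h' (sub_eq_zero.1 (hF _ ?_)))
  rw [map_sub, sub_eq_zero]
  refine Lp.ext ?_
  filter_upwards [vFourier_deriv ψ, vFourier_deriv χ] with x h1 h2
  rw [h1, h2, h']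

namespace ConeMap

variable (G : ConeMap)

/-- The pair of operators acting on a test function and on its derivative. -/
def pairMap : L2Cone × L2Cone →ₗ[ℂ] L2Cone × L2Cone :=
  ((mulS G.weight).comp G.compL2).toLinearMap.prodMap
    ((mulS fun s => G.weight s * G.scale s).comp G.compL2).toLinearMap

/-- The chain rule, checked in Fourier space: the multiplier `k` is evaluated at `k/a`, and the
factor `a` of the derivative entry compensates. -/
lemma pairMap_mem {p : L2Cone × L2Cone} (hp : p ∈ TestSpace) : G.pairMap p ∈ TestSpace := by
  have hc : Continuous fun s => G.weight s * G.scale s := G.continuous_weight.mul G.continuous_scale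
  have h := mem_testSpace_iff.1 hp
  refine mem_testSpace_iff.2 ?_
  have h' := G.dual.quasiMeasurePreserving.ae_eq_comp h
  change vFourier (mulS (fun s => G.weight s * G.scale s) (G.compL2 p.2)) =ᵐ[coneMeasure] fun x =>
    2 * Real.pi * Complex.I * x.1 * vFourier (mulS G.weight (G.compL2 p.1)) x
  rw [vFourier_mulS hc, vFourier_mulS G.continuous_weight]
  filter_upwards [h', coeFn_mulS hc (vFourier (G.compL2 p.2)),
    coeFn_mulS G.continuous_weight (vFourier (G.compL2 p.1)), G.vFourier_compL2 p.1,
    G.vFourier_compL2 p.2] with x h1 h2 h3 h4 h5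
  have h1' : vFourier p.2 (G.dual.map x) = 2 * Real.pi * Complex.I * (G.dual.map x).1
    * vFourier p.1 (G.dual.map x) := h1
  rw [h2, h3, h4, h5, h1']
  have hs : (G.scale x.2 : ℂ) ≠ 0 := Complex.ofReal_ne_zero.2 (G.scale_pos x.2).ne'
  have h6 : ((G.dual.map x).1 : ℂ) = (G.scale x.2 : ℂ)⁻¹ * x.1 := by
    simp [map, dual]
  rw [h6]
  push_cast
  field_simp

/-- The action `ψ ↦ w · ψ ∘ G` on test functions. -/
def pull : TestSpace →ₗ[ℂ] TestSpace := G.pairMap.restrict fun _ h => G.pairMap_mem h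

lemma pull_fst (ψ : TestSpace) : (G.pull ψ).1.1 = mulS G.weight (G.compL2 ψ.1.1) := rfl

lemma coeFn_pull (ψ : TestSpace) : (toL2 (G.pull ψ) : Cone → ℂ) =ᵐ[coneMeasure]
    fun x => (G.weight x.2 : ℂ) * toL2 ψ (G.map x) := by
  filter_upwards [coeFn_mulS G.continuous_weight (G.compL2 ψ.1.1), G.coeFn_compL2 ψ.1.1]
    with x h1 h2
  change mulS G.weight (G.compL2 ψ.1.1) x = _
  rw [h1, h2]
  rfl

lemma pull_conjTest (ψ : TestSpace) : G.pull (conjTest ψ) = conjTest (G.pull ψ) := by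
  refine toL2_injective (Lp.ext ?_)
  have h1 := G.quasiMeasurePreserving.ae_eq_comp (Lp.coeFn_star ψ.1.1)
  filter_upwards [G.coeFn_pull (conjTest ψ), G.coeFn_pull ψ, h1, Lp.coeFn_star (toL2 (G.pull ψ))]
    with x e1 e2 e3 e4
  have e3' : toL2 (conjTest ψ) (G.map x) = star (toL2 ψ (G.map x)) := e3
  have e4' : toL2 (conjTest (G.pull ψ)) x = star (toL2 (G.pull ψ) x) := e4
  rw [e1, e4', e2, e3', star_mul']
  congr 1
  exact (Complex.conj_ofReal _).symm

lemma vFourier_pull (ψ : TestSpace) : (vFourier (G.pull ψ).1.1 : Cone → ℂ) =ᵐ[coneMeasure]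
    fun x => (G.weight x.2 : ℂ) * (G.phase x * vFourier ψ.1.1 (G.dual.map x)) := by
  rw [pull_fst, vFourier_mulS G.continuous_weight]
  filter_upwards [coeFn_mulS G.continuous_weight (vFourier (G.compL2 ψ.1.1)),
    G.vFourier_compL2 ψ.1.1] with x h1 h2
  rw [h1, h2]

lemma integral_map {f : Cone → ℂ} (hf : AEStronglyMeasurable f coneMeasure) :
    ∫ x, (G.density x : ℂ) * f (G.map x) ∂coneMeasure = ∫ x, f x ∂coneMeasure := by
  conv_rhs => rw [← G.measurePreserving.map_eq]
  rw [MeasureTheory.integral_map G.continuous_map.aemeasurable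
    (by rw [G.measurePreserving.map_eq]; exact hf), srcMeasure]
  have hm : Measurable fun x => (G.density x).toNNReal :=
    G.continuous_density.measurable.real_toNNReal
  have := integral_withDensity_eq_integral_smul (μ := coneMeasure) hm (fun x => f (G.map x))
  refine Eq.trans ?_ this.symm
  refine integral_congr_ae (ae_of_all _ fun x => ?_)
  simp only [NNReal.smul_def, Real.coe_toNNReal _ (G.density_pos x).le, Complex.real_smul]

/-- The substitution `k ↦ k/a` in `k dk` produces `a⁻²`, equal to the product of the two phases, so
the scale cancels; the remaining `w²` is the Jacobian of the base map. -/
theorem twoPointForm_pull (ψ χ : TestSpace) :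
    twoPointForm (G.pull ψ) (G.pull χ) = twoPointForm ψ χ := by
  rw [twoPointForm_eq_integral, twoPointForm_eq_integral,
    ← G.dual.integral_map (integrable_twoPointForm ψ χ).aestronglyMeasurable]
  refine integral_congr_ae ?_
  have h2 := measurePreserving_reflect.quasiMeasurePreserving.ae_eq_comp (G.vFourier_pull χ)
  filter_upwards [G.vFourier_pull ψ, h2] with x e1 e2
  have e2' : vFourier (G.pull χ).1.1 (-x.1, x.2) = (G.weight x.2 : ℂ) * (G.phase (-x.1, x.2)
    * vFourier χ.1.1 (G.dual.map (-x.1, x.2))) := e2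
  have e3 : G.dual.map (-x.1, x.2) = (-(G.dual.map x).1, (G.dual.map x).2) := by
    simp [map, dual]
  have e4 : posFreq (G.dual.map x) = posFreq x := by
    have : 0 < (G.dual.map x).1 ↔ 0 < x.1 := by
      simp only [map, dual, add_zero]
      exact mul_pos_iff_of_pos_left (inv_pos.2 (G.scale_pos _))
    unfold posFreq
    simp only [this]
  have e5 : ((G.dual.map x).1 : ℂ) = (G.scale x.2 : ℂ)⁻¹ * x.1 := by
    simp [map, dual]
  have e6 : (G.dual.density x : ℂ) = (G.scale x.2 : ℂ)⁻¹ * (G.weight x.2 : ℂ) ^ 2 := by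
    simp [density, dual]
  have e7 := G.phase_mul_phase x
  rw [e1, e2', e3, e4, e5, e6]
  push_cast at e7
  linear_combination (4 * Real.pi * posFreq x * x.1 * (G.weight x.2 : ℂ) ^ 2
    * vFourier ψ.1.1 (G.dual.map x) * vFourier χ.1.1 (-(G.dual.map x).1, (G.dual.map x).2)) * e7

/-- The symplectic form is recovered from `ω` by antisymmetrisation, so it is invariant as well. -/
lemma sympl_pull (ψ χ : TestSpace) : sympl (G.pull ψ) (G.pull χ) = sympl ψ χ := by
  have h := twoPointForm_comm (G.pull ψ) (G.pull χ)
  rw [twoPointForm_pull, twoPointForm_pull, twoPointForm_comm] at h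
  exact (mul_left_cancel₀ Complex.I_ne_zero h).symm

end ConeMap

/-- Uniqueness of the action of an invertible transformation. -/
lemma Implements.unique {g : Cone → Cone} {w : Cone → ℝ} {U U' : TestSpace →ₗ[ℂ] TestSpace}
    (h : Implements g w U) (h' : Implements g w U') (G : ConeMap) (hG : ∀ x, g (G.map x) = x) :
    U = U' := by
  refine LinearMap.ext fun ψ => toL2_injective (Lp.ext ?_)
  filter_upwards [G.quasiMeasurePreserving.ae (h ψ), G.quasiMeasurePreserving.ae (h' ψ)]
    with x h1 h2
  rw [hG] at h1 h2
  rw [h1, h2]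

/-- Mutually inverse transformations. -/
structure ConeMap.IsInverse (H G : ConeMap) : Prop where
  right_inv : ∀ x, H.map (G.map x) = x
  left_inv : ∀ x, G.map (H.map x) = x
  weight : ∀ s, H.weight s * G.weight (H.base s) = 1

namespace ConeMap.IsInverse

variable {H G : ConeMap}

lemma symm (h : H.IsInverse G) : G.IsInverse H where
  right_inv := h.left_inv
  left_inv := h.right_inv
  weight s := by
    have h1 := congrArg Prod.snd (h.right_inv (0, s))
    have h2 := h.weight (G.base s)
    have h3 : H.base (G.base s) = s := h1
    rwa [h3, mul_comm] at h2

lemma implements (h : H.IsInverse G) : Implements H.map (fun x => (H.weight x.2)⁻¹) G.pull := by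
  intro ψ
  filter_upwards [H.quasiMeasurePreserving.ae (G.coeFn_pull ψ)] with x hx
  rw [hx, h.left_inv]
  congr 2
  exact eq_inv_of_mul_eq_one_right (h.weight x.2)

lemma pull_pull (h : H.IsInverse G) (ψ : TestSpace) : G.pull (H.pull ψ) = ψ := by
  refine toL2_injective (Lp.ext ?_)
  filter_upwards [G.quasiMeasurePreserving.ae (H.coeFn_pull ψ), G.coeFn_pull (H.pull ψ)]
    with x h1 h2
  rw [h2, h1, h.right_inv, ← mul_assoc]
  have : (G.weight x.2 : ℂ) * (H.weight (G.map x).2 : ℂ) = 1 := by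
    exact_mod_cast h.symm.weight x.2
  rw [this, one_mul]

lemma eq_pull (h : H.IsInverse G) {U : TestSpace →ₗ[ℂ] TestSpace}
    (hU : Implements H.map (fun x => (H.weight x.2)⁻¹) U) : U = G.pull :=
  hU.unique h.implements G h.right_inv

/-- The transformed functional is again quasi-free with the same two-point function, hence equals
`Ω` by uniqueness. -/
theorem isInvariantUnder (h : H.IsInverse G) {Ω : FieldAlg TestSpace →ₗ[ℂ] ℂ}
    (hΩ : IsQuasiFree sympl (fun ψ χ => twoPointForm ψ χ) Ω) :
    IsInvariantUnder Ω H.map (fun x => (H.weight x.2)⁻¹) := by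
  refine ⟨⟨G.pull, h.implements, fun U hU => h.eq_pull hU⟩, fun U hU => ?_⟩
  rw [h.eq_pull hU]
  refine ⟨bijective_secondQuant (Function.bijective_iff_has_inverse.2
    ⟨H.pull, h.symm.pull_pull, h.pull_pull⟩), secondQuant_starProd _ G.sympl_pull,
    secondQuant_starOp _ G.pull_conjTest, fun F => ?_⟩
  have h1 := hΩ.comp G.pull G.sympl_pull G.twoPointForm_pull
  exact LinearMap.congr_fun (h1.unique hΩ) F

end ConeMap.IsInverse

/-- The translations. -/
def translateMap (t : ℝ) : ConeMap where
  base := id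
  scale _ := 1
  shift _ := t
  weight _ := 1
  continuous_base := continuous_id
  continuous_scale := continuous_const
  continuous_shift := continuous_const
  continuous_weight := continuous_const
  scale_pos _ := one_pos
  weight_pos _ := one_pos
  lintegral_base f _ := by simp

lemma translateMap_map (t : ℝ) : (translateMap t).map = translate t := by
  funext x
  simp [ConeMap.map, translateMap, translate]

lemma isInverse_translateMap (t : ℝ) : (translateMap t).IsInverse (translateMap (-t)) where
  right_inv x := by simp [translateMap_map, translate]
  left_inv x := by simp [translateMap_map, translate]
  weight s := by simp [translateMap]

/-! ### The spectrum condition. -/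

section Spectrum

open scoped FourierTransform

/-- Superpositions of oscillations `t ↦ exp(i λ t)` with `λ ≥ 0`. -/
def IsPositiveSpectral (φ : ℝ → ℂ) : Prop :=
  ∃ (X : Type) (_ : MeasurableSpace X) (μ : Measure X) (_ : SFinite μ) (c : X → ℂ) (lam : X → ℝ),
    Integrable c μ ∧ Measurable lam ∧ (∀ x, 0 ≤ lam x) ∧
    ∀ t, φ t = ∫ x, c x * Complex.exp (((lam x * t : ℝ) : ℂ) * Complex.I) ∂μ

/-- The positive spectral functions, as a multiplicative monoid. -/
def positiveSpectral : Submonoid (ℝ → ℂ) where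
  carrier := {φ | IsPositiveSpectral φ}
  one_mem' := ⟨Unit, inferInstance, Measure.dirac (), inferInstance, fun _ => 1, fun _ => 0,
    integrable_const _, measurable_const, fun _ => le_rfl, fun t => by simp⟩
  mul_mem' := by
    rintro φ φ' ⟨X, _, μ, _, c, lam, hc, hm, h0, h⟩ ⟨X', _, μ', _, c', lam', hc', hm', h0', h'⟩
    -- In a product of superpositions the frequencies add and so stay nonnegative.
    refine ⟨X × X', inferInstance, μ.prod μ', inferInstance, fun x => c x.1 * c' x.2,
      fun x => lam x.1 + lam' x.2, hc.mul_prod hc',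
      (hm.comp measurable_fst).add (hm'.comp measurable_snd), fun x => add_nonneg (h0 _) (h0' _),
      fun t => ?_⟩
    rw [Pi.mul_apply, h, h', ← integral_prod_mul]
    refine integral_congr_ae (ae_of_all _ fun x => ?_)
    simp only
    rw [mul_mul_mul_comm, ← Complex.exp_add]
    congr 2
    push_cast
    ring

lemma norm_phase_mul (c : ℂ) (r : ℝ) : ‖c * Complex.exp ((r : ℂ) * Complex.I)‖ = ‖c‖ := by
  rw [norm_mul, Complex.norm_exp_ofReal_mul_I, mul_one]

/-- The Fourier transform in the normalisation without `2π`. -/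
def angularFourier (f : ℝ → ℂ) (t : ℝ) : ℂ := ∫ p : ℝ, Complex.exp (-Complex.I * t * p) * f p

lemma angularFourier_eq (f : ℝ → ℂ) (t : ℝ) : angularFourier f t = 𝓕 f (t / (2 * Real.pi)) := by
  rw [Real.fourier_real_eq_integral_exp_smul]
  refine integral_congr_ae (ae_of_all _ fun p => ?_)
  have hpi : (Real.pi : ℂ) ≠ 0 := Complex.ofReal_ne_zero.2 Real.pi_ne_zero
  simp only [smul_eq_mul]
  congr 2
  push_cast
  field_simp

lemma integrable_angularFourier {f : ℝ → ℂ} (hf : ContDiff ℝ ∞ f) (hs : HasCompactSupport f) :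
    Integrable (angularFourier f) := by
  have h : Integrable (𝓕 f) := (𝓕 (hs.toSchwartzMap hf)).integrable
  have h2 := h.comp_div (g := 𝓕 f) (R := 2 * Real.pi) (by positivity)
  exact h2.congr (ae_of_all _ fun t => (angularFourier_eq f t).symm)

lemma integral_angularFourier_mul_exp {f : ℝ → ℂ} (hf : ContDiff ℝ ∞ f) (hs : HasCompactSupport f)
    (l : ℝ) : ∫ t, angularFourier f t * Complex.exp (((l * t : ℝ) : ℂ) * Complex.I)
      = 2 * Real.pi * f l := by
  have h : Integrable (𝓕 f) := (𝓕 (hs.toSchwartzMap hf)).integrable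
  have h1 := congrFun (hf.continuous.fourierInv_fourier_eq
    (hf.continuous.integrable_of_hasCompactSupport hs) h) l
  rw [Real.fourierInv_eq'] at h1
  let g : ℝ → ℂ := fun v => Complex.exp (((2 * Real.pi * (v * l) : ℝ) : ℂ) * Complex.I) * 𝓕 f v
  have h2 : ∫ v, g v = f l := by
    rw [← h1]
    refine integral_congr_ae (ae_of_all _ fun v => ?_)
    simp only [g, smul_eq_mul]
    congr 3
    simp [mul_comm]
  have h3 : ∫ t, angularFourier f t * Complex.exp (((l * t : ℝ) : ℂ) * Complex.I)
      = ∫ t, g (t / (2 * Real.pi)) := by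
    refine integral_congr_ae (ae_of_all _ fun t => ?_)
    simp only [g]
    rw [angularFourier_eq, mul_comm]
    congr 3
    push_cast
    have hpi : (Real.pi : ℂ) ≠ 0 := Complex.ofReal_ne_zero.2 Real.pi_ne_zero
    field_simp
  rw [h3, Measure.integral_comp_div, h2, abs_of_pos (by positivity), Complex.real_smul]
  push_cast
  ring

lemma IsPositiveSpectral.continuous {φ : ℝ → ℂ} (h : IsPositiveSpectral φ) : Continuous φ := by
  obtain ⟨X, _, μ, _, c, lam, hc, hm, h0, h⟩ := h
  have : φ = fun t => ∫ x, c x * Complex.exp (((lam x * t : ℝ) : ℂ) * Complex.I) ∂μ := funext h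
  rw [this]
  refine continuous_of_dominated (bound := fun x => ‖c x‖) (fun t => ?_) (fun t => ?_) hc.norm
    (ae_of_all _ fun x => by fun_prop)
  · exact hc.aestronglyMeasurable.mul (by fun_prop)
  · exact ae_of_all _ fun x => (norm_phase_mul _ _).le

lemma IsPositiveSpectral.bounded {φ : ℝ → ℂ} (h : IsPositiveSpectral φ) : ∃ B, ∀ t, ‖φ t‖ ≤ B := by
  obtain ⟨X, _, μ, _, c, lam, hc, hm, h0, h⟩ := h
  refine ⟨∫ x, ‖c x‖ ∂μ, fun t => ?_⟩
  rw [h]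
  refine (norm_integral_le_integral_norm _).trans (le_of_eq ?_)
  simp only [norm_phase_mul]

/-- After exchanging the integrals, Fourier inversion evaluates the inner one to `2π f(λ)` with `λ ≥
0`, which lies outside the support of `f`. -/
lemma IsPositiveSpectral.integral_eq_zero {φ : ℝ → ℂ} (h : IsPositiveSpectral φ) {f : ℝ → ℂ}
    (hf : ContDiff ℝ ∞ f) (hs : HasCompactSupport f) (hneg : tsupport f ⊆ Iio 0) :
    ∫ t, angularFourier f t * φ t = 0 := by
  obtain ⟨X, _, μ, _, c, lam, hc, hm, h0, h⟩ := h
  have hi := integrable_angularFourier hf hs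
  have hG : Integrable (fun p : ℝ × X => angularFourier f p.1
      * (c p.2 * Complex.exp (((lam p.2 * p.1 : ℝ) : ℂ) * Complex.I))) (volume.prod μ) := by
    refine ((hi.mul_prod hc).bdd_mul (c := 1) (f := fun p : ℝ × X =>
      Complex.exp (((lam p.2 * p.1 : ℝ) : ℂ) * Complex.I)) ?_ (ae_of_all _ fun y => ?_)).congr
      (ae_of_all _ fun p => ?_)
    · have : Measurable fun p : ℝ × X => lam p.2 := hm.comp measurable_snd
      exact Measurable.aestronglyMeasurable (by fun_prop)
    · rw [Complex.norm_exp_ofReal_mul_I]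
    · simp only
      ring
  simp only [h, ← integral_const_mul]
  rw [integral_integral_swap hG]
  refine integral_eq_zero_of_ae (ae_of_all _ fun x => ?_)
  have e : ∀ t : ℝ, angularFourier f t * (c x * Complex.exp (((lam x * t : ℝ) : ℂ) * Complex.I))
      = c x * (angularFourier f t * Complex.exp (((lam x * t : ℝ) : ℂ) * Complex.I)) := by
    intro t
    ring
  simp only [e]
  rw [integral_const_mul, integral_angularFourier_mul_exp hf hs]
  have hz : f (lam x) = 0 := image_eq_zero_of_notMem_tsupport fun hx =>
    absurd (hneg hx) (not_lt.2 (h0 x))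
  rw [hz]
  simp

/-- The generating set is a monoid, so its algebra is its linear span, and the three properties pass
to linear combinations. -/
theorem spectral_of_mem_adjoin {φ : ℝ → ℂ} (h : φ ∈ Algebra.adjoin ℂ (positiveSpectral : Set (ℝ → ℂ))) :
    Continuous φ ∧ (∃ B, ∀ t, ‖φ t‖ ≤ B) ∧ ∀ f : ℝ → ℂ, ContDiff ℝ ∞ f → HasCompactSupport f →
      tsupport f ⊆ Iio 0 → ∫ t, angularFourier f t * φ t = 0 := by
  rw [← Subalgebra.mem_toSubmodule, Algebra.adjoin_eq_span, Submonoid.closure_eq] at h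
  induction h using Submodule.span_induction with
  | mem φ h =>
    have h' : IsPositiveSpectral φ := h
    exact ⟨h'.continuous, h'.bounded, fun f hf hs hn => h'.integral_eq_zero hf hs hn⟩
  | zero => exact ⟨continuous_const, ⟨0, by simp⟩, by simp⟩
  | add φ φ' _ _ h h' =>
    obtain ⟨hc, ⟨B, hB⟩, hi⟩ := h
    obtain ⟨hc', ⟨B', hB'⟩, hi'⟩ := h'
    refine ⟨hc.add hc', ⟨B + B', fun t => norm_add_le_of_le (hB t) (hB' t)⟩, fun f hf hs hn => ?_⟩
    have hF := integrable_angularFourier hf hs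
    have e1 : Integrable fun t => angularFourier f t * φ t :=
      hF.mul_bdd hc.aestronglyMeasurable (ae_of_all _ hB)
    have e2 : Integrable fun t => angularFourier f t * φ' t :=
      hF.mul_bdd hc'.aestronglyMeasurable (ae_of_all _ hB')
    simp only [Pi.add_apply, mul_add]
    rw [integral_add e1 e2, hi f hf hs hn, hi' f hf hs hn, add_zero]
  | smul a φ _ h =>
    obtain ⟨hc, ⟨B, hB⟩, hi⟩ := h
    refine ⟨hc.const_smul a, ⟨‖a‖ * B, fun t => ?_⟩, fun f hf hs hn => ?_⟩
    · rw [Pi.smul_apply, norm_smul]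
      exact mul_le_mul_of_nonneg_left (hB t) (norm_nonneg _)
    · simp only [Pi.smul_apply, smul_eq_mul, mul_left_comm _ a]
      rw [integral_const_mul, hi f hf hs hn, mul_zero]

lemma isPositiveSpectral_twoPointForm (ψ χ : TestSpace) :
    IsPositiveSpectral fun t => twoPointForm ψ ((translateMap (-t)).pull χ) := by
  -- Translation multiplies `χ̂(-k)` by `exp(2πikt)`. The maximum makes the frequency nonnegative
  -- everywhere; for `k ≤ 0` the coefficient vanishes.
  refine ⟨Cone, inferInstance, coneMeasure, inferInstance, _, fun x => 2 * Real.pi * max x.1 0,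
    integrable_twoPointForm ψ χ, by fun_prop, fun x => by positivity, fun t => ?_⟩
  refine (twoPointForm_eq_integral _ _).trans (integral_congr_ae ?_)
  have h2 := measurePreserving_reflect.quasiMeasurePreserving.ae_eq_comp
    ((translateMap (-t)).vFourier_pull χ)
  filter_upwards [h2] with x e2
  have e2' : vFourier ((translateMap (-t)).pull χ).1.1 (-x.1, x.2)
      = ((1 : ℝ) : ℂ) * ((translateMap (-t)).phase (-x.1, x.2)
        * vFourier χ.1.1 ((translateMap (-t)).dual.map (-x.1, x.2))) := e2
  have e3 : (translateMap (-t)).dual.map (-x.1, x.2) = (-x.1, x.2) := by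
    simp [ConeMap.map, ConeMap.dual, translateMap]
  rw [e2', e3, posFreq]
  split_ifs with hx
  · rw [max_eq_left hx.le]
    have e4 : (translateMap (-t)).phase (-x.1, x.2)
        = Complex.exp (((2 * Real.pi * x.1 * t : ℝ) : ℂ) * Complex.I) := by
      simp [ConeMap.phase, translateMap]
    rw [e4]
    push_cast
    ring
  · simp

lemma isVacuum_of_isWickMap {S : FieldAlg TestSpace →ₗ[ℂ] FieldAlg TestSpace}
    (hS : IsWickMap (symmPart twoPointForm) S)
    (hΩ : IsQuasiFree sympl (fun ψ χ => twoPointForm ψ χ) (vacuumPart.toLinearMap ∘ₗ S)) :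
    IsVacuum (vacuumPart.toLinearMap ∘ₗ S) := by
  refine ⟨fun t => ?_, fun U hU F G => ?_⟩
  · have h := (isInverse_translateMap t).isInvariantUnder hΩ
    rw [translateMap_map] at h
    simpa [translateMap] using h
  · have hU' : U = fun t => (translateMap (-t)).pull := by
      funext t
      refine (isInverse_translateMap t).eq_pull ?_
      rw [translateMap_map]
      simpa [translateMap] using hU t
    rw [hU']
    exact spectral_of_mem_adjoin (hS.mem_adjoin isTwoPointForm_twoPointForm
      (fun t => ConeMap.twoPointForm_pull _)
      (fun ψ χ => Algebra.subset_adjoin (isPositiveSpectral_twoPointForm ψ χ)) F G)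

end Spectrum

/-! ### The functions `h f` are test functions. -/

section ConeTest

lemma coneFun_eq_indicator (k : ℝ × E3 → ℝ) (g : ℝ × E3 → ℂ) :
    coneFun k g = {x : Cone | 0 < x.1}.indicator fun x => (k (incl x) : ℂ) * g (incl x) := by
  funext x
  unfold coneFun
  by_cases hx : 0 < x.1
  · rw [if_pos hx, indicator_of_mem (show x ∈ {x : Cone | 0 < x.1} from hx)]
  · rw [if_neg hx, indicator_of_notMem (show x ∉ {x : Cone | 0 < x.1} from hx)]

lemma isOpen_halfSpace : IsOpen (Ioi (0 : ℝ) ×ˢ (univ : Set E3)) := isOpen_Ioi.prod isOpen_univ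

/-- Near `V = 0` the factor `k` is bounded by hypothesis, away from it by compactness, and `g`
confines everything to a set of finite measure. -/
lemma memLp_coneFun {k : ℝ × E3 → ℝ} {g : ℝ × E3 → ℂ}
    (hk : ContinuousOn k (Ioi 0 ×ˢ univ)) {C : ℝ}
    (hC : ∀ᶠ V in 𝓝[>] (0 : ℝ), ∀ s : S2, |k (V, (s : E3))| ≤ C)
    (hg : Continuous g) (hgs : HasCompactSupport g) : MemLp (coneFun k g) 2 coneMeasure := by
  obtain ⟨δ, hδ, hb⟩ := mem_nhdsGT_iff_exists_Ioo_subset.1 hC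
  have hδ0 : 0 < δ := hδ
  obtain ⟨R, hR⟩ := hgs.isCompact.isBounded.exists_norm_le
  have hg0 : ∀ x : Cone, |R| < |x.1| → g (incl x) = 0 := by
    intro x hx
    refine image_eq_zero_of_notMem_tsupport fun h => ?_
    have h1 : |x.1| ≤ ‖incl x‖ := norm_fst_le (incl x)
    linarith [hR _ h, le_abs_self R]
  obtain ⟨M, hM⟩ := hgs.exists_bound_of_continuous hg
  have hcomp : IsCompact (Icc δ (max δ |R|) ×ˢ Metric.sphere (0 : E3) 1) :=
    isCompact_Icc.prod (isCompact_sphere 0 1)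
  obtain ⟨C', hC'⟩ := hcomp.exists_bound_of_continuousOn (hk.mono fun y hy =>
    ⟨lt_of_lt_of_le hδ0 hy.1.1, mem_univ _⟩)
  have hincl := isClosedEmbedding_incl.continuous
  have hE : MeasurableSet {x : Cone | 0 < x.1} := measurableSet_lt measurable_const measurable_fst
  have hm : AEStronglyMeasurable (coneFun k g) coneMeasure := by
    rw [coneFun_eq_indicator]
    refine (aestronglyMeasurable_indicator_iff hE).2 (ContinuousOn.aestronglyMeasurable ?_ hE)
    refine ContinuousOn.mul (Complex.continuous_ofReal.comp_continuousOn
      (hk.comp hincl.continuousOn fun x hx => ⟨hx, mem_univ _⟩)) (hg.comp hincl).continuousOn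
  have hfin : coneMeasure (Icc (-|R|) |R| ×ˢ univ) ≠ ⊤ := by
    rw [Measure.prod_prod]
    exact ENNReal.mul_ne_top (by simp) (measure_ne_top _ _)
  have hms : MeasurableSet (Icc (-|R|) |R| ×ˢ (univ : Set S2)) :=
    measurableSet_Icc.prod MeasurableSet.univ
  refine MemLp.of_le (g := (Icc (-|R|) |R| ×ˢ (univ : Set S2)).indicator
    fun _ => (max |C| |C'| * |M| : ℝ)) (memLp_indicator_const 2 hms _ (Or.inr hfin)) hm
    (ae_of_all _ fun x => ?_)
  by_cases hx : |x.1| ≤ |R|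
  · rw [indicator_of_mem (show x ∈ Icc (-|R|) |R| ×ˢ (univ : Set S2) from ⟨abs_le.1 hx, mem_univ _⟩),
      Real.norm_of_nonneg (by positivity)]
    unfold coneFun
    split_ifs with h0
    · rw [norm_mul, Complex.norm_real]
      refine mul_le_mul ?_ ((hM _).trans (le_abs_self M)) (norm_nonneg _) (by positivity)
      by_cases hd : x.1 < δ
      · exact ((hb ⟨h0, hd⟩ x.2).trans (le_abs_self C)).trans (le_max_left _ _)
      · refine ((hC' (incl x) ⟨⟨not_lt.1 hd, ?_⟩, x.2.2⟩).trans (le_abs_self C')).trans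
          (le_max_right _ _)
        exact ((le_abs_self _).trans hx).trans (le_max_right _ _)
    · rw [norm_zero]
      positivity
  · rw [coneFun, hg0 x (not_le.1 hx)]
    simp

lemma hasDerivAt_slice {F : Type*} [NormedAddCommGroup F] [NormedSpace ℝ F] {k : ℝ × E3 → F}
    {V : ℝ} {s : E3} (hk : DifferentiableAt ℝ k (V, s)) :
    HasDerivAt (fun v => k (v, s)) (fderiv ℝ k (V, s) (1, 0)) V := by
  have h1 : HasDerivAt (fun V : ℝ => (V, s)) ((1 : ℝ), (0 : E3)) V :=
    (hasDerivAt_id V).prodMk (hasDerivAt_const V s)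
  exact hk.hasFDerivAt.comp_hasDerivAt V h1

/-- The functions `h f` are test functions. -/
theorem exists_mem_coneTest {h : ℝ × E3 → ℝ} (hh : IsConeWeight h) {f : ℝ × E3 → ℂ}
    (hf : ContDiff ℝ ∞ f) (hfs : HasCompactSupport f) :
    ∃ ψ ∈ coneTest h, (toL2 ψ : Cone → ℂ) =ᵐ[coneMeasure] coneFun h f := by
  let dh : ℝ × E3 → ℝ := fun y => fderiv ℝ h y (1, 0)
  let df : ℝ × E3 → ℂ := fun y => fderiv ℝ f y (1, 0)
  have hdf : Continuous df := (hf.continuous_fderiv (by simp)).clm_apply continuous_const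
  have hdfs : HasCompactSupport df := hfs.fderiv_apply ℝ (1, 0)
  have hdh : ContinuousOn dh (Ioi 0 ×ˢ univ) :=
    (hh.smooth.continuousOn_fderiv_of_isOpen isOpen_halfSpace (by simp)).clm_apply
      continuousOn_const
  have hdiff : ∀ (V : ℝ) (s : E3), 0 < V → DifferentiableAt ℝ h (V, s) := fun V s hV =>
    (hh.smooth.differentiableOn (by simp)).differentiableAt
      (isOpen_halfSpace.mem_nhds ⟨hV, mem_univ _⟩)
  have hb : ∀ᶠ V in 𝓝[>] (0 : ℝ), ∀ s : S2, |h (V, (s : E3))| ≤ 1 := by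
    filter_upwards [Metric.tendstoUniformly_iff.1 hh.vanish 1 one_pos] with V hV s
    have := (hV s).le
    rwa [dist_comm, Real.dist_eq, sub_zero] at this
  obtain ⟨c, hc⟩ := hh.deriv_tendsto 1 le_rfl
  have hb' : ∀ᶠ V in 𝓝[>] (0 : ℝ), ∀ s : S2, |dh (V, (s : E3))| ≤ |c| + 1 := by
    filter_upwards [Metric.tendstoUniformly_iff.1 hc 1 one_pos, self_mem_nhdsWithin] with V hV h0 s
    have h1 := hV s
    rw [iteratedDeriv_one, (hasDerivAt_slice (hdiff V s h0)).deriv, dist_comm, Real.dist_eq] at h1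
    have h2 : |dh (V, (s : E3))| - |c| ≤ |dh (V, (s : E3)) - c| := abs_sub_abs_le_abs_sub _ _
    have h3 : |dh (V, (s : E3)) - c| < 1 := h1
    linarith
  have m1 := memLp_coneFun hh.smooth.continuousOn hb hf.continuous hfs
  have m2 := (memLp_coneFun hdh hb' hf.continuous hfs).add
    (memLp_coneFun hh.smooth.continuousOn hb hdf hdfs)
  have hd : ∀ (s : S2) (V : ℝ), V ≠ 0 → HasDerivAt (fun V => coneFun h f (V, s))
      ((coneFun dh f + coneFun h df) (V, s)) V := by
    intro s V hV
    rcases lt_or_gt_of_ne hV with h0 | h0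
    · have e : (coneFun dh f + coneFun h df) (V, s) = 0 := by
        simp [coneFun, not_lt.2 h0.le]
      rw [e]
      refine (hasDerivAt_const V (0 : ℂ)).congr_of_eventuallyEq ?_
      filter_upwards [Iio_mem_nhds h0] with W hW
      have : ¬ 0 < W := not_lt.2 (le_of_lt hW)
      simp [coneFun, this]
    · have e : (coneFun dh f + coneFun h df) (V, s)
          = ((dh (V, (s : E3)) : ℝ) : ℂ) * f (V, (s : E3))
            + (h (V, (s : E3)) : ℂ) * df (V, (s : E3)) := by
        simp [coneFun, h0, incl]
      rw [e]
      have h1 := (hasDerivAt_slice (hdiff V s h0)).ofReal_comp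
      have h2 := hasDerivAt_slice (hf.differentiable (by simp) (V, (s : E3)))
      refine (h1.mul h2).congr_of_eventuallyEq ?_
      filter_upwards [Ioi_mem_nhds h0] with W hW
      have : 0 < W := hW
      simp [coneFun, this, incl]
  -- The vanishing of `h` at `V = 0` makes the extension by zero continuous, so that the weak
  -- derivative has no delta term there.
  have hcont : ∀ s : S2, Continuous fun V => coneFun h f (V, s) := by
    intro s
    refine continuous_iff_continuousAt.2 fun V => ?_
    rcases eq_or_ne V 0 with rfl | hV
    · have e : coneFun h f (0, s) = 0 := by simp [coneFun]
      rw [ContinuousAt, e]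
      have h1 : Tendsto (fun V => h (V, (s : E3))) (𝓝[>] 0) (𝓝 0) := hh.vanish.tendsto_at s
      have h2 : Tendsto (fun V : ℝ => f (V, (s : E3))) (𝓝[>] 0) (𝓝 (f (0, (s : E3)))) :=
        ((hf.continuous.comp (by fun_prop : Continuous fun V : ℝ => (V, (s : E3)))).tendsto
          0).mono_left nhdsWithin_le_nhds
      have h3 : Tendsto (fun V => coneFun h f (V, s)) (𝓝[>] 0) (𝓝 0) := by
        have h4 := (Complex.continuous_ofReal.tendsto 0 |>.comp h1).mul h2
        simp only [Complex.ofReal_zero, zero_mul] at h4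
        refine h4.congr' ?_
        filter_upwards [self_mem_nhdsWithin] with W hW
        have : 0 < W := hW
        simp [coneFun, this, incl]
      have h5 : Tendsto (fun V => coneFun h f (V, s)) (𝓝[≤] 0) (𝓝 0) := by
        refine tendsto_const_nhds.congr' ?_
        filter_upwards [self_mem_nhdsWithin] with W hW
        have : ¬ 0 < W := not_lt.2 hW
        simp [coneFun, this]
      have := h5.sup h3
      rwa [nhdsLE_sup_nhdsGT] at this
    · exact (hd s V hV).continuousAt
  refine ⟨⟨(m1.toLp _, m2.toLp _), isWeakVDeriv_of_hasDerivAt m1 m2 hcont hd⟩,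
    ⟨f, hf, hfs, m1.coeFn_toLp⟩, m1.coeFn_toLp⟩

end ConeTest

/-! ### Transformations preserving `𝒮(𝒞_p)` for `h = V`. -/

section SmoothTransformations

/-- A smooth cutoff function around the unit sphere. -/
lemma exists_sphere_cutoff {O : Set E3} (hO : IsOpen O) (hs : Metric.sphere (0 : E3) 1 ⊆ O) :
    ∃ χ : E3 → ℝ, ContDiff ℝ ∞ χ ∧ HasCompactSupport χ ∧ tsupport χ ⊆ O ∧ ∀ s : S2, χ s = 1 := by
  obtain ⟨K, hK, hsK, hKO⟩ := exists_compact_between (isCompact_sphere (0 : E3) 1) hO hs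
  obtain ⟨χ, h1, h0, -⟩ := exists_contMDiffMap_one_nhds_of_subset_interior (n := (⊤ : ℕ∞))
    (modelWithCornersSelf ℝ E3) (Metric.isClosed_sphere (x := (0 : E3)) (ε := 1)) hsK
  have hsub : tsupport χ ⊆ K := closure_minimal (fun x hx => by
    by_contra hxK
    exact hx (h0 x hxK)) hK.isClosed
  exact ⟨χ, χ.contMDiff.contDiff, hK.of_isClosed_subset (isClosed_tsupport _) hsub,
    hsub.trans hKO, fun s => h1.self_of_nhdsSet s s.2⟩

/-- A smooth extension of a fibrewise linear transformation to a neighbourhood of the sphere. -/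
structure ConeMap.SmoothExtension (G : ConeMap) where
  dom : Set E3
  scale : E3 → ℝ
  weight : E3 → ℝ
  base : E3 → E3
  isOpen_dom : IsOpen dom
  sphere_subset : Metric.sphere (0 : E3) 1 ⊆ dom
  contDiffOn_scale : ContDiffOn ℝ ∞ scale dom
  contDiffOn_weight : ContDiffOn ℝ ∞ weight dom
  contDiffOn_base : ContDiffOn ℝ ∞ base dom
  scale_pos : ∀ x ∈ dom, 0 < scale x
  scale_eq : ∀ s : S2, scale s = G.scale s
  weight_eq : ∀ s : S2, weight s = G.weight s
  base_eq : ∀ s : S2, base s = G.base s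
  shift_eq : ∀ s : S2, G.shift s = 0

lemma ConeMap.SmoothExtension.pull_mem {G : ConeMap} (e : G.SmoothExtension) {ψ : TestSpace}
    (hψ : ψ ∈ coneTest fun y => y.1) : G.pull ψ ∈ coneTest fun y => y.1 := by
  obtain ⟨f, hf, hfs, hfa⟩ := hψ
  obtain ⟨χ, hχ, hχs, hχd, hχ1⟩ := exists_sphere_cutoff e.isOpen_dom e.sphere_subset
  let m : E3 → ℂ := fun r => ((χ r * (e.weight r * e.scale r) : ℝ) : ℂ)
  -- On the cone `w · (aV) f(aV, θ) = V · (w a f(aV, θ))`, so the scale factor moves from the weight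
  -- function into `f'`; the cutoff extends it smoothly to `ℝ⁴`.
  let f' : ℝ × E3 → ℂ := fun y => m y.2 * f (e.scale y.2 * y.1, e.base y.2)
  have hm0 : ∀ r, r ∉ tsupport χ → m r = 0 := by
    intro r hr
    simp only [m]
    rw [image_eq_zero_of_notMem_tsupport hr]
    simp
  have hsm : ContDiff ℝ ∞ f' := by
    refine contDiff_iff_contDiffAt.2 fun y => ?_
    by_cases hy : y.2 ∈ tsupport χ
    · have hd := e.isOpen_dom.mem_nhds (hχd hy)
      have h1 : ContDiffAt ℝ ∞ (fun y : ℝ × E3 => e.scale y.2) y :=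
        (e.contDiffOn_scale.contDiffAt hd).comp y contDiffAt_snd
      have h2 : ContDiffAt ℝ ∞ (fun y : ℝ × E3 => e.weight y.2) y :=
        (e.contDiffOn_weight.contDiffAt hd).comp y contDiffAt_snd
      have h3 : ContDiffAt ℝ ∞ (fun y : ℝ × E3 => e.base y.2) y :=
        (e.contDiffOn_base.contDiffAt hd).comp y contDiffAt_snd
      have h4 : ContDiffAt ℝ ∞ (fun y : ℝ × E3 => χ y.2) y := hχ.contDiffAt.comp y contDiffAt_snd
      refine ContDiffAt.mul ?_ ?_
      · exact Complex.ofRealCLM.contDiff.contDiffAt.comp y (h4.mul (h2.mul h1))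
      · exact hf.contDiffAt.comp y ((h1.mul contDiffAt_fst).prodMk h3)
    · have : f' =ᶠ[𝓝 y] fun _ => 0 := by
        have ho : IsOpen {y : ℝ × E3 | y.2 ∉ tsupport χ} :=
          (isClosed_tsupport χ).isOpen_compl.preimage continuous_snd
        filter_upwards [ho.mem_nhds hy] with z hz
        simp only [f']
        rw [hm0 _ hz, zero_mul]
      exact contDiffAt_const.congr_of_eventuallyEq this
  have hcs : HasCompactSupport f' := by
    obtain ⟨R, hR⟩ := hfs.isCompact.isBounded.exists_norm_le
    -- A bound on the inverse scale over the compact support of the cutoff turns the bound on `aV`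
    -- into one on `V`.
    have hcont : ContinuousOn (fun r => (e.scale r)⁻¹) (tsupport χ) :=
      (e.contDiffOn_scale.continuousOn.mono hχd).inv₀ fun r hr => (e.scale_pos r (hχd hr)).ne'
    obtain ⟨C, hC⟩ := IsCompact.exists_bound_of_continuousOn (s := tsupport χ) hχs hcont
    refine HasCompactSupport.intro ((isCompact_closedBall (0 : ℝ) (|C| * |R|)).prod
      (show IsCompact (tsupport χ) from hχs)) fun y hy => ?_
    by_cases hy2 : y.2 ∈ tsupport χ
    · have hp := e.scale_pos _ (hχd hy2)
      have hfz : f (e.scale y.2 * y.1, e.base y.2) = 0 := by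
        refine image_eq_zero_of_notMem_tsupport fun hmem => hy ⟨?_, hy2⟩
        have h1 : |e.scale y.2 * y.1| ≤ |R| :=
          ((norm_fst_le (e.scale y.2 * y.1, e.base y.2)).trans (hR _ hmem)).trans (le_abs_self R)
        have h2 : |(e.scale y.2)⁻¹| ≤ |C| := (hC _ hy2).trans (le_abs_self C)
        rw [mem_closedBall_zero_iff, Real.norm_eq_abs]
        calc |y.1| = |(e.scale y.2)⁻¹| * |e.scale y.2 * y.1| := by
              rw [← abs_mul, inv_mul_cancel_left₀ hp.ne']
          _ ≤ _ := mul_le_mul h2 h1 (abs_nonneg _) (abs_nonneg _)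
      simp only [f']
      rw [hfz, mul_zero]
    · simp only [f']
      rw [hm0 _ hy2, zero_mul]
  refine ⟨f', hsm, hcs, ?_⟩
  filter_upwards [G.coeFn_pull ψ, G.quasiMeasurePreserving.ae_eq_comp hfa] with x h1 h2
  have h2' : toL2 ψ (G.map x) = coneFun (fun y => y.1) f (G.map x) := h2
  have h3 : (G.map x).1 = e.scale x.2 * x.1 := by
    rw [ConeMap.map, e.shift_eq, add_zero, e.scale_eq]
  have h4 : ((G.map x).2 : E3) = e.base x.2 := by
    rw [e.base_eq]
    rfl
  have h5 : 0 < e.scale x.2 * x.1 ↔ 0 < x.1 := by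
    rw [e.scale_eq]
    exact mul_pos_iff_of_pos_left (G.scale_pos _)
  rw [h1, h2']
  unfold coneFun
  simp only [incl, h3, h4, f', m, hχ1, ← e.weight_eq, h5]
  split_ifs
  · push_cast
    ring
  · simp

lemma ConeMap.IsInverse.preservesConeTest {H G : ConeMap} (h : H.IsInverse G)
    (eH : H.SmoothExtension) (eG : G.SmoothExtension) :
    PreservesConeTest H.map fun x => (H.weight x.2)⁻¹ := by
  intro U hU
  rw [h.eq_pull hU]
  refine le_antisymm ?_ fun ψ hψ => ?_
  · rintro _ ⟨ψ, hψ, rfl⟩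
    exact eG.pull_mem hψ
  · exact ⟨H.pull ψ, eH.pull_mem hψ, h.pull_pull ψ⟩

end SmoothTransformations

/-! ### Lorentz matrices acting on the null cone and the celestial sphere. -/

section Lorentz

/-- The orthochronous Lorentz matrices. -/
structure IsLorentz (Λ : Matrix (Fin 4) (Fin 4) ℝ) : Prop where
  isometry : Λᵀ * minkowski * Λ = minkowski
  pos : 0 < Λ 0 0

lemma minkowski_mul_self : minkowski * minkowski = 1 := by
  rw [minkowski, Matrix.diagonal_mul_diagonal, ← Matrix.diagonal_one]
  congr 1
  funext i
  fin_cases i <;> simp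

lemma minkowski_transpose : minkowskiᵀ = minkowski := Matrix.diagonal_transpose _

/-- The inverse of a Lorentz matrix. -/
def lorentzInv (Λ : Matrix (Fin 4) (Fin 4) ℝ) : Matrix (Fin 4) (Fin 4) ℝ :=
  minkowski * Λᵀ * minkowski

/-- The null vector with given spatial part. -/
def nullExt (x : E3) : Fin 4 → ℝ := ![‖x‖, x 0, x 1, x 2]

lemma nullExt_sphere (s : S2) : nullExt s = nullVec s := by
  rw [nullExt, nullVec, mem_sphere_zero_iff_norm.1 s.2]

lemma norm_sq_E3 (x : E3) : ‖x‖ ^ 2 = x 0 ^ 2 + x 1 ^ 2 + x 2 ^ 2 := by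
  rw [EuclideanSpace.norm_sq_eq]
  simp [Fin.sum_univ_three]

lemma nullExt_smul {r : ℝ} (hr : 0 ≤ r) (x : E3) : nullExt (r • x) = r • nullExt x := by
  funext i
  fin_cases i <;> simp [nullExt, norm_smul, abs_of_nonneg hr]

/-- The spatial part of the image of the null vector with spatial part `x`. -/
def spatial (Λ : Matrix (Fin 4) (Fin 4) ℝ) (x : E3) : E3 :=
  !₂[(Λ *ᵥ nullExt x) 1, (Λ *ᵥ nullExt x) 2, (Λ *ᵥ nullExt x) 3]

lemma spatial_smul (Λ : Matrix (Fin 4) (Fin 4) ℝ) {r : ℝ} (hr : 0 ≤ r) (x : E3) :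
    spatial Λ (r • x) = r • spatial Λ x := by
  ext i
  fin_cases i <;> simp [spatial, nullExt_smul hr, Matrix.mulVec_smul]

lemma minkowski_form (v : Fin 4 → ℝ) :
    v ⬝ᵥ (minkowski *ᵥ v) = -(v 0) ^ 2 + v 1 ^ 2 + v 2 ^ 2 + v 3 ^ 2 := by
  simp [minkowski, Matrix.mulVec_diagonal, dotProduct, Fin.sum_univ_four]
  ring

namespace IsLorentz

variable {Λ : Matrix (Fin 4) (Fin 4) ℝ}

lemma inv_mul (h : IsLorentz Λ) : lorentzInv Λ * Λ = 1 := by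
  rw [lorentzInv, Matrix.mul_assoc, Matrix.mul_assoc, ← Matrix.mul_assoc Λᵀ, h.isometry,
    minkowski_mul_self]

lemma mul_inv (h : IsLorentz Λ) : Λ * lorentzInv Λ = 1 := mul_eq_one_comm.1 h.inv_mul

lemma mul_minkowski_mul (h : IsLorentz Λ) : Λ * minkowski * Λᵀ = minkowski := by
  have h1 := congrArg (· * minkowski) h.mul_inv
  simp only [lorentzInv, one_mul] at h1
  refine Eq.trans ?_ h1
  simp only [Matrix.mul_assoc, minkowski_mul_self, mul_one]

lemma inv (h : IsLorentz Λ) : IsLorentz (lorentzInv Λ) where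
  isometry := by
    have e : (lorentzInv Λ)ᵀ = minkowski * Λ * minkowski := by
      simp [lorentzInv, Matrix.transpose_mul, minkowski_transpose, Matrix.mul_assoc]
    rw [e, lorentzInv]
    calc minkowski * Λ * minkowski * minkowski * (minkowski * Λᵀ * minkowski)
        = minkowski * (Λ * (minkowski * minkowski * minkowski) * Λᵀ) * minkowski := by
          simp only [Matrix.mul_assoc]
      _ = minkowski * (Λ * minkowski * Λᵀ) * minkowski := by
          rw [minkowski_mul_self, one_mul]
      _ = minkowski := by
          rw [h.mul_minkowski_mul, minkowski_mul_self, one_mul]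
  pos := by
    have : lorentzInv Λ 0 0 = Λ 0 0 := by
      simp [lorentzInv, minkowski, Matrix.mul_diagonal, Matrix.diagonal_mul]
    rw [this]
    exact h.pos

lemma row_zero (h : IsLorentz Λ) : Λ 0 0 ^ 2 = 1 + (Λ 0 1 ^ 2 + Λ 0 2 ^ 2 + Λ 0 3 ^ 2) := by
  have h1 := congrFun (congrFun h.mul_minkowski_mul 0) 0
  simp [minkowski, Matrix.mul_apply, Fin.sum_univ_four] at h1
  linarith

/-- The first row of `Λ` is timelike by `row_zero`. Cauchy–Schwarz then makes its spatial part too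
small to cancel the positive term `Λ₀₀ ‖x‖`. -/
lemma time_pos (h : IsLorentz Λ) {x : E3} (hx : x ≠ 0) : 0 < (Λ *ᵥ nullExt x) 0 := by
  have h0 : 0 < ‖x‖ := norm_pos_iff.2 hx
  have e : (Λ *ᵥ nullExt x) 0 = Λ 0 0 * ‖x‖ + (Λ 0 1 * x 0 + Λ 0 2 * x 1 + Λ 0 3 * x 2) := by
    simp [Matrix.mulVec, dotProduct, Fin.sum_univ_four, nullExt]
    ring
  have hcs : (Λ 0 1 * x 0 + Λ 0 2 * x 1 + Λ 0 3 * x 2) ^ 2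
      ≤ (Λ 0 1 ^ 2 + Λ 0 2 ^ 2 + Λ 0 3 ^ 2) * ‖x‖ ^ 2 := by
    rw [norm_sq_E3]
    nlinarith [sq_nonneg (Λ 0 1 * x 1 - Λ 0 2 * x 0), sq_nonneg (Λ 0 1 * x 2 - Λ 0 3 * x 0),
      sq_nonneg (Λ 0 2 * x 2 - Λ 0 3 * x 1)]
  have hlt : (Λ 0 1 * x 0 + Λ 0 2 * x 1 + Λ 0 3 * x 2) ^ 2 < (Λ 0 0 * ‖x‖) ^ 2 := by
    rw [mul_pow, h.row_zero]
    nlinarith [pow_pos h0 2]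
  have := (abs_lt.1 (abs_lt_of_sq_lt_sq hlt (mul_pos h.pos h0).le)).1
  rw [e]
  linarith

lemma time_nonneg (h : IsLorentz Λ) (x : E3) : 0 ≤ (Λ *ᵥ nullExt x) 0 := by
  rcases eq_or_ne x 0 with rfl | hx
  · have : nullExt 0 = 0 := by
      funext i
      fin_cases i <;> simp [nullExt]
    simp [this]
  · exact (h.time_pos hx).le

lemma norm_spatial (h : IsLorentz Λ) (x : E3) : ‖spatial Λ x‖ = (Λ *ᵥ nullExt x) 0 := by
  have h1 : (Λ *ᵥ nullExt x) ⬝ᵥ (minkowski *ᵥ (Λ *ᵥ nullExt x))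
      = nullExt x ⬝ᵥ (minkowski *ᵥ nullExt x) := by
    conv_rhs => rw [← h.isometry]
    rw [← Matrix.mulVec_mulVec, ← Matrix.mulVec_mulVec, Matrix.dotProduct_mulVec _ Λᵀ,
      Matrix.vecMul_transpose]
  rw [minkowski_form, minkowski_form] at h1
  have h2 : -(nullExt x 0) ^ 2 + nullExt x 1 ^ 2 + nullExt x 2 ^ 2 + nullExt x 3 ^ 2 = 0 := by
    have := norm_sq_E3 x
    simp [nullExt]
    linarith
  refine (sq_eq_sq₀ (norm_nonneg _) (h.time_nonneg x)).1 ?_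
  rw [norm_sq_E3]
  simp only [spatial]
  simp
  linarith

lemma nullExt_spatial (h : IsLorentz Λ) (x : E3) : nullExt (spatial Λ x) = Λ *ᵥ nullExt x := by
  funext i
  fin_cases i
  · exact h.norm_spatial x
  all_goals simp [nullExt, spatial]

lemma spatial_inv (h : IsLorentz Λ) (x : E3) : spatial (lorentzInv Λ) (spatial Λ x) = x := by
  have e : lorentzInv Λ *ᵥ nullExt (spatial Λ x) = nullExt x := by
    rw [h.nullExt_spatial, Matrix.mulVec_mulVec, h.inv_mul, Matrix.one_mulVec]
  rw [spatial, e]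
  ext i
  fin_cases i <;> simp [nullExt]

lemma lorentzInv_lorentzInv (Λ : Matrix (Fin 4) (Fin 4) ℝ) : lorentzInv (lorentzInv Λ) = Λ := by
  simp only [lorentzInv, Matrix.transpose_mul, minkowski_transpose, Matrix.transpose_transpose,
    Matrix.mul_assoc, minkowski_mul_self, mul_one]
  rw [← Matrix.mul_assoc, minkowski_mul_self, one_mul]

lemma spatial_ne_zero (h : IsLorentz Λ) {x : E3} (hx : x ≠ 0) : spatial Λ x ≠ 0 := by
  rw [← norm_pos_iff, h.norm_spatial]
  exact h.time_pos hx

lemma boost_eq (h : IsLorentz Λ) (s : S2) : boost Λ s = ‖spatial Λ s‖ := by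
  rw [h.norm_spatial, nullExt_sphere, boost]

lemma sphere_ne_zero (s : S2) : (s : E3) ≠ 0 := by
  rw [← norm_pos_iff, mem_sphere_zero_iff_norm.1 s.2]
  exact one_pos

lemma boost_pos (h : IsLorentz Λ) (s : S2) : 0 < boost Λ s := by
  rw [h.boost_eq, norm_pos_iff]
  exact h.spatial_ne_zero (sphere_ne_zero s)

end IsLorentz

/-- The action of a Lorentz matrix on the celestial sphere. -/
def skyMap (Λ : Matrix (Fin 4) (Fin 4) ℝ) (h : IsLorentz Λ) (s : S2) : S2 :=
  ⟨(boost Λ s)⁻¹ • spatial Λ s, by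
    rw [mem_sphere_zero_iff_norm, norm_smul, ← h.boost_eq, Real.norm_of_nonneg
      (inv_nonneg.2 (h.boost_pos s).le), inv_mul_cancel₀ (h.boost_pos s).ne']⟩

namespace IsLorentz

variable {Λ : Matrix (Fin 4) (Fin 4) ℝ}

lemma spatial_eq (h : IsLorentz Λ) (s : S2) : spatial Λ s = boost Λ s • (skyMap Λ h s : E3) := by
  rw [skyMap, smul_smul, mul_inv_cancel₀ (h.boost_pos s).ne', one_smul]

lemma spatial_inv_skyMap (h : IsLorentz Λ) (s : S2) :
    spatial (lorentzInv Λ) (skyMap Λ h s) = (boost Λ s)⁻¹ • (s : E3) := by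
  rw [skyMap, spatial_smul _ (inv_nonneg.2 (h.boost_pos s).le), h.spatial_inv]

lemma boost_inv_skyMap (h : IsLorentz Λ) (s : S2) :
    boost (lorentzInv Λ) (skyMap Λ h s) = (boost Λ s)⁻¹ := by
  rw [h.inv.boost_eq, h.spatial_inv_skyMap, norm_smul, mem_sphere_zero_iff_norm.1 s.2, mul_one,
    Real.norm_of_nonneg (inv_nonneg.2 (h.boost_pos s).le)]

lemma skyMap_inv_skyMap (h : IsLorentz Λ) (s : S2) :
    skyMap (lorentzInv Λ) h.inv (skyMap Λ h s) = s := by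
  refine Subtype.ext ?_
  change (boost (lorentzInv Λ) (skyMap Λ h s))⁻¹ • spatial (lorentzInv Λ) (skyMap Λ h s) = s
  rw [h.boost_inv_skyMap, h.spatial_inv_skyMap, smul_smul, inv_inv,
    mul_inv_cancel₀ (h.boost_pos s).ne', one_smul]

lemma skyMap_skyMap_inv (h : IsLorentz Λ) (s : S2) :
    skyMap Λ h (skyMap (lorentzInv Λ) h.inv s) = s := by
  have h1 := h.inv.skyMap_inv_skyMap s
  convert h1 using 2
  · exact (lorentzInv_lorentzInv Λ).symm

lemma boost_skyMap_inv (h : IsLorentz Λ) (s : S2) :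
    boost Λ (skyMap (lorentzInv Λ) h.inv s) = (boost (lorentzInv Λ) s)⁻¹ := by
  have h1 := h.inv.boost_inv_skyMap s
  rwa [lorentzInv_lorentzInv] at h1

lemma continuous_spatial (Λ : Matrix (Fin 4) (Fin 4) ℝ) : Continuous (spatial Λ) := by
  refine (PiLp.continuous_toLp 2 _).comp (continuous_pi fun i => ?_)
  fin_cases i <;> simp [Matrix.mulVec, dotProduct, Fin.sum_univ_four, nullExt] <;> fun_prop

lemma continuous_boost (h : IsLorentz Λ) : Continuous (boost Λ) := by
  have e : boost Λ = fun s : S2 => ‖spatial Λ s‖ := funext h.boost_eq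
  rw [e]
  exact (continuous_spatial Λ).norm.comp continuous_subtype_val

lemma continuous_skyMap (h : IsLorentz Λ) : Continuous (skyMap Λ h) :=
  Continuous.subtype_mk ((h.continuous_boost.inv₀ fun s => (h.boost_pos s).ne').smul
    ((continuous_spatial Λ).comp continuous_subtype_val)) _

end IsLorentz

end Lorentz

/-! ### The Jacobian of the action on the celestial sphere. -/

section Jacobian

/-- The derivative of the action of a Lorentz matrix on spatial parts of null vectors. -/
def spatialDeriv (Λ : Matrix (Fin 4) (Fin 4) ℝ) (x : E3) : E3 →L[ℝ] E3 :=
  (‖x‖⁻¹ • innerSL ℝ x).smulRight !₂[Λ 1 0, Λ 2 0, Λ 3 0]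
    + (Matrix.toEuclideanLin (Matrix.of fun i j : Fin 3 => Λ i.succ j.succ)).toContinuousLinearMap

lemma spatial_eq_add (Λ : Matrix (Fin 4) (Fin 4) ℝ) (x : E3) : spatial Λ x
    = ‖x‖ • !₂[Λ 1 0, Λ 2 0, Λ 3 0]
      + (Matrix.toEuclideanLin (Matrix.of fun i j : Fin 3 => Λ i.succ j.succ)) x := by
  ext i
  fin_cases i <;> simp [spatial, Matrix.mulVec, dotProduct, Fin.sum_univ_four, Fin.sum_univ_three,
    nullExt] <;> ring

lemma hasFDerivAt_spatial (Λ : Matrix (Fin 4) (Fin 4) ℝ) {x : E3} (hx : x ≠ 0) :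
    HasFDerivAt (spatial Λ) (spatialDeriv Λ x) x := by
  have h0 : ‖x‖ ≠ 0 := norm_ne_zero_iff.2 hx
  have hn : HasFDerivAt (fun x : E3 => ‖x‖) (‖x‖⁻¹ • innerSL ℝ x) x := by
    have h1 := ((hasStrictFDerivAt_norm_sq x).hasFDerivAt).sqrt (pow_ne_zero 2 h0)
    have e : (fun y : E3 => √(‖y‖ ^ 2)) = fun y => ‖y‖ := by
      funext y
      rw [Real.sqrt_sq (norm_nonneg y)]
    rw [e] at h1
    refine h1.congr_fderiv ?_
    ext v
    simp [Real.sqrt_sq (norm_nonneg x)]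
    field_simp
  have e : spatial Λ = fun x => ‖x‖ • !₂[Λ 1 0, Λ 2 0, Λ 3 0]
      + (Matrix.toEuclideanLin (Matrix.of fun i j : Fin 3 => Λ i.succ j.succ)).toContinuousLinearMap
        x := funext (spatial_eq_add Λ)
  rw [e]
  exact (hn.smul_const _).add (ContinuousLinearMap.hasFDerivAt _)

lemma adjugate_lorentz {Λ : Matrix (Fin 4) (Fin 4) ℝ} (h : IsLorentz Λ) :
    Λ.adjugate = Λ.det • lorentzInv Λ := by
  calc Λ.adjugate = Λ.adjugate * (Λ * lorentzInv Λ) := by rw [h.mul_inv, mul_one]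
    _ = _ := by rw [← Matrix.mul_assoc, Matrix.adjugate_mul, Matrix.smul_mul, one_mul]

lemma abs_det_lorentz {Λ : Matrix (Fin 4) (Fin 4) ℝ} (h : IsLorentz Λ) : |Λ.det| = 1 := by
  have h1 := congrArg Matrix.det h.isometry
  rw [Matrix.det_mul, Matrix.det_mul, Matrix.det_transpose] at h1
  have h2 : minkowski.det ≠ 0 := by
    simp [minkowski, Matrix.det_diagonal, Fin.prod_univ_four]
  have h3 : Λ.det ^ 2 = 1 := by
    have : minkowski.det * (Λ.det ^ 2) = minkowski.det * 1 := by linear_combination h1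
    exact mul_left_cancel₀ h2 this
  rwa [← sq_abs, pow_eq_one_iff_of_nonneg (abs_nonneg _) two_ne_zero] at h3

/-- This is the Lorentz invariance of `d³x/|x|`. The `3 × 3` determinant is written as that of `Λ`
with first row `(1, -x/|x|)`, and expansion along that row is evaluated with the adjugate, which is
known because `Λ⁻¹ = ηΛᵀη`. -/
lemma det_spatialDeriv {Λ : Matrix (Fin 4) (Fin 4) ℝ} (h : IsLorentz Λ) {x : E3} (hx : x ≠ 0) :
    |(spatialDeriv Λ x).det| = ‖spatial Λ x‖ / ‖x‖ := by
  have h0 : ‖x‖ ≠ 0 := norm_ne_zero_iff.2 hx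
  let b := (EuclideanSpace.basisFun (Fin 3) ℝ).toBasis
  have hm : LinearMap.toMatrix b b (spatialDeriv Λ x).toLinearMap
      = Matrix.of fun i j : Fin 3 => ‖x‖⁻¹ * x j * Λ i.succ 0 + Λ i.succ j.succ := by
    ext i j
    rw [LinearMap.toMatrix_apply]
    fin_cases i <;> fin_cases j <;>
      simp [b, spatialDeriv, EuclideanSpace.inner_single_right,
        Matrix.toLpLin_apply]
  have hd : (spatialDeriv Λ x).det = (Matrix.of fun i j : Fin 3 =>
      ‖x‖⁻¹ * x j * Λ i.succ 0 + Λ i.succ j.succ).det := by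
    rw [← hm, LinearMap.det_toMatrix]
  have h4 : (Matrix.of fun i j : Fin 3 => ‖x‖⁻¹ * x j * Λ i.succ 0 + Λ i.succ j.succ).det
      = (Λ.updateRow 0 ![1, -(‖x‖⁻¹ * x 0), -(‖x‖⁻¹ * x 1), -(‖x‖⁻¹ * x 2)]).det := by
    have e1 : Fin.succAbove (1 : Fin 4) (2 : Fin 3) = 3 := rfl
    have e2 : Fin.succAbove (2 : Fin 4) (2 : Fin 3) = 3 := rfl
    have e3 : Fin.succAbove (3 : Fin 4) (2 : Fin 3) = 2 := rfl
    simp [Matrix.det_succ_row_zero, Fin.sum_univ_succ, Matrix.updateRow_apply, e1, e2, e3]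
    ring
  have h5 : (Λ.updateRow 0 ![1, -(‖x‖⁻¹ * x 0), -(‖x‖⁻¹ * x 1), -(‖x‖⁻¹ * x 2)]).det
      = Λ.det * (‖x‖⁻¹ * ‖spatial Λ x‖) := by
    rw [← Matrix.cramer_transpose_apply, Matrix.cramer_eq_adjugate_mulVec, ← Matrix.adjugate_transpose,
      adjugate_lorentz h, h.norm_spatial]
    simp [lorentzInv, minkowski, Matrix.mulVec, dotProduct, Fin.sum_univ_four, nullExt]
    field_simp
    ring
  rw [hd, h4, h5, abs_mul, abs_det_lorentz h, one_mul, abs_of_nonneg (by positivity)]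
  ring

lemma lintegral_polar {F : E3 → ℝ≥0∞} (hF : Measurable F) :
    ∫⁻ x in {0}ᶜ, F x = ∫⁻ s : S2, (∫⁻ r : Ioi (0 : ℝ), F (r.1 • (s : E3))
      ∂Measure.volumeIoiPow 2) ∂sphereMeasure := by
  have h := (volume : Measure E3).measurePreserving_homeomorphUnitSphereProd
  rw [finrank_euclideanSpace_fin] at h
  have hG : Measurable fun p : S2 × Ioi (0 : ℝ) => F (p.2.1 • (p.1 : E3)) :=
    hF.comp (Continuous.measurable (by fun_prop))
  rw [← lintegral_subtype_comap (measurableSet_singleton _).compl]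
  refine Eq.trans ?_ ((h.lintegral_comp hG).trans (lintegral_prod _ hG.aemeasurable))
  refine lintegral_congr fun x => ?_
  congr 1
  have := congrArg Subtype.val ((homeomorphUnitSphereProd E3).symm_apply_apply x)
  rw [homeomorphUnitSphereProd_symm_apply_coe] at this
  exact this.symm

lemma image_spatial {Λ : Matrix (Fin 4) (Fin 4) ℝ} (h : IsLorentz Λ) :
    spatial Λ '' {0}ᶜ = {0}ᶜ := by
  ext y
  constructor
  · rintro ⟨x, hx, rfl⟩
    exact h.spatial_ne_zero hx
  · intro hy
    refine ⟨spatial (lorentzInv Λ) y, h.inv.spatial_ne_zero hy, ?_⟩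
    have := h.inv.spatial_inv y
    rwa [IsLorentz.lorentzInv_lorentzInv] at this

lemma injective_spatial {Λ : Matrix (Fin 4) (Fin 4) ℝ} (h : IsLorentz Λ) :
    Function.Injective (spatial Λ) :=
  Function.LeftInverse.injective h.spatial_inv

/-- The action of a Lorentz matrix on the sphere has the Jacobian `boost⁻²`. -/
theorem lintegral_skyMap {Λ : Matrix (Fin 4) (Fin 4) ℝ} (h : IsLorentz Λ) {f : S2 → ℝ≥0∞}
    (hf : Measurable f) :
    ∫⁻ s, ENNReal.ofReal ((boost Λ s)⁻¹ ^ 2) * f (skyMap Λ h s) ∂sphereMeasure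
      = ∫⁻ s, f s ∂sphereMeasure := by
  let g : E3 → ℝ≥0∞ := Function.extend Subtype.val f 0
  have hg : Measurable g := measurableEmbedding_sphere.measurable_extend hf measurable_zero
  have hgs : ∀ s : S2, g s = f s := fun s => Subtype.val_injective.extend_apply _ _ _
  -- The function `f` extended radially over the unit ball; in polar coordinates its integral is `⅓
  -- ∫ f`.
  let F : E3 → ℝ≥0∞ := fun y => (Metric.ball (0 : E3) 1).indicator (fun y => g (‖y‖⁻¹ • y)) y
  have hF : Measurable F :=
    Measurable.indicator (hg.comp (by fun_prop)) Metric.isOpen_ball.measurableSet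
  have hFs : ∀ (r : ℝ), 0 < r → ∀ s : S2, F (r • (s : E3)) = (Iio (1 : ℝ)).indicator (fun _ => f s) r := by
    intro r hr s
    have hn : ‖r • (s : E3)‖ = r := by
      rw [norm_smul, mem_sphere_zero_iff_norm.1 s.2, mul_one, Real.norm_of_nonneg hr.le]
    simp only [F]
    by_cases h1 : r < 1
    · rw [indicator_of_mem (show r • (s : E3) ∈ Metric.ball 0 1 by
        rw [mem_ball_zero_iff, hn]; exact h1), indicator_of_mem (show r ∈ Iio (1 : ℝ) from h1), hn,
        smul_smul, inv_mul_cancel₀ hr.ne', one_smul, hgs]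
    · rw [indicator_of_notMem (show r • (s : E3) ∉ Metric.ball 0 1 by
        rw [mem_ball_zero_iff, hn]; exact h1), indicator_of_notMem (show r ∉ Iio (1 : ℝ) from h1)]
  have hr3 : ∀ (ρ : ℝ), 0 < ρ → ∀ a : ℝ≥0∞, ∫⁻ r : Ioi (0 : ℝ), (Iio ρ).indicator (fun _ => a) r.1
      ∂Measure.volumeIoiPow 2 = ENNReal.ofReal (ρ ^ 3 / 3) * a := by
    intro ρ hρ a
    have e : (fun r : Ioi (0 : ℝ) => (Iio ρ).indicator (fun _ => a) r.1)
        = (Iio (⟨ρ, hρ⟩ : Ioi (0 : ℝ))).indicator fun _ => a := by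
      funext r
      simp only [indicator]
      rfl
    rw [e, lintegral_indicator_const measurableSet_Iio, Measure.volumeIoiPow_apply_Iio, mul_comm]
    norm_num
  have h1 : ∫⁻ y in {0}ᶜ, F y = ENNReal.ofReal (1 / 3) * ∫⁻ s, f s ∂sphereMeasure := by
    rw [lintegral_polar hF, ← lintegral_const_mul _ hf]
    refine lintegral_congr fun s => ?_
    rw [lintegral_congr fun r : Ioi (0 : ℝ) => hFs r.1 r.2 s, hr3 1 one_pos, one_pow]
  -- The same integral after the substitution by `spatial Λ`. In direction `s` the Jacobian is `κ`
  -- and the preimage of the ball has radius `κ⁻¹`, which gives `κ · κ⁻³/3 = κ⁻²/3`.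
  have h2 : ∫⁻ y in {0}ᶜ, F y = ENNReal.ofReal (1 / 3) *
      ∫⁻ s, ENNReal.ofReal ((boost Λ s)⁻¹ ^ 2) * f (skyMap Λ h s) ∂sphereMeasure := by
    have hcv := lintegral_image_eq_lintegral_abs_det_fderiv_mul volume
      (measurableSet_singleton (0 : E3)).compl
      (fun x hx => (hasFDerivAt_spatial Λ hx).hasFDerivWithinAt) (injective_spatial h).injOn F
    have hc := IsLorentz.continuous_spatial Λ
    have hm : Measurable fun x => ENNReal.ofReal (‖spatial Λ x‖ / ‖x‖) * F (spatial Λ x) :=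
      (Measurable.ennreal_ofReal (by fun_prop)).mul (hF.comp hc.measurable)
    have hm2 : Measurable fun s => ENNReal.ofReal ((boost Λ s)⁻¹ ^ 2) * f (skyMap Λ h s) :=
      (((h.continuous_boost.inv₀ fun s => (h.boost_pos s).ne').pow 2).measurable.ennreal_ofReal).mul
        (hf.comp h.continuous_skyMap.measurable)
    rw [image_spatial h] at hcv
    rw [hcv, setLIntegral_congr_fun (measurableSet_singleton (0 : E3)).compl (fun x hx => by
      rw [det_spatialDeriv h hx]), lintegral_polar hm, ← lintegral_const_mul _ hm2]
    refine lintegral_congr fun s => ?_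
    have hb := h.boost_pos s
    have e : ∀ r : Ioi (0 : ℝ), ENNReal.ofReal (‖spatial Λ (r.1 • (s : E3))‖ / ‖r.1 • (s : E3)‖)
        * F (spatial Λ (r.1 • (s : E3))) = ENNReal.ofReal (boost Λ s)
          * (Iio (boost Λ s)⁻¹).indicator (fun _ => f (skyMap Λ h s)) r.1 := by
      intro r
      have hr : 0 < r.1 := r.2
      rw [spatial_smul Λ hr.le, norm_smul, norm_smul, mem_sphere_zero_iff_norm.1 s.2, mul_one,
        ← h.boost_eq, mul_div_cancel_left₀ _ (norm_ne_zero_iff.2 hr.ne'), h.spatial_eq s, smul_smul,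
        hFs _ (mul_pos hr hb)]
      congr 1
      have : r.1 * boost Λ s ∈ Iio (1 : ℝ) ↔ r.1 ∈ Iio (boost Λ s)⁻¹ := by
        rw [mem_Iio, mem_Iio, ← one_div, lt_div_iff₀ hb]
      simp only [indicator, this]
    have hmi : Measurable fun r : Ioi (0 : ℝ) =>
        (Iio (boost Λ s)⁻¹).indicator (fun _ => f (skyMap Λ h s)) r.1 :=
      (measurable_const.indicator measurableSet_Iio).comp measurable_subtype_coe
    rw [lintegral_congr e, lintegral_const_mul _ hmi, hr3 _ (inv_pos.2 hb), ← mul_assoc, ← mul_assoc,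
      ← ENNReal.ofReal_mul hb.le, ← ENNReal.ofReal_mul (by norm_num)]
    congr 2
    field_simp
  rw [h1] at h2
  exact ((ENNReal.mul_right_inj (by simp) ENNReal.ofReal_ne_top).1 h2).symm

end Jacobian

/-! ### Invariance under Lorentz transformations of the cone. -/

section LorentzMaps

variable {Λ : Matrix (Fin 4) (Fin 4) ℝ}

/-- The transformations `(V, s) ↦ (κ(s)^p V, s')` of `𝒞` with `Λ (1, s) = κ(s) (1, s')`. -/
def lorentzMap (h : IsLorentz Λ) (p : ℤ) : ConeMap where
  base := skyMap Λ h
  scale s := boost Λ s ^ p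
  shift _ := 0
  weight s := (boost Λ s)⁻¹
  continuous_base := h.continuous_skyMap
  continuous_scale := h.continuous_boost.zpow₀ p fun s => Or.inl (h.boost_pos s).ne'
  continuous_shift := continuous_const
  continuous_weight := h.continuous_boost.inv₀ fun s => (h.boost_pos s).ne'
  scale_pos s := zpow_pos (h.boost_pos s) p
  weight_pos s := inv_pos.2 (h.boost_pos s)
  lintegral_base _ hf := lintegral_skyMap h hf

lemma isInverse_lorentzMap (h : IsLorentz Λ) (p : ℤ) :
    (lorentzMap h p).IsInverse (lorentzMap h.inv p) where
  right_inv x := by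
    refine Prod.ext ?_ (h.skyMap_skyMap_inv x.2)
    simp only [ConeMap.map, lorentzMap, add_zero]
    rw [h.boost_skyMap_inv, inv_zpow, inv_mul_cancel_left₀ (zpow_pos (h.inv.boost_pos _) p).ne']
  left_inv x := by
    refine Prod.ext ?_ (h.skyMap_inv_skyMap x.2)
    simp only [ConeMap.map, lorentzMap, add_zero]
    rw [h.boost_inv_skyMap, inv_zpow, inv_mul_cancel_left₀ (zpow_pos (h.boost_pos _) p).ne']
  weight s := by
    simp only [lorentzMap]
    rw [h.boost_inv_skyMap, inv_inv, inv_mul_cancel₀ (h.boost_pos s).ne']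

/-- The affine function extending `boost` from the sphere. -/
def boostExt (Λ : Matrix (Fin 4) (Fin 4) ℝ) (x : E3) : ℝ := (Λ *ᵥ ![1, x 0, x 1, x 2]) 0

lemma contDiff_boostExt (Λ : Matrix (Fin 4) (Fin 4) ℝ) : ContDiff ℝ ∞ (boostExt Λ) := by
  unfold boostExt
  simp only [Matrix.mulVec, dotProduct, Fin.sum_univ_four]
  simp only [Matrix.cons_val]
  fun_prop

/-- The affine map extending the spatial part from the sphere. -/
def spatialExt (Λ : Matrix (Fin 4) (Fin 4) ℝ) (x : E3) : E3 :=
  !₂[(Λ *ᵥ ![1, x 0, x 1, x 2]) 1, (Λ *ᵥ ![1, x 0, x 1, x 2]) 2, (Λ *ᵥ ![1, x 0, x 1, x 2]) 3]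

lemma contDiff_spatialExt (Λ : Matrix (Fin 4) (Fin 4) ℝ) : ContDiff ℝ ∞ (spatialExt Λ) := by
  refine contDiff_euclidean.2 fun i => ?_
  fin_cases i <;> simp [spatialExt, Matrix.mulVec, dotProduct, Fin.sum_univ_four] <;> fun_prop

lemma spatialExt_sphere (Λ : Matrix (Fin 4) (Fin 4) ℝ) (s : S2) :
    spatialExt Λ s = spatial Λ s := by
  rw [spatial, nullExt_sphere]
  rfl

/-- The smooth extension of a Lorentz transformation of the sphere. -/
def lorentzExtension (h : IsLorentz Λ) (p : ℤ) (hp : p = 1 ∨ p = -1) :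
    (lorentzMap h p).SmoothExtension where
  -- The affine extension is smooth everywhere, unlike the null vector built from the norm; on this
  -- open neighbourhood of the sphere its inverse is smooth too.
  dom := {x | 0 < boostExt Λ x}
  scale x := boostExt Λ x ^ p
  weight x := (boostExt Λ x)⁻¹
  base x := (boostExt Λ x)⁻¹ • spatialExt Λ x
  isOpen_dom := isOpen_lt continuous_const (contDiff_boostExt Λ).continuous
  sphere_subset x hx := h.boost_pos ⟨x, hx⟩
  contDiffOn_scale := by
    rcases hp with rfl | rfl
    · simpa using (contDiff_boostExt Λ).contDiffOn
    · simp only [zpow_neg_one]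
      exact (contDiff_boostExt Λ).contDiffOn.inv fun x (hx : 0 < boostExt Λ x) => hx.ne'
  contDiffOn_weight :=
    (contDiff_boostExt Λ).contDiffOn.inv fun x (hx : 0 < boostExt Λ x) => hx.ne'
  contDiffOn_base :=
    ((contDiff_boostExt Λ).contDiffOn.inv fun x (hx : 0 < boostExt Λ x) => hx.ne').smul
      (contDiff_spatialExt Λ).contDiffOn
  scale_pos _ hx := zpow_pos hx p
  scale_eq _ := rfl
  weight_eq _ := rfl
  base_eq s := by
    rw [spatialExt_sphere]
    rfl
  shift_eq _ := rfl

/-- The two-point function ignores the scale, so both exponents are handled together: `p = 1` for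
changes of frame and `p = -1` for the BMS action, with the same weight. -/
theorem lorentz_invariance (h : IsLorentz Λ) {p : ℤ} (hp : p = 1 ∨ p = -1)
    {Ω : FieldAlg TestSpace →ₗ[ℂ] ℂ}
    (hΩ : IsQuasiFree sympl (fun ψ χ => twoPointForm ψ χ) Ω) {g : Cone → Cone} {w : Cone → ℝ}
    (hg : ∀ x, g x = (boost Λ x.2 ^ p * x.1, skyMap Λ h x.2)) (hw : ∀ x, w x = boost Λ x.2) :
    IsInvariantUnder Ω g w ∧ PreservesConeTest g w := by
  have e1 : g = (lorentzMap h p).map := by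
    funext x
    rw [hg]
    simp [ConeMap.map, lorentzMap]
  have e2 : w = fun x => ((lorentzMap h p).weight x.2)⁻¹ := by
    funext x
    rw [hw]
    exact (inv_inv _).symm
  rw [e1, e2]
  exact ⟨(isInverse_lorentzMap h p).isInvariantUnder hΩ,
    (isInverse_lorentzMap h p).preservesConeTest (lorentzExtension h p hp)
      (lorentzExtension h.inv p hp)⟩

lemma isLorentz_of_mem {Λ : Matrix (Fin 4) (Fin 4) ℝ} (h : Λ ∈ SO031) : IsLorentz Λ := ⟨h.1, h.2.2⟩

theorem frameChange_invariance {Ω : FieldAlg TestSpace →ₗ[ℂ] ℂ}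
    (hΩ : IsQuasiFree sympl (fun ψ χ => twoPointForm ψ χ) Ω) (Λ : SO031) :
    IsInvariantUnder Ω (frameChange Λ) (frameWeight Λ) ∧
      PreservesConeTest (frameChange Λ) (frameWeight Λ) := by
  refine lorentz_invariance (isLorentz_of_mem Λ.2) (p := 1) (Or.inl rfl) hΩ (fun x => ?_)
    fun x => rfl
  rw [zpow_one]
  refine Prod.ext rfl (Subtype.ext ?_)
  simp only [frameChange, celestial, skyMap, spatial, nullExt_sphere]

end LorentzMaps

/-! ### The spinor map from `SL(2,ℂ)` to Lorentz matrices. -/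

section Spinors

open ComplexConjugate

/-- The null vector of a spinor. -/
def spinVec (ξ η : ℂ) : Fin 4 → ℝ :=
  ![Complex.normSq ξ + Complex.normSq η, 2 * (ξ * conj η).re, 2 * (ξ * conj η).im,
    Complex.normSq ξ - Complex.normSq η]

/-- The Lorentz matrix of an element of `SL(2,ℂ)` with entries `a`, `b`, `c`, `d`. -/
def spinMatrix (a b c d : ℂ) : Matrix (Fin 4) (Fin 4) ℝ :=
  !![(Complex.normSq a + Complex.normSq b + Complex.normSq c + Complex.normSq d) / 2,
      (a * conj b + c * conj d).re, -(a * conj b + c * conj d).im,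
      (Complex.normSq a - Complex.normSq b + Complex.normSq c - Complex.normSq d) / 2;
    (a * conj c + b * conj d).re, (a * conj d + b * conj c).re, (b * conj c - a * conj d).im,
      (a * conj c - b * conj d).re;
    (a * conj c + b * conj d).im, (a * conj d + b * conj c).im, (a * conj d - b * conj c).re,
      (a * conj c - b * conj d).im;
    (Complex.normSq a + Complex.normSq b - Complex.normSq c - Complex.normSq d) / 2,
      (a * conj b - c * conj d).re, -(a * conj b - c * conj d).im,
      (Complex.normSq a - Complex.normSq b - Complex.normSq c + Complex.normSq d) / 2]

/-- A null vector corresponds to the hermitian matrix `vv*` of the spinor `v = (ξ, η)`, and `A` acts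
by `vv* ↦ (Av)(Av)*`. -/
lemma spinMatrix_mulVec (a b c d ξ η : ℂ) :
    spinMatrix a b c d *ᵥ spinVec ξ η = spinVec (a * ξ + b * η) (c * ξ + d * η) := by
  funext i
  fin_cases i <;> simp [spinMatrix, spinVec, Matrix.mulVec, dotProduct, Fin.sum_univ_four,
    Complex.normSq_apply] <;> ring

lemma isLorentz_spinMatrix {a b c d : ℂ} (h : a * d - b * c = 1) :
    IsLorentz (spinMatrix a b c d) where
  isometry := by
    -- Only `|ad - bc|² = 1` enters the isometry condition, and only in its diagonal entries.
    have h1 := congrArg Complex.normSq h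
    simp [Complex.normSq_apply] at h1
    ext i j
    fin_cases i <;> fin_cases j <;>
      simp [spinMatrix, minkowski, Matrix.mul_apply, Fin.sum_univ_four, Complex.normSq_apply]
    · linear_combination -h1
    · ring
    · ring
    · ring
    · ring
    · linear_combination h1
    · ring
    · ring
    · ring
    · ring
    · linear_combination h1
    · ring
    · ring
    · ring
    · ring
    · linear_combination h1
  pos := by
    have h0 : 0 < Complex.normSq a + Complex.normSq b + Complex.normSq c + Complex.normSq d := by
      have ha := Complex.normSq_nonneg a
      have hb := Complex.normSq_nonneg b
      have hc := Complex.normSq_nonneg c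
      have hd := Complex.normSq_nonneg d
      refine lt_of_le_of_ne (by positivity) fun h0 => ?_
      have ha0 : a = 0 := Complex.normSq_eq_zero.1 (by linarith)
      have hb0 : b = 0 := Complex.normSq_eq_zero.1 (by linarith)
      rw [ha0, hb0] at h
      simp at h
    simpa [spinMatrix] using h0

/-- The point of the Riemann sphere with given homogeneous coordinates. -/
def projPoint (ξ η : ℂ) : OnePoint ℂ := if η = 0 then OnePoint.infty else ((ξ / η : ℂ) : OnePoint ℂ)

/-- Homogeneous coordinates treat the point at infinity like any other and make the conformal factor
a ratio of squared norms of spinors. -/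
lemma exists_projPoint (z : OnePoint ℂ) : ∃ ξ η : ℂ, (ξ ≠ 0 ∨ η ≠ 0) ∧ z = projPoint ξ η ∧
    ∀ A : Matrix.SpecialLinearGroup (Fin 2) ℂ, bmsFactor A z = (Complex.normSq ξ + Complex.normSq η)
      / (Complex.normSq (A.1 0 0 * ξ + A.1 0 1 * η)
        + Complex.normSq (A.1 1 0 * ξ + A.1 1 1 * η)) := by
  induction z using OnePoint.rec with
  | infty =>
    refine ⟨1, 0, Or.inl one_ne_zero, by simp [projPoint], fun A => ?_⟩
    change 1 / (Complex.normSq (A.1 0 0) + Complex.normSq (A.1 1 0)) = _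
    simp
  | coe z =>
    refine ⟨z, 1, Or.inr one_ne_zero, by simp [projPoint], fun A => ?_⟩
    change (1 + Complex.normSq z) / _ = _
    simp [add_comm]

lemma normSq_add_pos {ξ η : ℂ} (h : ξ ≠ 0 ∨ η ≠ 0) : 0 < Complex.normSq ξ + Complex.normSq η := by
  rcases h with h | h
  · exact add_pos_of_pos_of_nonneg (Complex.normSq_pos.2 h) (Complex.normSq_nonneg _)
  · exact add_pos_of_nonneg_of_pos (Complex.normSq_nonneg _) (Complex.normSq_pos.2 h)

lemma nullVec_projPoint {ξ η : ℂ} (h : ξ ≠ 0 ∨ η ≠ 0) :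
    nullVec (invStereo (projPoint ξ η)) = (Complex.normSq ξ + Complex.normSq η)⁻¹ • spinVec ξ η := by
  have h0 := normSq_add_pos h
  by_cases hη : η = 0
  · have e : invStereo (projPoint ξ η) = invStereo OnePoint.infty := by rw [projPoint, if_pos hη]
    have e' : ((invStereo OnePoint.infty : S2) : E3) = !₂[0, 0, 1] := rfl
    subst hη
    rw [map_zero, add_zero] at h0
    rw [e, nullVec, e']
    funext i
    fin_cases i <;> simp [spinVec, h0.ne']
  · have e : invStereo (projPoint ξ η) = invStereo ((ξ / η : ℂ) : OnePoint ℂ) := by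
      rw [projPoint, if_neg hη]
    have e' : ((invStereo ((ξ / η : ℂ) : OnePoint ℂ) : S2) : E3)
        = (1 + Complex.normSq (ξ / η))⁻¹ • !₂[2 * (ξ / η).re, 2 * (ξ / η).im,
          Complex.normSq (ξ / η) - 1] := rfl
    have hη' : Complex.normSq η ≠ 0 := (Complex.normSq_pos.2 hη).ne'
    have e1 : (ξ / η).re = (ξ * conj η).re / Complex.normSq η := by
      rw [Complex.div_re]
      simp
      ring
    have e2 : (ξ / η).im = (ξ * conj η).im / Complex.normSq η := by
      rw [Complex.div_im]
      simp
      ring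
    have e3 : (1 + Complex.normSq (ξ / η))⁻¹
        = (Complex.normSq ξ + Complex.normSq η)⁻¹ * Complex.normSq η := by
      rw [map_div₀, one_add_div hη', inv_div, add_comm (Complex.normSq η), div_eq_inv_mul]
    rw [e, nullVec, e', e1, e2, e3, map_div₀]
    funext i
    fin_cases i
    · simp [spinVec]
      field_simp
    · simp [spinVec]
      field_simp
    · simp [spinVec]
      field_simp
    · simp [spinVec]
      field_simp

lemma smul_projPoint (A : Matrix.SpecialLinearGroup (Fin 2) ℂ) {ξ η : ℂ} (h : ξ ≠ 0 ∨ η ≠ 0) :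
    (A : GL (Fin 2) ℂ) • projPoint ξ η
      = projPoint (A.1 0 0 * ξ + A.1 0 1 * η) (A.1 1 0 * ξ + A.1 1 1 * η) := by
  by_cases hη : η = 0
  · subst hη
    have hξ : ξ ≠ 0 := by simpa using h
    rw [projPoint, if_pos rfl, OnePoint.smul_infty_eq_ite]
    simp only [projPoint, mul_zero, add_zero, mul_eq_zero, hξ, or_false]
    rw [mul_div_mul_right _ _ hξ]
    rfl
  · rw [projPoint, if_neg hη, OnePoint.smul_some_eq_ite]
    have e1 : ∀ a b : ℂ, a * (ξ / η) + b = (a * ξ + b * η) / η := by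
      intro a b
      field_simp
    simp only [projPoint, e1, div_div_div_cancel_right₀ hη, div_eq_zero_iff, hη, or_false]
    rfl

lemma invStereo_stereo (s : S2) : invStereo (stereo s) = s := by
  have hs : (s : E3) 0 ^ 2 + (s : E3) 1 ^ 2 + (s : E3) 2 ^ 2 = 1 := by
    rw [← norm_sq_E3, mem_sphere_zero_iff_norm.1 s.2, one_pow]
  refine Subtype.ext ?_
  by_cases h : (s : E3) 2 = 1
  · have e : ((invStereo (stereo s) : S2) : E3) = !₂[0, 0, 1] := by
      rw [stereo, if_pos h]
      rfl
    rw [h] at hs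
    have h0 : (s : E3) 0 = 0 := by nlinarith [sq_nonneg ((s : E3) 0), sq_nonneg ((s : E3) 1)]
    have h1 : (s : E3) 1 = 0 := by nlinarith [sq_nonneg ((s : E3) 0), sq_nonneg ((s : E3) 1)]
    rw [e]
    ext i
    fin_cases i <;> simp [h0, h1, h]
  · let z : ℂ := ((((s : E3) 0 : ℝ) : ℂ) + Complex.I * (((s : E3) 1 : ℝ) : ℂ))
      / (1 - (((s : E3) 2 : ℝ) : ℂ))
    have e : ((invStereo (stereo s) : S2) : E3)
        = (1 + Complex.normSq z)⁻¹ • !₂[2 * z.re, 2 * z.im, Complex.normSq z - 1] := by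
      rw [stereo, if_neg h]
      rfl
    have h' : 1 - (s : E3) 2 ≠ 0 := sub_ne_zero.2 (Ne.symm h)
    have hz : z = ⟨(s : E3) 0 / (1 - (s : E3) 2), (s : E3) 1 / (1 - (s : E3) 2)⟩ := by
      have h'' : (1 - (((s : E3) 2 : ℝ) : ℂ)) ≠ 0 := by
        rw [← Complex.ofReal_one, ← Complex.ofReal_sub]
        exact Complex.ofReal_ne_zero.2 h'
      simp only [z]
      rw [div_eq_iff h'']
      apply Complex.ext <;> simp <;> field_simp
    have hn : Complex.normSq z = (1 + (s : E3) 2) / (1 - (s : E3) 2) := by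
      rw [hz, Complex.normSq_mk]
      field_simp
      linear_combination hs
    have hn1 : (1 + Complex.normSq z)⁻¹ = (1 - (s : E3) 2) / 2 := by
      rw [hn, one_add_div h', inv_div]
      congr 1
      ring
    rw [e, hn1, hn, hz]
    ext i
    fin_cases i <;> simp <;> field_simp
    ring

lemma nullVec_injective {s t : S2} (h : nullVec s = nullVec t) : s = t := by
  refine Subtype.ext ?_
  ext i
  fin_cases i
  · simpa [nullVec] using congrFun h 1
  · simpa [nullVec] using congrFun h 2
  · simpa [nullVec] using congrFun h 3

lemma nullVec_skyMap {Λ : Matrix (Fin 4) (Fin 4) ℝ} (h : IsLorentz Λ) (s : S2) :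
    nullVec (skyMap Λ h s) = (boost Λ s)⁻¹ • (Λ *ᵥ nullVec s) := by
  rw [← nullExt_sphere, skyMap, nullExt_smul (inv_nonneg.2 (h.boost_pos s).le), h.nullExt_spatial,
    nullExt_sphere]

/-- The Lorentz matrix of an element of `SL(2,ℂ)`. -/
def spinCover (A : Matrix.SpecialLinearGroup (Fin 2) ℂ) : Matrix (Fin 4) (Fin 4) ℝ :=
  spinMatrix (A.1 0 0) (A.1 0 1) (A.1 1 0) (A.1 1 1)

lemma det_entries (A : Matrix.SpecialLinearGroup (Fin 2) ℂ) :
    A.1 0 0 * A.1 1 1 - A.1 0 1 * A.1 1 0 = 1 := by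
  rw [← Matrix.det_fin_two]
  exact A.2

lemma isLorentz_spinCover (A : Matrix.SpecialLinearGroup (Fin 2) ℂ) : IsLorentz (spinCover A) :=
  isLorentz_spinMatrix (det_entries A)

lemma image_ne_zero (A : Matrix.SpecialLinearGroup (Fin 2) ℂ) {ξ η : ℂ} (h : ξ ≠ 0 ∨ η ≠ 0) :
    A.1 0 0 * ξ + A.1 0 1 * η ≠ 0 ∨ A.1 1 0 * ξ + A.1 1 1 * η ≠ 0 := by
  by_contra! hc
  have hd := det_entries A
  have h1 : ξ = 0 := by linear_combination -ξ * hd + A.1 1 1 * hc.1 - A.1 0 1 * hc.2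
  have h2 : η = 0 := by linear_combination -η * hd + A.1 0 0 * hc.2 - A.1 1 0 * hc.1
  simp [h1, h2] at h

/-- The null vector of `s` is the normalised null vector of its spinor. The boost is therefore the
ratio of the squared norms after and before `A`, which is `K⁻¹`, and the direction of the image is
the Möbius image. -/
lemma spinCover_eq (A : Matrix.SpecialLinearGroup (Fin 2) ℂ) (s : S2) :
    boost (spinCover A) s = (bmsFactor A (stereo s))⁻¹ ∧
      skyMap (spinCover A) (isLorentz_spinCover A) s = mobius A s := by
  obtain ⟨ξ, η, h0, hz, hK⟩ := exists_projPoint (stereo s)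
  have h1 := normSq_add_pos h0
  have h2 := normSq_add_pos (image_ne_zero A h0)
  have hs : spinCover A *ᵥ nullVec s = (Complex.normSq ξ + Complex.normSq η)⁻¹
      • spinVec (A.1 0 0 * ξ + A.1 0 1 * η) (A.1 1 0 * ξ + A.1 1 1 * η) := by
    rw [← invStereo_stereo s, hz, nullVec_projPoint h0, Matrix.mulVec_smul, spinCover,
      spinMatrix_mulVec]
  have hb : boost (spinCover A) s = (bmsFactor A (stereo s))⁻¹ := by
    rw [boost, hs, hK]
    simp [spinVec]
    field_simp
  refine ⟨hb, nullVec_injective ?_⟩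
  rw [nullVec_skyMap, hs, hb, hK, inv_inv, mobius, hz, smul_projPoint A h0,
    nullVec_projPoint (image_ne_zero A h0), smul_smul]
  congr 1
  field_simp

theorem bmsMap_invariance {Ω : FieldAlg TestSpace →ₗ[ℂ] ℂ}
    (hΩ : IsQuasiFree sympl (fun ψ χ => twoPointForm ψ χ) Ω)
    (A : Matrix.SpecialLinearGroup (Fin 2) ℂ) :
    IsInvariantUnder Ω (bmsMap A) (bmsWeight A) ∧ PreservesConeTest (bmsMap A) (bmsWeight A) := by
  refine lorentz_invariance (isLorentz_spinCover A) (p := -1) (Or.inr rfl) hΩ (fun x => ?_)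
    fun x => (spinCover_eq A x.2).1.symm
  rw [zpow_neg_one, (spinCover_eq A x.2).1, (spinCover_eq A x.2).2, inv_inv]
  rfl

end Spinors

/-! ### Restriction to `𝒞_p` and the final assembly. -/

/-- Restriction of a state to a subalgebra of fields. -/
lemma IsAlgState.comp {T T' : Type} [AddCommGroup T] [Module ℂ T] [AddCommGroup T'] [Module ℂ T']
    {σ : T →ₗ[ℂ] T →ₗ[ℂ] ℂ} {σ' : T' →ₗ[ℂ] T' →ₗ[ℂ] ℂ} {c : T →ₛₗ[starRingEnd ℂ] T}
    {c' : T' →ₛₗ[starRingEnd ℂ] T'} {Ω : FieldAlg T' →ₗ[ℂ] ℂ} (hΩ : IsAlgState σ' c' Ω)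
    (U : T →ₗ[ℂ] T') (hσ : ∀ ψ χ, σ' (U ψ) (U χ) = σ ψ χ) (hc : ∀ ψ, U (c ψ) = c' (U ψ)) :
    IsAlgState σ c (Ω ∘ₗ (secondQuant U).toLinearMap) := by
  refine ⟨?_, fun F => ?_⟩
  · rw [LinearMap.comp_apply, AlgHom.toLinearMap_apply, map_one, hΩ.1]
  · rw [LinearMap.comp_apply, AlgHom.toLinearMap_apply, secondQuant_starProd U hσ,
      secondQuant_starOp U hc]
    exact hΩ.2 _

lemma twoPoint_eq_twoPointForm : twoPoint = fun ψ χ => twoPointForm ψ χ :=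
  funext fun ψ => funext fun χ => twoPoint_eq ψ χ

lemma isQuasiFree_iff {T : Type} [AddCommGroup T] [Module ℂ T] {σ : T →ₗ[ℂ] T →ₗ[ℂ] ℂ}
    {w : T → T → ℂ} {Ω : FieldAlg T →ₗ[ℂ] ℂ} (h : IsQuasiFree σ w Ω) (Ω' : FieldAlg T →ₗ[ℂ] ℂ) :
    IsQuasiFree σ w Ω' ↔ Ω' = Ω :=
  ⟨fun h' => h'.unique h, fun e => e ▸ h⟩

/-- A quasi-free state pulls back along an injection of test functions to the unique quasi-free
functional, which is again a state. -/
lemma IsQuasiFree.exists_comap {T T' : Type} [AddCommGroup T] [Module ℂ T] [AddCommGroup T']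
    [Module ℂ T'] {σ : T →ₗ[ℂ] T →ₗ[ℂ] ℂ} {σ' : T' →ₗ[ℂ] T' →ₗ[ℂ] ℂ}
    {c : T →ₛₗ[starRingEnd ℂ] T} {c' : T' →ₛₗ[starRingEnd ℂ] T'} {w : T → T → ℂ}
    {w' : T' → T' → ℂ} {Ω : FieldAlg T' →ₗ[ℂ] ℂ} (hΩ : IsQuasiFree σ' w' Ω)
    (hstate : IsAlgState σ' c' Ω) (U : T →ₗ[ℂ] T') (hσ : ∀ ψ χ, σ' (U ψ) (U χ) = σ ψ χ)
    (hw : ∀ ψ χ, w' (U ψ) (U χ) = w ψ χ) (hc : ∀ ψ, U (c ψ) = c' (U ψ)) :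
    ∃ Ωp : FieldAlg T →ₗ[ℂ] ℂ, (∀ Ω' : FieldAlg T →ₗ[ℂ] ℂ, IsQuasiFree σ w Ω' ↔ Ω' = Ωp) ∧
      IsAlgState σ c Ωp ∧ ∀ F, Ωp F = Ω (secondQuant U F) :=
  ⟨Ω ∘ₗ (secondQuant U).toLinearMap, isQuasiFree_iff (hΩ.comp U hσ hw), hstate.comp U hσ hc,
    fun _ => rfl⟩

/-- A quasi-free state on the algebra over `T` restricts to one on the algebra over a subspace. -/
lemma IsQuasiFree.exists_restrict {T : Type} [AddCommGroup T] [Module ℂ T] (S : Submodule ℂ T)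
    {σ : T →ₗ[ℂ] T →ₗ[ℂ] ℂ} {σ' : S →ₗ[ℂ] S →ₗ[ℂ] ℂ}
    {c : T →ₛₗ[starRingEnd ℂ] T} {c' : S →ₛₗ[starRingEnd ℂ] S} {w : T → T → ℂ}
    {Ω : FieldAlg T →ₗ[ℂ] ℂ} (hΩ : IsQuasiFree σ w Ω)
    (hstate : IsAlgState σ c Ω) (hσ : σ' = σ.compl₁₂ S.subtype S.subtype)
    (hc : ∀ ψ, S.subtype (c' ψ) = c (S.subtype ψ)) :
    ∃ Ωp : FieldAlg S →ₗ[ℂ] ℂ,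
      (∀ Ω' : FieldAlg S →ₗ[ℂ] ℂ, IsQuasiFree σ' (fun ψ χ => w ψ.1 χ.1) Ω' ↔ Ω' = Ωp) ∧
      IsAlgState σ' c' Ωp ∧ ∀ F, Ωp F = Ω (secondQuant S.subtype F) :=
  hΩ.exists_comap hstate S.subtype (fun _ _ => by rw [hσ]; rfl) (fun _ _ => rfl) hc

end LightCone

end

theorem mainTheorem7 :
    -- the two-point function is well defined
    (∀ ψ ψ' : TestSpace,
      (∀ ε : ℝ, 0 < ε → Integrable (twoPointIntegrand ε ψ ψ') twoPointMeasure) ∧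
      Tendsto (fun ε => regTwoPoint ε ψ ψ') (𝓝[>] 0) (𝓝 (twoPoint ψ ψ'))) ∧
    ∃ Ω : FieldAlg TestSpace →ₗ[ℂ] ℂ,
      -- the quasi-free functional exists, is unique, and is a state on the algebra of `𝒞`
      (∀ Ω' : FieldAlg TestSpace →ₗ[ℂ] ℂ, IsQuasiFree sympl twoPoint Ω' ↔ Ω' = Ω) ∧
      IsAlgState sympl conjTest Ω ∧
      -- the same on the algebra of `𝒞_p`, where the functional is the restriction of `Ω`
      (∀ h : ℝ × E3 → ℝ, IsConeWeight h →
        (∀ f : ℝ × E3 → ℂ, ContDiff ℝ ∞ f → HasCompactSupport f →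
          ∃ ψ ∈ coneTest h, (toL2 ψ : Cone → ℂ) =ᵐ[coneMeasure] coneFun h f) ∧
        ∃ Ωp : FieldAlg (coneTest h) →ₗ[ℂ] ℂ,
          (∀ Ω' : FieldAlg (coneTest h) →ₗ[ℂ] ℂ,
            IsQuasiFree (symplCone h) (fun ψ ψ' => twoPoint ψ.1 ψ'.1) Ω' ↔ Ω' = Ωp) ∧
          IsAlgState (symplCone h) (conjCone h) Ωp ∧
          ∀ F, Ωp F = Ω (secondQuant (coneTest h).subtype F)) ∧
      -- vacuum with respect to `∂_V`
      IsVacuum Ω ∧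
      -- invariance under changes of the local frame
      (∀ Λ : SO031, IsInvariantUnder Ω (frameChange Λ) (frameWeight Λ) ∧
        PreservesConeTest (frameChange Λ) (frameWeight Λ)) ∧
      -- invariance under the Lorentz subgroup of the BMS group
      (∀ A : Matrix.SpecialLinearGroup (Fin 2) ℂ,
        IsInvariantUnder Ω (bmsMap A) (bmsWeight A) ∧
        PreservesConeTest (bmsMap A) (bmsWeight A)) := by
  obtain ⟨S, hS, hΩ, hstate⟩ := isTwoPointForm_twoPointForm.exists_state
  refine ⟨fun ψ ψ' => ⟨fun ε hε => integrable_twoPointIntegrand ψ ψ' hε, ?_⟩,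
    vacuumPart.toLinearMap ∘ₗ S, ?_, hstate, fun h hh =>
      ⟨fun f hf hfs => exists_mem_coneTest hh hf hfs, ?_⟩,
    isVacuum_of_isWickMap hS hΩ, frameChange_invariance hΩ, bmsMap_invariance hΩ⟩
  · rw [twoPoint_eq]
    exact tendsto_regTwoPoint ψ ψ'
  · rw [twoPoint_eq_twoPointForm]
    exact isQuasiFree_iff hΩ
  · rw [twoPoint_eq_twoPointForm]
    exact IsQuasiFree.exists_restrict (coneTest h) (σ' := symplCone h) (c' := conjCone h) hΩ hstate
      rfl fun _ => rfl
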